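/- **Setting.** Consider a discounted MDP with (measurable) state space $\mathcal S$, finite action set $\mathcal A$ with $|\mathcal A|\ge 2$, transition kernel $P$, reward $r:\mathcal S\times\mathcal A\to[0,1]$, deterministic initial state $\rho$ and discount $\gamma\in(0,1)$. Policies are stationary; $V_\pi$, $Q_\pi$ are the expected discounted returns of $\pi$ and $V^*=\sup_\pi V_\pi$. Let $\phi:\mathcal S\times\mathcal A\to\mathbb R^d$, $d\ge1$, satisfy $\|\phi(s,a)\|_2\le1$; one evaluation of $\phi$ takes $\mathrm{poly}(d)$ operations and no query. **Algorithm (Confident MC-Politex)**, with inputs $\pi_0$ (arbitrary), $K,m,n,\lambda,\tau,\alpha$. It keeps an ordered core set $\mathcal C$ of state-action pairs; $\Phi_{\mathcal C}$ is the matrix with rows $\phi(z)$, $z\in\mathcal C$. A pair $(s,a)$ is *uncertain* if $\phi(s,a)^\top(\Phi_{\mathcal C}^\top\Phi_{\mathcal C}+\lambda I)^{-1}\phi(s,a)>\tau$. 1. Start with $\mathcal C=\emptyset$; for each $a\in\mathcal A$ in turn add $(\rho,a)$ if $\mathcal C=\emptyset$ or $(\rho,a)$ is uncertain. 2. For $k=1,\dots,K$: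 for each $z\in\mathcal C$ run $m$ rollouts from $z$. A rollout queries the simulator at $(s_0,a_0)=z$, receiving $r(s_0,a_0)$ and $s_1\sim P(\cdot\mid s_0,a_0)$; then for $t=1,\dots,n$ it checks all actions at $s_t$, and if some $(s_t,a)$ is uncertain, the first such pair is added to $\mathcal C$ and step 2 is restarted from $k=1$; otherwise it draws $a_t\sim\pi_{k-1}(\cdot\mid s_t)$ and queries the simulator at $(s_t,a_t)$, receiving the reward and $s_{t+1}$. Let $q_z$ be the average over the $m$ rollouts of $\sum_{t=0}^n\gamma^t r(s_t,a_t)$. Put $w_k=(\Phi_{\mathcal C}^\top\Phi_{\mathcal C}+\lambda I)^{-1}\Phi_{\mathcal C}^\top q$, $Q_{k-1}(s,a)=\min\{\max\{w_k^\top\phi(s,a),0\},(1-\gamma)^{-1}\}$ and $\pi_k(a\mid s)\propto\exp\big(\alpha\sum_{j=1}^{k-1}Q_j(s,a)\big)$. 3. When all $K$ iterations are completed, output the uniform mixture $\overline\pi_K$ of $\pi_0,\dots,\pi_{K-1}$, with value $V_{\overline\pi_K}:=\frac1K\sum_{k=0}^{K-1}V_{\pi_k}$. The *query cost* is the largest possible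 number of simulator calls; the *computational cost* is the largest possible number of logical and arithmetic operations (on real numbers, at unit cost). Below, $K,n,m$ are rounded up to integers, $\tau=1$, $\alpha=(1-\gamma)\sqrt{2\log|\mathcal A|/K}$, $\delta\in(0,1)$, $b>0$, and $\log^+b=\max\{0,\log b\}$. **Theorem.** (a) Suppose that for every policy $\pi$ there is $w_\pi\in\mathbb R^d$ with $\|w_\pi\|_2\le b$ and $Q_\pi(s,a)=w_\pi^\top\phi(s,a)$ for all $(s,a)$. Let $\kappa>0$ and $$\lambda=\frac{\kappa^2(1-\gamma)^2}{256b^2},\quad K=\frac{32\log|\mathcal A|}{\kappa^2(1-\gamma)^4},\quad n=\frac1{1-\gamma}\log\Big(\frac{32\sqrt d\,(1+\log(1+\lambda^{-1}))}{(1-\gamma)^2\kappa}\Big),$$ $$m=1024\,\frac{d(1+\log(1+\lambda^{-1}))}{\kappa^2(1-\gamma)^4}\log\Big(\frac{8Kd(1+\log(1+\lambda^{-1}))}{\delta}\Big).$$ Then with probability at least $1-\delta$ the algorithm terminates with an output satisfying $V^*(\rho)-V_{\overline\pi_K}(\rho)\le\kappa$. Its query cost is $\mathrm{poly}\big(d,\frac1{1-\gamma},\frac1\kappa,\log\frac1\delta,\log^+b,\log|\mathcal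 A|\big)$ and its computational cost is $\mathrm{poly}\big(d,\frac1{1-\gamma},\frac1\kappa,\log\frac1\delta,\log^+b,|\mathcal A|\big)$. (b) Suppose instead that, for some $\varepsilon>0$, for every policy $\pi$ there is $w_\pi\in\mathbb R^d$ with $\|w_\pi\|_2\le b$ and $|Q_\pi(s,a)-w_\pi^\top\phi(s,a)|\le\varepsilon$ for all $(s,a)$. Let $$\lambda=\frac{\varepsilon^2d}{b^2},\quad K=\frac{2\log|\mathcal A|}{\varepsilon^2d(1-\gamma)^2},\quad n=\frac1{1-\gamma}\log\Big(\frac1{\varepsilon(1-\gamma)}\Big),\quad m=\frac1{\varepsilon^2(1-\gamma)^2}\log\Big(\frac{8Kd(1+\log(1+\lambda^{-1}))}{\delta}\Big).$$ Then with probability at least $1-\delta$ the algorithm terminates with an output satisfying $$V^*(\rho)-V_{\overline\pi_K}(\rho)\le\frac{42\,\varepsilon\sqrt d}{1-\gamma}\Big(1+\log\big(1+b^2\varepsilon^{-2}d^{-1}\big)\Big).$$ Its query cost is $\mathrm{poly}\big(d,\frac1{1-\gamma},\frac1\varepsilon,\log\frac1\delta,\log^+b,\log|\mathcal A|\big)$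 and its computational cost is $\mathrm{poly}\big(d,\frac1{1-\gamma},\frac1\varepsilon,\log\frac1\delta,\log^+b,|\mathcal A|\big)$. The polynomials are universal, except that those for the computational cost may depend on the polynomial that bounds the cost of evaluating $\phi$. -/

import Mathlib

open MeasureTheory ProbabilityTheory

universe u v w w'

noncomputable section

namespace MCPolitex

/-! ### Discounted Markov decision processes, policies and value functions -/

/-- An infinite-horizon discounted MDP with rewards in `[0, 1]`, a deterministic initial state `ρ`
and discount factor `γ ∈ (0, 1)`. The action space will always be finite with all sets measurable;
the state space is an arbitrary measurable space. -/
structure MDP (S : Type u) (A : Type v) [MeasurableSpace S] [MeasurableSpace A] where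
  /-- transition kernel -/
  P : Kernel (S × A) S
  isMarkov : IsMarkovKernel P
  /-- reward function -/
  r : S → A → ℝ
  measurable_r : Measurable fun z : S × A => r z.1 z.2
  r_nonneg : ∀ s a, 0 ≤ r s a
  r_le_one : ∀ s a, r s a ≤ 1
  /-- initial state -/
  ρ : S
  /-- discount factor -/
  γ : ℝ
  γ_pos : 0 < γ
  γ_lt_one : γ < 1

/-- A stationary policy: a (measurable) map from states to probability distributions on the finite
action set; `prob s a` is `π(a | s)`. -/
structure Policy (S : Type u) (A : Type v) [MeasurableSpace S] [Fintype A] where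
  prob : S → A → ℝ
  nonneg : ∀ s a, 0 ≤ prob s a
  sum_eq_one : ∀ s, ∑ a, prob s a = 1
  measurable_prob : ∀ a, Measurable fun s => prob s a

/-- A feature map `φ : S × A → ℝ^d` with `‖φ(s, a)‖₂ ≤ 1`. -/
structure FeatureMap (S : Type u) (A : Type v) [MeasurableSpace S] (d : ℕ) where
  map : S → A → Fin d → ℝ
  measurable_map : ∀ a, Measurable fun s => map s a
  norm_le_one : ∀ s a, ‖WithLp.toLp 2 (map s a)‖ ≤ 1

section Values

variable {S : Type u} {A : Type v} [MeasurableSpace S] [Fintype A] [MeasurableSpace A]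

/-- The policy as a kernel from states to actions. -/
def Policy.kernel (π : Policy S A) : Kernel S A where
  toFun s := ∑ a, ENNReal.ofReal (π.prob s a) • Measure.dirac a
  measurable' := by
    refine Measure.measurable_of_measurable_coe _ fun t _ => ?_
    simp only [Measure.coe_finsetSum, Finset.sum_apply, Measure.smul_apply, smul_eq_mul]
    exact Finset.measurable_sum _ fun a _ =>
      (ENNReal.measurable_ofReal.comp (π.measurable_prob a)).mul_const _

instance (π : Policy S A) : IsMarkovKernel π.kernel where
  isProbabilityMeasure s := ⟨by
    have h : π.kernel s = ∑ a, ENNReal.ofReal (π.prob s a) • Measure.dirac a := rfl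
    rw [h]
    simp only [Measure.coe_finsetSum, Finset.sum_apply, Measure.smul_apply, smul_eq_mul,
      measure_univ, mul_one]
    rw [← ENNReal.ofReal_sum_of_nonneg fun a _ => π.nonneg s a, π.sum_eq_one,
      ENNReal.ofReal_one]⟩

/-- One step of the state-action process: from `(s, a)` draw `s' ∼ P(· | s, a)`, then
`a' ∼ π(· | s')`. -/
def MDP.stepKernel (M : MDP S A) (π : Policy S A) : Kernel (S × A) (S × A) :=
  M.P ⊗ₖ Kernel.prodMkLeft (S × A) π.kernel

instance (M : MDP S A) (π : Policy S A) : IsMarkovKernel (M.stepKernel π) := by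
  have := M.isMarkov
  unfold MDP.stepKernel
  infer_instance

/-- The law of the whole trajectory `(s_t, a_t)_{t ≥ 0}` under `π`, given `(s_0, a_0)`. -/
def MDP.trajFrom (M : MDP S A) (π : Policy S A) : Kernel (S × A) (ℕ → S × A) :=
  (Kernel.traj (X := fun _ => S × A)
    (fun n => (M.stepKernel π).comap
      (fun h : (i : Finset.Iic n) → S × A => h ⟨n, Finset.mem_Iic.2 le_rfl⟩)
      (measurable_pi_apply _)) 0).comap
    (fun z _ => z) (measurable_pi_lambda _ fun _ => measurable_id)

/-- The discounted return `∑ γ^t r(s_t, a_t)` of a trajectory. -/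
def MDP.ret (M : MDP S A) (ω : ℕ → S × A) : ℝ :=
  ∑' t, M.γ ^ t * M.r (ω t).1 (ω t).2

/-- The state-action value function `Q_π(s, a)`. -/
def MDP.Q (M : MDP S A) (π : Policy S A) (s : S) (a : A) : ℝ :=
  ∫ ω, M.ret ω ∂(M.trajFrom π (s, a))

/-- The value function `V_π(s)`: the expected return when `s_0 = s` and `a_0 ∼ π(· | s)`. -/
def MDP.V (M : MDP S A) (π : Policy S A) (s : S) : ℝ :=
  ∫ ω, M.ret ω ∂(((π.kernel s).map fun a => (s, a)).bind (M.trajFrom π))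

/-- The optimal value `V*(s)` over all stationary policies. -/
def MDP.Vstar (M : MDP S A) (s : S) : ℝ := ⨆ π : Policy S A, M.V π s

/-- `Q_π`-realizability with weight bound `b`. -/
def Realizable {d : ℕ} (M : MDP S A) (φ : FeatureMap S A d) (b : ℝ) : Prop :=
  ∀ π : Policy S A, ∃ w : Fin d → ℝ, ‖WithLp.toLp 2 w‖ ≤ b ∧
    ∀ s a, M.Q π s a = w ⬝ᵥ φ.map s a

/-- Approximate `Q_π`-realizability with weight bound `b` and misspecification error `ε`. -/
def ApproxRealizable {d : ℕ} (M : MDP S A) (φ : FeatureMap S A d) (b ε : ℝ) : Prop :=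
  ∀ π : Policy S A, ∃ w : Fin d → ℝ, ‖WithLp.toLp 2 w‖ ≤ b ∧
    ∀ s a, |M.Q π s a - w ⬝ᵥ φ.map s a| ≤ ε

end Values

/-! ### Randomized programs with access to a simulator -/

/-- A randomized program that interacts with a simulator and finally returns an element of `α`.
`ops k p` performs `k` logical or arithmetic operations and continues as `p`;
`query s a next` calls the simulator at `(s, a)`, receives the reward and a next state;
`draw p next` draws an action from the probability vector `p`. -/
inductive Prog (S : Type u) (A : Type v) (α : Type w) : Type (max u v w)
  | done (x : α) : Prog S A α
  | ops (k : ℕ) (p : Prog S A α) : Prog S A α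
  | query (s : S) (a : A) (next : ℝ → S → Prog S A α) : Prog S A α
  | draw (p : A → ℝ) (next : A → Prog S A α) : Prog S A α

namespace Prog

variable {S : Type u} {A : Type v} {α : Type w} {β : Type w'}

/-- Sequential composition. -/
def bind : Prog S A α → (α → Prog S A β) → Prog S A β
  | done x, f => f x
  | ops k p, f => ops k (p.bind f)
  | query s a next, f => query s a fun r s' => (next r s').bind f
  | draw p next, f => draw p fun a => (next a).bind f

variable [MeasurableSpace S] [Fintype A] [MeasurableSpace A]

open Classical in
/-- The probability that the program, run against the simulator of `M`, returns a result satisfying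
`E`: conditionally on the past, the answer to a query at `(s, a)` is the reward `r(s, a)` and a
fresh next state drawn from `P(· | s, a)`. -/
def prob (M : MDP S A) : Prog S A α → (α → Prop) → ENNReal
  | done x, E => if E x then 1 else 0
  | ops _ p, E => p.prob M E
  | query s a next, E => ∫⁻ s', (next (M.r s a) s').prob M E ∂(M.P (s, a))
  | draw p next, E => ∑ a, ENNReal.ofReal (p a) * (next a).prob M E

/-- The largest number of simulator calls over all executions (all next states, all actions). -/
def queries (M : MDP S A) : Prog S A α → ℕ∞
  | done _ => 0
  | ops _ p => p.queries M
  | query s a next => 1 + ⨆ s', (next (M.r s a) s').queries M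
  | draw _ next => ⨆ a, (next a).queries M

/-- The largest number of operations over all executions; a simulator call also counts as one
operation. -/
def opCount (M : MDP S A) : Prog S A α → ℕ∞
  | done _ => 0
  | ops k p => k + p.opCount M
  | query s a next => 1 + ⨆ s', (next (M.r s a) s').opCount M
  | draw _ next => ⨆ a, (next a).opCount M

end Prog

/-! ### Regularized Gram matrices -/

/-- The matrix whose rows are the vectors of the list. -/
def rowMatrix {d : ℕ} (xs : List (Fin d → ℝ)) : Matrix (Fin xs.length) (Fin d) ℝ :=
  Matrix.of fun i => xs.get i

/-- `(Φᵀ Φ + lam I)⁻¹`, where `Φ` has the given rows. -/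
def gramInv {d : ℕ} (lam : ℝ) (xs : List (Fin d → ℝ)) : Matrix (Fin d) (Fin d) ℝ :=
  ((rowMatrix xs).transpose * rowMatrix xs + lam • (1 : Matrix (Fin d) (Fin d) ℝ))⁻¹

/-- From `B = M⁻¹` compute `(M + x xᵀ)⁻¹`, together with the number of arithmetic operations: `2d²`
for each of the products `B x` and `xᵀ B`, then `2d` for `xᵀ B x`, two scalar operations, and `d²`
for each of the outer product, its scaling and the subtraction. -/
def rankOneUpdate {d : ℕ} (B : Matrix (Fin d) (Fin d) ℝ) (x : Fin d → ℝ) :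
    Matrix (Fin d) (Fin d) ℝ × ℕ :=
  (B - (1 + x ⬝ᵥ B.mulVec x)⁻¹ • Matrix.vecMulVec (B.mulVec x) (Matrix.vecMul x B),
    2 * d ^ 2 + 2 * d ^ 2 + 2 * d + 2 + 3 * d ^ 2)

/-- A procedure that computes `gramInv lam xs` by arithmetic operations, with its operation count:
start from `lam⁻¹ I` and do one rank-one update for each row. -/
def gramInvProcedure {d : ℕ} (lam : ℝ) (xs : List (Fin d → ℝ)) : Matrix (Fin d) (Fin d) ℝ × ℕ :=
  xs.foldl (fun c x => ((rankOneUpdate c.1 x).1, c.2 + (rankOneUpdate c.1 x).2))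
    (lam⁻¹ • (1 : Matrix (Fin d) (Fin d) ℝ), d ^ 2 + 1)

/-- Number of arithmetic operations for computing `(Φᵀ Φ + lam I)⁻¹`. -/
def gramInvCost {d : ℕ} (lam : ℝ) (xs : List (Fin d → ℝ)) : ℕ := (gramInvProcedure lam xs).2

theorem rowMatrix_gram {d : ℕ} (xs : List (Fin d → ℝ)) :
    (rowMatrix xs).transpose * rowMatrix xs = (xs.map fun x => Matrix.vecMulVec x x).sum := by
  induction xs with
  | nil =>
    ext i j
    simp [Matrix.mul_apply]
  | cons x xs ih =>
    rw [List.map_cons, List.sum_cons, ← ih]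
    ext i j
    simp only [Matrix.mul_apply, Matrix.add_apply, Matrix.transpose_apply, Matrix.vecMulVec_apply]
    exact Fin.sum_univ_succ (n := xs.length)
      (fun k : Fin (xs.length + 1) => rowMatrix (x :: xs) k i * rowMatrix (x :: xs) k j)

/-- The procedure is correct. -/
theorem gramInvProcedure_fst {d : ℕ} {lam : ℝ} (hlam : 0 < lam) (xs : List (Fin d → ℝ)) :
    (gramInvProcedure lam xs).1 = gramInv lam xs := by
  induction xs using List.reverseRecOn with
  | nil =>
    have h : (rowMatrix ([] : List (Fin d → ℝ))).transpose *
        rowMatrix ([] : List (Fin d → ℝ)) = 0 := by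
      rw [rowMatrix_gram]; rfl
    rw [gramInv, h, zero_add]
    symm
    apply Matrix.inv_eq_left_inv
    change (lam⁻¹ • (1 : Matrix (Fin d) (Fin d) ℝ)) * _ = 1
    rw [Matrix.smul_mul, Matrix.one_mul, smul_smul, inv_mul_cancel₀ hlam.ne', one_smul]
  | append_singleton xs x ih =>
    set G : Matrix (Fin d) (Fin d) ℝ :=
      (rowMatrix xs).transpose * rowMatrix xs + lam • (1 : Matrix (Fin d) (Fin d) ℝ) with hG
    have hpos : G.PosDef := by
      refine Matrix.PosDef.posSemidef_add ?_ (Matrix.PosDef.one.smul hlam)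
      have := Matrix.posSemidef_conjTranspose_mul_self (rowMatrix xs)
      rwa [Matrix.conjTranspose_eq_transpose_of_trivial] at this
    have hB : (gramInvProcedure lam xs).1 = G⁻¹ := ih
    have hstep : (gramInvProcedure lam (xs ++ [x])).1 = (rankOneUpdate G⁻¹ x).1 := by
      rw [← hB]
      simp [gramInvProcedure, List.foldl_append]
    have hgram : gramInv lam (xs ++ [x]) = (G + Matrix.vecMulVec x x)⁻¹ := by
      rw [gramInv, rowMatrix_gram, hG, rowMatrix_gram, List.map_append, List.sum_append]
      simp only [List.map_cons, List.map_nil, List.sum_cons, List.sum_nil, add_zero]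
      congr 1
      abel
    have hden : 0 < 1 + x ⬝ᵥ G⁻¹.mulVec x := by
      have := hpos.inv.posSemidef.dotProduct_mulVec_nonneg x
      simp only [star_trivial] at this
      linarith
    have hinv : G⁻¹ * G = 1 :=
      Matrix.nonsing_inv_mul _ ((Matrix.isUnit_iff_isUnit_det _).1 hpos.isUnit)
    rw [hstep, hgram]
    symm
    apply Matrix.inv_eq_left_inv
    set c : ℝ := x ⬝ᵥ G⁻¹.mulVec x with hc
    have e1 : Matrix.vecMul x G⁻¹ ⬝ᵥ x = c := by rw [hc, ← Matrix.dotProduct_mulVec]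
    have e2 : G⁻¹ * Matrix.vecMulVec x x = Matrix.vecMulVec (G⁻¹.mulVec x) x := by
      rw [Matrix.mul_vecMulVec]
    have e3 : Matrix.vecMulVec (G⁻¹.mulVec x) (Matrix.vecMul x G⁻¹) * G =
        Matrix.vecMulVec (G⁻¹.mulVec x) x := by
      rw [Matrix.vecMulVec_mul, Matrix.vecMul_vecMul, hinv, Matrix.vecMul_one]
    have e4 : Matrix.vecMulVec (G⁻¹.mulVec x) (Matrix.vecMul x G⁻¹) * Matrix.vecMulVec x x =
        c • Matrix.vecMulVec (G⁻¹.mulVec x) x := by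
      rw [Matrix.vecMulVec_mul_vecMulVec, e1]
      ext i j
      simp [Matrix.vecMulVec_apply, Matrix.smul_apply]
      ring
    change (G⁻¹ - (1 + c)⁻¹ • Matrix.vecMulVec (G⁻¹.mulVec x) (Matrix.vecMul x G⁻¹)) *
      (G + Matrix.vecMulVec x x) = 1
    rw [sub_mul, mul_add, hinv, e2, Matrix.smul_mul, mul_add, e3, e4]
    have : (1 + c)⁻¹ • (Matrix.vecMulVec (G⁻¹.mulVec x) x +
        c • Matrix.vecMulVec (G⁻¹.mulVec x) x) = Matrix.vecMulVec (G⁻¹.mulVec x) x := by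
      rw [show ∀ T : Matrix (Fin d) (Fin d) ℝ, T + c • T = (1 + c) • T from
        fun T => by rw [add_smul, one_smul], smul_smul, inv_mul_cancel₀ hden.ne', one_smul]
    rw [this, add_sub_cancel_right]

/-! ### The algorithm -/

/-- Inputs of the algorithm: number of iterations `K`, number of rollouts `m`, rollout length `n`,
regularization `lam`, threshold `tau`, mirror-descent parameter `alpha`; and the number `featCost`
of operations that one evaluation of the feature map takes. -/
structure Params where
  K : ℕ
  m : ℕ
  n : ℕ
  lam : ℝ
  tau : ℝ
  alpha : ℝ
  featCost : ℕ

section Algorithm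

variable {S : Type u} {A : Type v} [MeasurableSpace S] {d : ℕ}

/-- `Π_{[0, 1/(1-γ)]}(w ⬝ φ(s, a))`. -/
def clipQ (γ : ℝ) (φ : FeatureMap S A d) (w : Fin d → ℝ) (s : S) (a : A) : ℝ :=
  min (max (w ⬝ᵥ φ.map s a) 0) (1 - γ)⁻¹

theorem measurable_clipQ (γ : ℝ) (φ : FeatureMap S A d) (w : Fin d → ℝ) (a : A) :
    Measurable fun s => clipQ γ φ w s a := by
  have h : Measurable fun s => w ⬝ᵥ φ.map s a :=
    Finset.measurable_sum _ fun i _ =>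
      ((measurable_pi_apply i).comp (φ.measurable_map a)).const_mul (w i)
  exact (h.max measurable_const).min measurable_const

/-- The unnormalized weight `exp(α ∑ Q_j(s, a))`, where the `j`-th member `w_{j+1}` of the list
encodes `Q_j = Π_{[0, 1/(1-γ)]}(w_{j+1} ⬝ φ)`. -/
def expWeight (γ alpha : ℝ) (φ : FeatureMap S A d) (ws : List (Fin d → ℝ)) (s : S) (a : A) : ℝ :=
  Real.exp (alpha * (ws.map fun w => clipQ γ φ w s a).sum)

theorem measurable_expWeight (γ alpha : ℝ) (φ : FeatureMap S A d) (ws : List (Fin d → ℝ)) (a : A) :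
    Measurable fun s => expWeight γ alpha φ ws s a := by
  have h : Measurable fun s => (ws.map fun w => clipQ γ φ w s a).sum := by
    induction ws with
    | nil => simp
    | cons w ws ih =>
      simp only [List.map_cons, List.sum_cons]
      exact (measurable_clipQ γ φ w a).add ih
  exact Real.measurable_exp.comp (h.const_mul alpha)

variable [Fintype A]

/-- The policy proportional to `expWeight`. -/
def softmaxPolicy [Nonempty A] (γ alpha : ℝ) (φ : FeatureMap S A d) (ws : List (Fin d → ℝ)) :
    Policy S A where
  prob s a := expWeight γ alpha φ ws s a / ∑ a', expWeight γ alpha φ ws s a'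
  nonneg s a := div_nonneg (Real.exp_pos _).le (Finset.sum_nonneg fun _ _ => (Real.exp_pos _).le)
  sum_eq_one s := by
    rw [← Finset.sum_div]
    exact div_self (Finset.sum_pos (fun _ _ => Real.exp_pos _) Finset.univ_nonempty).ne'
  measurable_prob a := (measurable_expWeight γ alpha φ ws a).div
    (Finset.measurable_sum _ fun a' _ => measurable_expWeight γ alpha φ ws a')

/-- The rollout policy `π_k` when the weights learnt so far are `w_1, …, w_k`: the initial policy
for `k = 0`, and for `k ≥ 1` the policy proportional to `exp(α ∑_{j=1}^{k-1} Q_j(s, a))`, where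
`Q_j` is obtained from `w_{j+1}`. -/
def rolloutPolicy [Nonempty A] (γ alpha : ℝ) (φ : FeatureMap S A d) (π₀ : Policy S A) :
    List (Fin d → ℝ) → Policy S A
  | [] => π₀
  | _ :: ws => softmaxPolicy γ alpha φ ws

variable [Nonempty A] (γ : ℝ) (φ : FeatureMap S A d) (p : Params)

/-- The features of the elements of a core set, in order. -/
def feats (C : List (S × A)) : List (Fin d → ℝ) := C.map fun z => φ.map z.1 z.2

/-- Number of operations for obtaining the features of the core set and `(Φᵀ Φ + lam I)⁻¹`. -/
def coreInvCost (C : List (S × A)) : ℕ :=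
  C.length * p.featCost + gramInvCost p.lam (feats φ C)

/-- `φ(s, a)ᵀ (Φᵀ Φ + lam I)⁻¹ φ(s, a) > tau`: the pair is outside the good set of the core set. -/
def Uncertain (C : List (S × A)) (s : S) (a : A) : Prop :=
  p.tau < φ.map s a ⬝ᵥ (gramInv p.lam (feats φ C)).mulVec (φ.map s a)

/-- Number of operations for one test of `Uncertain`, given the inverse matrix. -/
def testCost (d : ℕ) (p : Params) : ℕ := p.featCost + 2 * d ^ 2 + 2 * d + 1

/-- Number of operations for the distribution `π_k(· | s)` and for drawing an action from it; one
evaluation of the initial policy `π_0(a | s)` counts as one operation. For `k ≥ 1` and each action,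
one feature evaluation, then `2d` operations for an inner product and three for clipping and summing
for each function `Q_j`, and one each for scaling, exponential, normalizing sum and division. -/
def policyCost (A : Type v) [Fintype A] {d : ℕ} (p : Params) : List (Fin d → ℝ) → ℕ
  | [] => 2 * Fintype.card A
  | _ :: ws => Fintype.card A * (p.featCost + ws.length * (2 * d + 3) + 4) + Fintype.card A

open Classical in
/-- Go through the actions in order and return the first one (if any) that is uncertain at `s`. -/
def scan (C : List (S × A)) (s : S) : List A → Prog S A (Option A)
  | [] => .done none
  | a :: as => .ops (testCost d p) (if Uncertain φ p C s a then .done (some a) else scan C s as)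

/-- The steps `t = n - k + 1, …, n` of one rollout, where `k` is the first argument: the state is
`s`, `disc` is `γ^t` and `G` the discounted reward collected so far. Returns an uncertain pair or
the discounted reward of the rollout. -/
def rolloutSteps (π₀ : Policy S A) (ws : List (Fin d → ℝ)) (C : List (S × A)) :
    ℕ → S → ℝ → ℝ → Prog S A ((S × A) ⊕ ℝ)
  | 0, _, _, G => .done (.inr G)
  | k + 1, s, disc, G =>
    (scan φ p C s Finset.univ.toList).bind fun found =>
      match found with
      | some a => .done (.inl (s, a))
      | none =>
        .ops (policyCost A p ws) (.draw ((rolloutPolicy γ p.alpha φ π₀ ws).prob s) fun a =>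
          .query s a fun r s' =>
            .ops 3 (rolloutSteps π₀ ws C k s' (disc * γ) (G + disc * r)))

/-- One rollout from `z`. -/
def oneRollout (π₀ : Policy S A) (ws : List (Fin d → ℝ)) (C : List (S × A)) (z : S × A) :
    Prog S A ((S × A) ⊕ ℝ) :=
  .query z.1 z.2 fun r s' => rolloutSteps γ φ p π₀ ws C p.n s' γ r

/-- `k` rollouts from `z`, adding up the discounted rewards. -/
def rollouts (π₀ : Policy S A) (ws : List (Fin d → ℝ)) (C : List (S × A)) (z : S × A) :
    ℕ → ℝ → Prog S A ((S × A) ⊕ ℝ)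
  | 0, total => .done (.inr total)
  | k + 1, total =>
    (oneRollout γ φ p π₀ ws C z).bind fun res =>
      match res with
      | .inl z' => .done (.inl z')
      | .inr G => .ops 1 (rollouts π₀ ws C z k (total + G))

/-- The subroutine ConfidentRollout: returns an uncertain pair (`inl`), or the average discounted
reward of `m` rollouts from `z` (`inr`). -/
def confidentRollout (π₀ : Policy S A) (ws : List (Fin d → ℝ)) (C : List (S × A)) (z : S × A) :
    Prog S A ((S × A) ⊕ ℝ) :=
  .ops (coreInvCost φ p C) ((rollouts γ φ p π₀ ws C z p.m 0).bind fun res =>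
    match res with
    | .inl z' => .done (.inl z')
    | .inr total => .ops 1 (.done (.inr (total / p.m))))

/-- Estimate the action value at each pair in the list; returns the first uncertain pair that is
discovered, or the list of all estimates. -/
def evaluate (π₀ : Policy S A) (ws : List (Fin d → ℝ)) (C : List (S × A)) :
    List (S × A) → List ℝ → Prog S A ((S × A) ⊕ List ℝ)
  | [], qs => .done (.inr qs)
  | z :: zs, qs =>
    (confidentRollout γ φ p π₀ ws C z).bind fun res =>
      match res with
      | .inl z' => .done (.inl z')
      | .inr q => evaluate π₀ ws C zs (qs ++ [q])

/-- The ridge regression weights `(Φᵀ Φ + lam I)⁻¹ Φᵀ q`. -/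
def ridge (C : List (S × A)) (qs : List ℝ) : Fin d → ℝ :=
  (gramInv p.lam (feats φ C)).mulVec
    ((rowMatrix (feats φ C)).transpose.mulVec fun i => qs.getD i 0)

/-- Number of operations for `ridge`. -/
def ridgeCost (C : List (S × A)) : ℕ :=
  coreInvCost φ p C + 2 * C.length * d + 2 * d ^ 2

/-- `k` further iterations of policy iteration with core set `C`, where `ws` are the weights learnt
so far. Returns an uncertain pair or the list of all weights. -/
def policyIteration (π₀ : Policy S A) (C : List (S × A)) :
    ℕ → List (Fin d → ℝ) → Prog S A ((S × A) ⊕ List (Fin d → ℝ))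
  | 0, ws => .done (.inr ws)
  | k + 1, ws =>
    (evaluate γ φ p π₀ ws C C []).bind fun res =>
      match res with
      | .inl z => .done (.inl z)
      | .inr qs => .ops (ridgeCost φ p C)
          (policyIteration π₀ C k (ws ++ [ridge φ p C qs]))

/-- The restart loop, cut off after `R` rounds (result `none`): run policy iteration, and whenever
an uncertain pair is discovered, add it to the core set and start again. -/
def restartLoop (π₀ : Policy S A) :
    ℕ → List (S × A) → Prog S A (Option (List (Fin d → ℝ)))
  | 0, _ => .done none
  | R + 1, C =>
    (policyIteration γ φ p π₀ C p.K []).bind fun res =>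
      match res with
      | .inl z => restartLoop π₀ R (C ++ [z])
      | .inr ws => .done (some ws)

open Classical in
/-- Initialization of the core set with the initial state `ρ`, going through the actions in order. -/
def initCore (ρ : S) : List A → List (S × A) → Prog S A (List (S × A))
  | [], C => .done C
  | a :: as, C => .ops (coreInvCost φ p C + testCost d p)
      (if C = [] ∨ Uncertain φ p C ρ a then initCore ρ as (C ++ [(ρ, a)]) else initCore ρ as C)

/-- The algorithm Confident MC-Politex, cut off after `R` rounds of the restart loop. The result
`some [w_1, …, w_K]` encodes the policies `π_0, …, π_{K-1}`. -/
def politex (π₀ : Policy S A) (ρ : S) (R : ℕ) : Prog S A (Option (List (Fin d → ℝ))) :=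
  (initCore φ p ρ Finset.univ.toList []).bind fun C => restartLoop γ φ p π₀ R C

end Algorithm

section Guarantees

variable {S : Type u} {A : Type v} [MeasurableSpace S] [Fintype A] [MeasurableSpace A] [Nonempty A]
  {d : ℕ}

/-- The value `(1/K) ∑_{k=0}^{K-1} V_{π_k}(ρ)` of the uniform mixture of `π_0, …, π_{K-1}`. -/
def mixtureValue (M : MDP S A) (φ : FeatureMap S A d) (p : Params) (π₀ : Policy S A)
    (ws : List (Fin d → ℝ)) : ℝ :=
  (1 / p.K : ℝ) * ∑ k ∈ Finset.range p.K,
    M.V (rolloutPolicy M.γ p.alpha φ π₀ (ws.take k)) M.ρ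

/-- Probability that Confident MC-Politex terminates and outputs a mixture policy of suboptimality
at most `x` at the initial state. -/
def successProb (M : MDP S A) (φ : FeatureMap S A d) (p : Params) (π₀ : Policy S A) (x : ℝ) :
    ENNReal :=
  ⨆ R : ℕ, (politex M.γ φ p π₀ M.ρ R).prob M fun out =>
    ∃ ws, out = some ws ∧ M.Vstar M.ρ - mixtureValue M φ p π₀ ws ≤ x

/-- Worst-case number of simulator calls of Confident MC-Politex. -/
def queryCost (M : MDP S A) (φ : FeatureMap S A d) (p : Params) (π₀ : Policy S A) : ℕ∞ :=
  ⨆ R : ℕ, (politex M.γ φ p π₀ M.ρ R).queries M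

/-- Worst-case number of logical and arithmetic operations of Confident MC-Politex. -/
def computationCost (M : MDP S A) (φ : FeatureMap S A d) (p : Params) (π₀ : Policy S A) : ℕ∞ :=
  ⨆ R : ℕ, (politex M.γ φ p π₀ M.ρ R).opCount M

end Guarantees

/-- The parameters for the exactly realizable case with target accuracy `κ`; real values that stand
for numbers of iterations, steps or rollouts are rounded up. Here `L = 1 + log(1 + lam⁻¹)`. -/
def exactParams (nA d : ℕ) (γ b κ δ : ℝ) (featCost : ℕ) : Params :=
  let lam : ℝ := κ ^ 2 * (1 - γ) ^ 2 / (256 * b ^ 2)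
  let L : ℝ := 1 + Real.log (1 + lam⁻¹)
  let K : ℕ := ⌈32 * Real.log nA / (κ ^ 2 * (1 - γ) ^ 4)⌉₊
  { K := K
    m := ⌈1024 * (d * L / (κ ^ 2 * (1 - γ) ^ 4)) * Real.log (8 * K * d * L / δ)⌉₊
    n := ⌈1 / (1 - γ) * Real.log (32 * √d * L / ((1 - γ) ^ 2 * κ))⌉₊
    lam := lam
    tau := 1
    alpha := (1 - γ) * √(2 * Real.log nA / K)
    featCost := featCost }

/-- The parameters for the approximately realizable case with misspecification error `ε`. -/
def approxParams (nA d : ℕ) (γ b ε δ : ℝ) (featCost : ℕ) : Params :=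
  let lam : ℝ := ε ^ 2 * d / b ^ 2
  let L : ℝ := 1 + Real.log (1 + lam⁻¹)
  let K : ℕ := ⌈2 * Real.log nA / (ε ^ 2 * d * (1 - γ) ^ 2)⌉₊
  { K := K
    m := ⌈1 / (ε ^ 2 * (1 - γ) ^ 2) * Real.log (8 * K * d * L / δ)⌉₊
    n := ⌈1 / (1 - γ) * Real.log (1 / (ε * (1 - γ)))⌉₊
    lam := lam
    tau := 1
    alpha := (1 - γ) * √(2 * Real.log nA / K)
    featCost := featCost }

/-- The polynomial `P` bounds the cost `c` when evaluated at `x`. -/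
def CostLE {k : ℕ} (c : ℕ∞) (P : MvPolynomial (Fin k) ℝ) (x : Fin k → ℝ) : Prop :=
  (c : ENNReal) ≤ ENNReal.ofReal (MvPolynomial.eval x P)

end MCPolitex

end

/-! Ridge regression on the core set controls the estimate of an action value only at pairs that are
not uncertain, whereas the analysis of policy iteration needs accurate values at every state. The
gap is closed by a virtual algorithm (`virtualPolicy`). At settled states, where no action is
uncertain, it uses the same clipped linear functions as the real algorithm; at all other states it
is handed the exact action values of its own current policy. Its evaluation errors are therefore
uniformly small, and the regret bound for exponential weights (`exp_weights_regret`) together with a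
performance difference bound (`MDP.sum_V_sub_le`) controls the average value of its policies.

The real algorithm inherits this for two reasons. The real and the virtual policy agree at settled
states (`rolloutPolicy_eq_virtualPolicy`), and a rollout is abandoned at the first unsettled state.
So, if abandoning counts as a success, the real rollouts succeed at least as often as uninterrupted
rollouts of either policy would, and one sample average estimates both action values by Hoeffding's
inequality (`le_prob_confidentRollout`). As every policy is realizable, including the virtual one,
the same ridge weights then fit both action values at all certain pairs (`ridge_accurate`). The
initial state is settled, so the two values there are close (`Vstar_sub_mixtureValue_le`).

Termination and cost come from the elliptical potential: after the first element, every pair that is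
added has leverage above one and doubles the determinant of the Gram matrix, while the trace bounds
that determinant. Hence the core set has at most `N = 3 d (1 + log (1 + lam⁻¹))` elements on every
execution (`Doubling.length_le`), and there are at most `N` rounds of `K` iterations with at most
`N` calls of the rollout subroutine each. A bound over these `N² K` calls gives the confidence
(`le_successProb`); the same count gives the worst-case costs (`politex_cost_le`).

Probabilities are nested integrals along the program, and only lower bounds for them are needed. As
`∫⁻` is a lower integral, these bounds multiply along sequential composition without any
measurability of the continuations. -/

set_option linter.unusedSectionVars false

noncomputable section

namespace MCPolitex

/-! ### Calculus of programs: possible results, probabilities and costs of compositions. -/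

namespace Prog

variable {S : Type u} {A : Type v} {α : Type w} {β : Type w'}
variable [MeasurableSpace S] [Fintype A] [MeasurableSpace A]

/-- Every possible result of the program satisfies `F`, and every draw is made from a vector of
total mass at most one. -/
def Sat (M : MDP S A) : Prog S A α → (α → Prop) → Prop
  | done x, F => F x
  | ops _ p, F => p.Sat M F
  | query s a next, F => ∀ s', (next (M.r s a) s').Sat M F
  | draw p next, F => ∑ a, ENNReal.ofReal (p a) ≤ 1 ∧ ∀ a, (next a).Sat M F

variable {M : MDP S A}

theorem Sat.bind {p : Prog S A α} {f : α → Prog S A β} {F : α → Prop} {G : β → Prop}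
    (hp : p.Sat M F) (hf : ∀ x, F x → (f x).Sat M G) : (p.bind f).Sat M G := by
  induction p with
  | done x => exact hf x hp
  | ops k p ih => exact ih hp
  | query s a next ih => exact fun s' => ih _ _ (hp s')
  | draw q next ih => exact ⟨hp.1, fun a => ih a (hp.2 a)⟩

/-- Lets facts that hold on every execution, such as an exit pair being uncertain, be added to an
event at no loss of probability. -/
theorem prob_mono_of_sat {p : Prog S A α} {F E E' : α → Prop} (hp : p.Sat M F)
    (h : ∀ x, F x → E x → E' x) : p.prob M E ≤ p.prob M E' := by
  induction p with
  | done x =>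
    by_cases hE : E x
    · simp [prob, hE, h x hp hE]
    · simp [prob, hE]
  | ops k p ih => exact ih hp
  | query s a next ih => exact lintegral_mono fun s' => ih _ _ (hp s')
  | draw q next ih => exact Finset.sum_le_sum fun a _ => mul_le_mul_right (ih a (hp.2 a)) _

theorem prob_mono (p : Prog S A α) {E E' : α → Prop} (h : ∀ x, E x → E' x) :
    p.prob M E ≤ p.prob M E' := by
  induction p with
  | done x =>
    by_cases hE : E x
    · simp [prob, hE, h x hE]
    · simp [prob, hE]
  | ops k p ih => exact ih
  | query s a next ih => exact lintegral_mono fun s' => ih _ _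
  | draw q next ih => exact Finset.sum_le_sum fun a _ => mul_le_mul_right (ih a) _

/-- Lower bounds on probabilities multiply along sequential composition. -/
theorem prob_mul_le_prob_bind (p : Prog S A α) {f : α → Prog S A β} {F : α → Prop} {E : β → Prop}
    {c : ENNReal} (hf : ∀ x, F x → c ≤ (f x).prob M E) :
    p.prob M F * c ≤ (p.bind f).prob M E := by
  induction p with
  | done x =>
    by_cases hF : F x
    · simpa [prob, hF, Prog.bind] using hf x hF
    · simp [prob, hF]
  | ops k p ih => exact ih
  | query s a next ih =>
    simp only [prob, Prog.bind]
    rw [mul_comm]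
    refine (lintegral_const_mul_le _ _).trans (lintegral_mono fun s' => ?_)
    rw [mul_comm]
    exact ih _ _
  | draw q next ih =>
    simp only [prob, Prog.bind]
    rw [Finset.sum_mul]
    refine Finset.sum_le_sum fun a _ => ?_
    rw [mul_assoc]
    exact mul_le_mul_right (ih a) _

/-- Inclusion-exclusion. Only superadditivity of the lower integral is used, plus additivity for a
measurable constant. The mass bound for draws inside `Sat` keeps the extra term at most `1`; `F`
itself plays no other role. -/
theorem prob_add_prob_le {p : Prog S A α} {F E E' : α → Prop} (hp : p.Sat M F) :
    p.prob M E + p.prob M E' ≤ p.prob M (fun x => E x ∧ E' x) + 1 := by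
  have := M.isMarkov
  induction p with
  | done x =>
    by_cases hE : E x <;> by_cases hE' : E' x <;> simp [prob, hE, hE']
  | ops k p ih => exact ih hp
  | query s a next ih =>
    simp only [prob]
    refine (le_lintegral_add _ _).trans ?_
    refine (lintegral_mono fun s' => ih _ _ (hp s')).trans ?_
    rw [lintegral_add_right _ measurable_const, lintegral_const, measure_univ, mul_one]
  | draw q next ih =>
    simp only [prob]
    rw [← Finset.sum_add_distrib]
    calc ∑ a, (ENNReal.ofReal (q a) * (next a).prob M E +
            ENNReal.ofReal (q a) * (next a).prob M E')
        ≤ ∑ a, (ENNReal.ofReal (q a) * (next a).prob M (fun x => E x ∧ E' x) +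
            ENNReal.ofReal (q a)) := by
          refine Finset.sum_le_sum fun a _ => ?_
          rw [← mul_add]
          refine (mul_le_mul_right (ih a (hp.2 a)) _).trans ?_
          rw [mul_add, mul_one]
      _ ≤ _ := by
          rw [Finset.sum_add_distrib]
          exact add_le_add_right hp.1 _

/-- The largest number of simulator calls plus `w` times the number of other operations. -/
def cost (M : MDP S A) (w : ℕ) : Prog S A α → ℕ∞
  | done _ => 0
  | ops k p => (w * k : ℕ) + p.cost M w
  | query s a next => 1 + ⨆ s', (next (M.r s a) s').cost M w
  | draw _ next => ⨆ a, (next a).cost M w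

theorem cost_zero (p : Prog S A α) : p.cost M 0 = p.queries M := by
  induction p with
  | done x => rfl
  | ops k p ih => simp [cost, queries, ih]
  | query s a next ih => simp only [cost, queries, ih]
  | draw q next ih => simp only [cost, queries, ih]

theorem cost_one (p : Prog S A α) : p.cost M 1 = p.opCount M := by
  induction p with
  | done x => rfl
  | ops k p ih => simp [cost, opCount, ih]
  | query s a next ih => simp only [cost, opCount, ih]
  | draw q next ih => simp only [cost, opCount, ih]

/-- Worst-case costs add, and the continuation has to be bounded only on results that can occur.
This is how the invariant of the core set enters the cost bounds. -/
theorem cost_bind_le {p : Prog S A α} {f : α → Prog S A β} {F : α → Prop} {w : ℕ} {a b : ℕ}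
    (hp : p.Sat M F) (ha : p.cost M w ≤ a) (hf : ∀ x, F x → (f x).cost M w ≤ b) :
    (p.bind f).cost M w ≤ (a + b : ℕ) := by
  have key : (p.bind f).cost M w ≤ p.cost M w + b := by
    clear ha
    induction p with
    | done x => simpa [cost, Prog.bind] using hf x hp
    | ops k p ih =>
      simp only [cost, Prog.bind]
      rw [add_assoc]
      exact add_le_add_right (ih hp) _
    | query s a next ih =>
      simp only [cost, Prog.bind]
      rw [add_assoc]
      refine add_le_add_right (iSup_le fun s' => (ih _ _ (hp s')).trans ?_) _
      exact add_le_add_left (le_iSup (fun s' => (next (M.r s a) s').cost M w) s') _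
    | draw q next ih =>
      simp only [cost, Prog.bind]
      refine iSup_le fun a => (ih a (hp.2 a)).trans ?_
      exact add_le_add_left (le_iSup (fun a => (next a).cost M w) a) _
  push_cast
  exact key.trans (add_le_add_left ha _)

end Prog

end MCPolitex

end

noncomputable section

namespace MCPolitex

/-! ### Integrals against policies and one-step transitions. -/

section PolicyIntegrals

variable {S : Type u} {A : Type v} [MeasurableSpace S] [Fintype A] [MeasurableSpace A]

theorem Policy.kernel_apply (π : Policy S A) (s : S) :
    π.kernel s = ∑ a, ENNReal.ofReal (π.prob s a) • Measure.dirac a := rfl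

variable [MeasurableSingletonClass A]

theorem Policy.lintegral_kernel (π : Policy S A) (s : S) (f : A → ENNReal) :
    ∫⁻ a, f a ∂(π.kernel s) = ∑ a, ENNReal.ofReal (π.prob s a) * f a := by
  rw [π.kernel_apply, lintegral_finsetSum_measure]
  simp [lintegral_smul_measure, lintegral_dirac]

theorem Policy.integral_kernel (π : Policy S A) (s : S) (f : A → ℝ) :
    ∫ a, f a ∂(π.kernel s) = ∑ a, π.prob s a * f a := by
  rw [π.kernel_apply, integral_finsetSum_measure]
  · simp [integral_smul_measure, integral_dirac, ENNReal.toReal_ofReal (π.nonneg s _)]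
  · intro a _
    exact (integrable_dirac (by simp)).smul_measure ENNReal.ofReal_ne_top

theorem integrable_of_mem_Icc {X : Type*} [MeasurableSpace X] {μ : Measure X} [IsFiniteMeasure μ]
    {f : X → ℝ} (hf : Measurable f) {lo hi : ℝ} (h : ∀ x, f x ∈ Set.Icc lo hi) : Integrable f μ :=
  Integrable.of_mem_Icc lo hi hf.aemeasurable (Filter.Eventually.of_forall h)

theorem integral_mem_Icc {X : Type*} [MeasurableSpace X] {μ : Measure X} [IsProbabilityMeasure μ]
    {f : X → ℝ} (hf : Measurable f) {lo hi : ℝ} (h : ∀ x, f x ∈ Set.Icc lo hi) :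
    ∫ x, f x ∂μ ∈ Set.Icc lo hi := by
  have hi := integrable_of_mem_Icc (μ := μ) hf h
  constructor
  · simpa using integral_mono (integrable_const lo) hi fun x => (h x).1
  · simpa using integral_mono hi (integrable_const _) fun x => (h x).2

variable (M : MDP S A) (π : Policy S A)

theorem MDP.lintegral_stepKernel (z : S × A) {f : S × A → ENNReal} (hf : Measurable f) :
    ∫⁻ y, f y ∂(M.stepKernel π z) =
      ∫⁻ s', ∑ a, ENNReal.ofReal (π.prob s' a) * f (s', a) ∂(M.P z) := by
  have := M.isMarkov
  rw [MDP.stepKernel, Kernel.lintegral_compProd _ _ _ hf]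
  simp only [Kernel.lintegral_prodMkLeft]
  exact lintegral_congr fun s' => π.lintegral_kernel s' _

theorem MDP.integral_stepKernel (z : S × A) {f : S × A → ℝ} (hf : Measurable f) {lo hi : ℝ}
    (hb : ∀ y, f y ∈ Set.Icc lo hi) :
    ∫ y, f y ∂(M.stepKernel π z) = ∫ s', ∑ a, π.prob s' a * f (s', a) ∂(M.P z) := by
  have := M.isMarkov
  have hi := integrable_of_mem_Icc (μ := M.stepKernel π z) hf hb
  rw [MDP.stepKernel] at hi ⊢
  rw [integral_compProd hi]
  simp only [Kernel.prodMkLeft_apply]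
  exact integral_congr_ae (Filter.Eventually.of_forall fun s' => π.integral_kernel s' _)

end PolicyIntegrals

/-! ### The effective horizon and bounds for the return. -/

section Horizon

variable {S : Type u} {A : Type v} [MeasurableSpace S] [MeasurableSpace A] (M : MDP S A)

/-- The effective horizon `1 / (1 - γ)`. -/
def MDP.horizon : ℝ := (1 - M.γ)⁻¹

theorem MDP.one_sub_γ_pos : 0 < 1 - M.γ := sub_pos.2 M.γ_lt_one

theorem MDP.horizon_pos : 0 < M.horizon := inv_pos.2 M.one_sub_γ_pos

theorem MDP.one_le_horizon : 1 ≤ M.horizon :=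
  (one_le_inv₀ M.one_sub_γ_pos).2 (by linarith [M.γ_pos])

theorem MDP.one_add_γ_mul_horizon : 1 + M.γ * M.horizon = M.horizon := by
  have := M.one_sub_γ_pos.ne'
  rw [MDP.horizon]
  field_simp
  ring

theorem MDP.ret_summable (ω : ℕ → S × A) :
    Summable fun t => M.γ ^ t * M.r (ω t).1 (ω t).2 := by
  refine Summable.of_nonneg_of_le
    (fun t => mul_nonneg (pow_nonneg M.γ_pos.le _) (M.r_nonneg _ _))
    (fun t => mul_le_of_le_one_right (pow_nonneg M.γ_pos.le _) (M.r_le_one _ _))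
    (summable_geometric_of_lt_one M.γ_pos.le M.γ_lt_one)

theorem MDP.ret_mem_Icc (ω : ℕ → S × A) : M.ret ω ∈ Set.Icc 0 M.horizon := by
  constructor
  · exact tsum_nonneg fun t => mul_nonneg (pow_nonneg M.γ_pos.le _) (M.r_nonneg _ _)
  · rw [MDP.horizon, ← tsum_geometric_of_lt_one M.γ_pos.le M.γ_lt_one]
    exact (M.ret_summable ω).tsum_le_tsum
      (fun t => mul_le_of_le_one_right (pow_nonneg M.γ_pos.le _) (M.r_le_one _ _))
      (summable_geometric_of_lt_one M.γ_pos.le M.γ_lt_one)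

theorem MDP.measurable_ret : Measurable M.ret := by
  refine measurable_of_tendsto_metrizable
    (f := fun n ω => ∑ t ∈ Finset.range n, M.γ ^ t * M.r (ω t).1 (ω t).2) (fun n => ?_) ?_
  · exact Finset.measurable_sum _ fun t _ =>
      (M.measurable_r.comp (measurable_pi_apply t)).const_mul _
  · exact tendsto_pi_nhds.2 fun ω => (M.ret_summable ω).hasSum.tendsto_sum_nat

end Horizon

/-! ### Marginals of the trajectory and the Bellman equation. -/

section Bellman

variable {S : Type u} {A : Type v} [MeasurableSpace S] [Fintype A] [MeasurableSpace A]
  [MeasurableSingletonClass A] (M : MDP S A) (π : Policy S A)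

instance : IsMarkovKernel (M.trajFrom π) := by
  unfold MDP.trajFrom
  infer_instance

theorem MDP.measurable_Q : Measurable fun z : S × A => M.Q π z.1 z.2 := by
  have h := (M.measurable_ret.stronglyMeasurable).integral_kernel (κ := M.trajFrom π)
  exact h.measurable

theorem MDP.Q_mem_Icc (s : S) (a : A) : M.Q π s a ∈ Set.Icc 0 M.horizon :=
  integral_mem_Icc M.measurable_ret M.ret_mem_Icc

theorem MDP.V_eq (s : S) : M.V π s = ∑ a, π.prob s a * M.Q π s a := by
  have hm : Measurable fun a : A => (s, a) := measurable_prodMk_left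
  have hp : IsProbabilityMeasure ((π.kernel s).map fun a => (s, a)) :=
    Measure.isProbabilityMeasure_map hm.aemeasurable
  -- Viewing the initial distribution as a constant kernel turns `Measure.bind` into a composition
  -- of kernels, for which the integral formula applies.
  set κ : Kernel Unit (S × A) := Kernel.const Unit ((π.kernel s).map fun a => (s, a)) with hκ
  have hc : ((π.kernel s).map fun a => (s, a)).bind (M.trajFrom π) = (M.trajFrom π ∘ₖ κ) () := by
    rw [Kernel.comp_apply, hκ, Kernel.const_apply]
  have hint : ∀ μ : Measure (ℕ → S × A), IsProbabilityMeasure μ → Integrable M.ret μ :=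
    fun μ _ => integrable_of_mem_Icc M.measurable_ret M.ret_mem_Icc
  rw [MDP.V, hc, Kernel.integral_comp (hint _ inferInstance), hκ, Kernel.const_apply,
    integral_map hm.aemeasurable, π.integral_kernel]
  · rfl
  · exact (M.measurable_Q π).aestronglyMeasurable

theorem MDP.V_mem_Icc (s : S) : M.V π s ∈ Set.Icc 0 M.horizon := by
  rw [M.V_eq]
  constructor
  · exact Finset.sum_nonneg fun a _ => mul_nonneg (π.nonneg s a) (M.Q_mem_Icc π s a).1
  · calc ∑ a, π.prob s a * M.Q π s a ≤ ∑ a, π.prob s a * M.horizon :=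
        Finset.sum_le_sum fun a _ =>
          mul_le_mul_of_nonneg_left (M.Q_mem_Icc π s a).2 (π.nonneg s a)
      _ = M.horizon := by rw [← Finset.sum_mul, π.sum_eq_one, one_mul]

/-- The law of the state-action pair at time `t`, given the one at time `0`. -/
def MDP.marginal (t : ℕ) : Kernel (S × A) (S × A) :=
  (M.trajFrom π).map fun ω => ω t

instance (t : ℕ) : IsMarkovKernel (M.marginal π t) :=
  Kernel.IsMarkovKernel.map _ (measurable_pi_apply t)

theorem MDP.marginal_zero : M.marginal π 0 = Kernel.id := by
  have he : Measurable fun x : (i : Finset.Iic 0) → S × A => x ⟨0, by simp⟩ :=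
    measurable_pi_apply _
  have h : (fun ω : ℕ → S × A => ω 0) =
      (fun x : (i : Finset.Iic 0) → S × A => x ⟨0, by simp⟩) ∘
        Preorder.frestrictLe (π := fun _ => S × A) 0 := rfl
  ext z : 1
  rw [MDP.marginal, MDP.trajFrom, Kernel.map_apply _ (measurable_pi_apply 0), Kernel.comap_apply, h,
    ← Measure.map_map he (Preorder.measurable_frestrictLe 0),
    Kernel.traj_map_frestrictLe_apply, Kernel.partialTraj_self, Kernel.id_apply, Kernel.id_apply]
  exact Measure.map_dirac' he _

theorem MDP.marginal_succ (t : ℕ) :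
    M.marginal π (t + 1) = M.stepKernel π ∘ₖ M.marginal π t := by
  set K : (n : ℕ) → Kernel ((i : Finset.Iic n) → S × A) (S × A) := fun n =>
    (M.stepKernel π).comap (fun h => h ⟨n, Finset.mem_Iic.2 le_rfl⟩) (measurable_pi_apply _)
    with hK
  -- A one-time marginal of the infinite trajectory is the marginal of a finite partial trajectory,
  -- where one more step is a composition with the transition.
  have hev : ∀ n, (Kernel.traj (X := fun _ => S × A) K 0).map (fun ω => ω n) =
      (Kernel.partialTraj (X := fun _ => S × A) K 0 n).map
        (fun x => x ⟨n, Finset.mem_Iic.2 le_rfl⟩) := fun n => by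
    rw [← Kernel.traj_map_frestrictLe,
      ← Kernel.map_comp_right _ (Preorder.measurable_frestrictLe n) (measurable_pi_apply _)]
    rfl
  have key : (Kernel.traj (X := fun _ => S × A) K 0).map (fun ω => ω (t + 1)) =
      M.stepKernel π ∘ₖ (Kernel.traj (X := fun _ => S × A) K 0).map (fun ω => ω t) := by
    rw [hev, hev, Kernel.partialTraj_succ_eq_comp (Nat.zero_le t), Kernel.map_comp,
      Kernel.map_partialTraj_succ_self, hK]
    exact (Kernel.comp_map _ _ (measurable_pi_apply _)).symm
  ext z : 1
  have h2 : ∀ n, M.marginal π n z = ((Kernel.traj (X := fun _ => S × A) K 0).map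
      (fun ω => ω n)) (fun _ => z) := fun n => by
    rw [MDP.marginal, Kernel.map_apply _ (measurable_pi_apply n),
      Kernel.map_apply _ (measurable_pi_apply n)]
    rfl
  rw [Kernel.comp_apply, h2, h2, key, Kernel.comp_apply]

/-- All steps use the same kernel, so by associativity the first transition can be split off instead
of the last. This is the form that the Bellman equation needs. -/
theorem MDP.marginal_succ' (t : ℕ) :
    M.marginal π (t + 1) = M.marginal π t ∘ₖ M.stepKernel π := by
  induction t with
  | zero => rw [M.marginal_succ, M.marginal_zero, Kernel.id_comp, Kernel.comp_id]
  | succ t ih =>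
    conv_lhs => rw [M.marginal_succ, ih, ← Kernel.comp_assoc, ← M.marginal_succ]

theorem MDP.Q_eq_tsum (z : S × A) :
    M.Q π z.1 z.2 = ∑' t, M.γ ^ t * ∫ y, M.r y.1 y.2 ∂(M.marginal π t z) := by
  have h : ∀ t, ∫ ω, M.γ ^ t * M.r (ω t).1 (ω t).2 ∂(M.trajFrom π z) =
      M.γ ^ t * ∫ y, M.r y.1 y.2 ∂(M.marginal π t z) := fun t => by
    rw [integral_const_mul, MDP.marginal, Kernel.map_apply _ (measurable_pi_apply t),
      integral_map (measurable_pi_apply t).aemeasurable M.measurable_r.aestronglyMeasurable]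
  simp_rw [← h]
  refine (hasSum_integral_of_dominated_convergence (fun t _ => M.γ ^ t) (fun t => ?_)
    (fun t => ?_) ?_ ?_ ?_).tsum_eq.symm
  · exact ((M.measurable_r.comp (measurable_pi_apply t)).const_mul _).aestronglyMeasurable
  · refine Filter.Eventually.of_forall fun ω => ?_
    rw [Real.norm_of_nonneg (mul_nonneg (pow_nonneg M.γ_pos.le _) (M.r_nonneg _ _))]
    exact mul_le_of_le_one_right (pow_nonneg M.γ_pos.le _) (M.r_le_one _ _)
  · exact Filter.Eventually.of_forall fun _ => summable_geometric_of_lt_one M.γ_pos.le M.γ_lt_one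
  · exact integrable_const _
  · exact Filter.Eventually.of_forall fun ω => (M.ret_summable ω).hasSum

/-- The Bellman equation for the action-value function. -/
theorem MDP.Q_bellman (z : S × A) :
    M.Q π z.1 z.2 = M.r z.1 z.2 + M.γ * ∫ y, M.Q π y.1 y.2 ∂(M.stepKernel π z) := by
  have hr : ∀ z : S × A, M.r z.1 z.2 ∈ Set.Icc 0 1 := fun z => ⟨M.r_nonneg _ _, M.r_le_one _ _⟩
  have hE : ∀ t (z : S × A), ∫ y, M.r y.1 y.2 ∂(M.marginal π t z) ∈ Set.Icc 0 1 :=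
    fun t z => integral_mem_Icc M.measurable_r hr
  have hEm : ∀ t, Measurable fun z => ∫ y, M.r y.1 y.2 ∂(M.marginal π t z) := fun t =>
    (M.measurable_r.stronglyMeasurable.integral_kernel (κ := M.marginal π t)).measurable
  have hsum : ∀ z : S × A,
      Summable fun t => M.γ ^ t * ∫ y, M.r y.1 y.2 ∂(M.marginal π t z) := fun z =>
    Summable.of_nonneg_of_le (fun t => mul_nonneg (pow_nonneg M.γ_pos.le _) (hE t z).1)
      (fun t => mul_le_of_le_one_right (pow_nonneg M.γ_pos.le _) (hE t z).2)
      (summable_geometric_of_lt_one M.γ_pos.le M.γ_lt_one)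
  have hstep : ∀ t, ∫ y, M.γ ^ t * ∫ y', M.r y'.1 y'.2 ∂(M.marginal π t y) ∂(M.stepKernel π z) =
      M.γ ^ t * ∫ y, M.r y.1 y.2 ∂(M.marginal π (t + 1) z) := fun t => by
    rw [integral_const_mul, M.marginal_succ',
      Kernel.integral_comp (integrable_of_mem_Icc M.measurable_r hr)]
  have hint : ∫ y, M.Q π y.1 y.2 ∂(M.stepKernel π z) =
      ∑' t, M.γ ^ t * ∫ y, M.r y.1 y.2 ∂(M.marginal π (t + 1) z) := by
    simp_rw [← hstep, M.Q_eq_tsum π]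
    refine (hasSum_integral_of_dominated_convergence (fun t _ => M.γ ^ t) (fun t => ?_)
      (fun t => ?_) ?_ ?_ ?_).tsum_eq.symm
    · exact ((hEm t).const_mul _).aestronglyMeasurable
    · refine Filter.Eventually.of_forall fun y => ?_
      rw [Real.norm_of_nonneg (mul_nonneg (pow_nonneg M.γ_pos.le _) (hE t y).1)]
      exact mul_le_of_le_one_right (pow_nonneg M.γ_pos.le _) (hE t y).2
    · exact Filter.Eventually.of_forall fun _ =>
        summable_geometric_of_lt_one M.γ_pos.le M.γ_lt_one
    · exact integrable_const _
    · exact Filter.Eventually.of_forall fun y => (hsum y).hasSum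
  rw [hint, M.Q_eq_tsum π, (hsum z).tsum_eq_zero_add, ← tsum_mul_left]
  congr 1
  · rw [M.marginal_zero, Kernel.id_apply,
      integral_dirac' _ _ M.measurable_r.stronglyMeasurable, pow_zero, one_mul]
  · exact tsum_congr fun t => by ring

end Bellman

/-! ### Law and mean of the truncated return. -/

section ReturnLaw

variable {S : Type u} {A : Type v} [MeasurableSpace S] [Fintype A] [MeasurableSpace A]
  [MeasurableSingletonClass A] (M : MDP S A) (π : Policy S A)

/-- The law of the discounted reward `∑_{t ≤ k} γ^t r(s_t, a_t)`, given `(s_0, a_0)`. -/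
def MDP.retLaw : ℕ → Kernel (S × A) ℝ
  | 0 => Kernel.deterministic (fun z => M.r z.1 z.2) M.measurable_r
  | k + 1 => (Kernel.id ×ₖ (MDP.retLaw k ∘ₖ M.stepKernel π)).map
      fun y => M.r y.1.1 y.1.2 + M.γ * y.2

theorem MDP.measurable_addReward :
    Measurable fun y : (S × A) × ℝ => M.r y.1.1 y.1.2 + M.γ * y.2 :=
  (M.measurable_r.comp measurable_fst).add (measurable_snd.const_mul _)

instance (k : ℕ) : IsMarkovKernel (M.retLaw π k) := by
  induction k with
  | zero => unfold MDP.retLaw; infer_instance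
  | succ k ih =>
    unfold MDP.retLaw
    exact Kernel.IsMarkovKernel.map _ M.measurable_addReward

theorem MDP.retLaw_succ_apply (k : ℕ) (z : S × A) :
    M.retLaw π (k + 1) z = ((M.retLaw π k ∘ₖ M.stepKernel π) z).map
      fun x => M.r z.1 z.2 + M.γ * x := by
  rw [MDP.retLaw, Kernel.map_apply _ M.measurable_addReward, Kernel.prod_apply, Kernel.id_apply,
    Measure.dirac_prod, Measure.map_map M.measurable_addReward measurable_prodMk_left]
  rfl

theorem MDP.lintegral_retLaw_succ (k : ℕ) (z : S × A) {g : ℝ → ENNReal} (hg : Measurable g) :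
    ∫⁻ x, g x ∂(M.retLaw π (k + 1) z) =
      ∫⁻ y, ∫⁻ x, g (M.r z.1 z.2 + M.γ * x) ∂(M.retLaw π k y) ∂(M.stepKernel π z) := by
  have hm : Measurable fun x : ℝ => M.r z.1 z.2 + M.γ * x :=
    (measurable_id.const_mul _).const_add _
  rw [M.retLaw_succ_apply, lintegral_map hg hm]
  exact Kernel.lintegral_comp _ _ _ (hg.comp hm)

theorem MDP.retLaw_mem_Icc (k : ℕ) (z : S × A) :
    ∀ᵐ x ∂(M.retLaw π k z), x ∈ Set.Icc 0 M.horizon := by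
  induction k generalizing z with
  | zero =>
    rw [MDP.retLaw, Kernel.deterministic_apply,
      ae_dirac_iff (p := (· ∈ Set.Icc 0 M.horizon)) measurableSet_Icc]
    exact ⟨M.r_nonneg _ _, (M.r_le_one _ _).trans M.one_le_horizon⟩
  | succ k ih =>
    have hm : Measurable fun x : ℝ => M.r z.1 z.2 + M.γ * x :=
      (measurable_id.const_mul _).const_add _
    rw [M.retLaw_succ_apply, ae_map_iff hm.aemeasurable (p := (· ∈ Set.Icc 0 M.horizon))
      measurableSet_Icc]
    refine Kernel.ae_comp_of_ae_ae (hm measurableSet_Icc) ?_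
    refine Filter.Eventually.of_forall fun y => (ih y).mono fun x hx => ?_
    constructor
    · exact add_nonneg (M.r_nonneg _ _) (mul_nonneg M.γ_pos.le hx.1)
    · rw [← M.one_add_γ_mul_horizon]
      exact add_le_add (M.r_le_one _ _) (mul_le_mul_of_nonneg_left hx.2 M.γ_pos.le)

/-- The mean of the discounted reward of the times `0, …, k`. -/
def MDP.truncQ (k : ℕ) (z : S × A) : ℝ := ∫ x, x ∂(M.retLaw π k z)

theorem MDP.integrable_retLaw (k : ℕ) (z : S × A) :
    Integrable (fun x : ℝ => x) (M.retLaw π k z) :=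
  Integrable.of_mem_Icc _ _ measurable_id.aemeasurable (M.retLaw_mem_Icc π k z)

theorem MDP.measurable_truncQ (k : ℕ) : Measurable (M.truncQ π k) :=
  (measurable_id.stronglyMeasurable.integral_kernel (κ := M.retLaw π k)).measurable

theorem MDP.truncQ_mem_Icc (k : ℕ) (z : S × A) : M.truncQ π k z ∈ Set.Icc 0 M.horizon := by
  have hi := M.integrable_retLaw π k z
  constructor
  · exact integral_nonneg_of_ae ((M.retLaw_mem_Icc π k z).mono fun x hx => hx.1)
  · rw [MDP.truncQ]
    simpa using integral_mono_ae hi (integrable_const M.horizon)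
      ((M.retLaw_mem_Icc π k z).mono fun x hx => hx.2)

theorem MDP.truncQ_zero (z : S × A) : M.truncQ π 0 z = M.r z.1 z.2 := by
  rw [MDP.truncQ, MDP.retLaw, Kernel.deterministic_apply, integral_dirac]

theorem MDP.truncQ_succ (k : ℕ) (z : S × A) :
    M.truncQ π (k + 1) z = M.r z.1 z.2 + M.γ * ∫ y, M.truncQ π k y ∂(M.stepKernel π z) := by
  have hm : Measurable fun x : ℝ => M.r z.1 z.2 + M.γ * x :=
    (measurable_id.const_mul _).const_add _
  have hae : ∀ᵐ x ∂((M.retLaw π k ∘ₖ M.stepKernel π) z), x ∈ Set.Icc 0 M.horizon :=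
    Kernel.ae_comp_of_ae_ae measurableSet_Icc
      (Filter.Eventually.of_forall fun y => M.retLaw_mem_Icc π k y)
  have hint : Integrable (fun x : ℝ => x) ((M.retLaw π k ∘ₖ M.stepKernel π) z) :=
    Integrable.of_mem_Icc _ _ measurable_id.aemeasurable hae
  rw [MDP.truncQ, M.retLaw_succ_apply, integral_map (f := fun x => x) hm.aemeasurable
    measurable_id.aestronglyMeasurable, integral_add (integrable_const _) (hint.const_mul _),
    integral_const_mul, Kernel.integral_comp hint]
  simp [MDP.truncQ]

/-- Both functions obey the same one-step recursion, so every step contracts the difference by `γ`.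
For `k = 0` the difference is exactly the discounted expectation of the next action value. -/
theorem MDP.abs_truncQ_sub_Q_le (k : ℕ) (z : S × A) :
    |M.truncQ π k z - M.Q π z.1 z.2| ≤ M.γ ^ (k + 1) * M.horizon := by
  have hQ : ∀ y : S × A, M.Q π y.1 y.2 ∈ Set.Icc 0 M.horizon := fun y => M.Q_mem_Icc π _ _
  induction k generalizing z with
  | zero =>
    have h := integral_mem_Icc (μ := M.stepKernel π z) (M.measurable_Q π) hQ
    rw [M.truncQ_zero, M.Q_bellman π z, sub_add_cancel_left, abs_neg, zero_add, pow_one,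
      abs_of_nonneg (mul_nonneg M.γ_pos.le h.1)]
    exact mul_le_mul_of_nonneg_left h.2 M.γ_pos.le
  | succ k ih =>
    have h1 := integrable_of_mem_Icc (μ := M.stepKernel π z) (M.measurable_Q π) hQ
    have h2 := integrable_of_mem_Icc (μ := M.stepKernel π z) (M.measurable_truncQ π k)
      (M.truncQ_mem_Icc π k)
    have h3 := integral_mem_Icc (μ := M.stepKernel π z)
      ((M.measurable_truncQ π k).sub (M.measurable_Q π)) (fun y => abs_le.1 (ih y))
    simp only [Pi.sub_apply] at h3
    rw [integral_sub h2 h1] at h3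
    rw [M.truncQ_succ, M.Q_bellman π z, add_sub_add_left_eq_sub, ← mul_sub, abs_mul,
      abs_of_pos M.γ_pos, pow_succ' _ (k + 1), mul_assoc]
    exact mul_le_mul_of_nonneg_left (abs_le.2 h3) M.γ_pos.le

end ReturnLaw

end MCPolitex

end

noncomputable section

namespace MCPolitex

open Matrix

/-! ### Gram matrices, the elliptical potential and ridge regression. -/

section Gram

variable {d : ℕ}

/-- The regularized Gram matrix `Φᵀ Φ + lam I`. -/
def gram (lam : ℝ) (xs : List (Fin d → ℝ)) : Matrix (Fin d) (Fin d) ℝ :=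
  (rowMatrix xs).transpose * rowMatrix xs + lam • (1 : Matrix (Fin d) (Fin d) ℝ)

/-- The squared norm `xᵀ (Φᵀ Φ + lam I)⁻¹ x`. -/
def leverage (lam : ℝ) (xs : List (Fin d → ℝ)) (x : Fin d → ℝ) : ℝ :=
  x ⬝ᵥ (gramInv lam xs).mulVec x

variable {lam : ℝ}

theorem gramInv_eq (xs : List (Fin d → ℝ)) : gramInv lam xs = (gram lam xs)⁻¹ := rfl

theorem gram_posDef (hlam : 0 < lam) (xs : List (Fin d → ℝ)) : (gram lam xs).PosDef := by
  refine Matrix.PosDef.posSemidef_add ?_ (Matrix.PosDef.one.smul hlam)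
  have := Matrix.posSemidef_conjTranspose_mul_self (rowMatrix xs)
  rwa [Matrix.conjTranspose_eq_transpose_of_trivial] at this

theorem isUnit_det_gram (hlam : 0 < lam) (xs : List (Fin d → ℝ)) : IsUnit (gram lam xs).det :=
  (Matrix.isUnit_iff_isUnit_det _).1 (gram_posDef hlam xs).isUnit

theorem gram_append (xs : List (Fin d → ℝ)) (x : Fin d → ℝ) :
    gram lam (xs ++ [x]) = gram lam xs + Matrix.vecMulVec x x := by
  rw [gram, gram, rowMatrix_gram, rowMatrix_gram, List.map_append, List.sum_append]
  simp only [List.map_cons, List.map_nil, List.sum_cons, List.sum_nil, add_zero]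
  abel

theorem gram_nil : gram lam ([] : List (Fin d → ℝ)) = lam • (1 : Matrix (Fin d) (Fin d) ℝ) := by
  rw [gram, rowMatrix_gram]
  simp

theorem leverage_nonneg (hlam : 0 < lam) (xs : List (Fin d → ℝ)) (x : Fin d → ℝ) :
    0 ≤ leverage lam xs x := by
  have := (gram_posDef hlam xs).inv.posSemidef.dotProduct_mulVec_nonneg x
  simpa [leverage, gramInv_eq] using this

theorem gramInv_transpose (xs : List (Fin d → ℝ)) : (gramInv lam xs)ᵀ = gramInv lam xs := by
  rw [gramInv_eq, Matrix.transpose_nonsing_inv]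
  congr 1
  simp [gram, Matrix.transpose_mul]

/-- The Sherman-Morrison formula, read off from the correctness of the rank-one update procedure. -/
theorem leverage_append (hlam : 0 < lam) (xs : List (Fin d → ℝ)) (x y : Fin d → ℝ) :
    leverage lam (xs ++ [x]) y =
      leverage lam xs y - (y ⬝ᵥ (gramInv lam xs).mulVec x) ^ 2 / (1 + leverage lam xs x) := by
  have h : gramInv lam (xs ++ [x]) = (rankOneUpdate (gramInv lam xs) x).1 := by
    rw [← gramInvProcedure_fst hlam, ← gramInvProcedure_fst hlam]
    simp [gramInvProcedure, List.foldl_append]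
  have hs : Matrix.vecMul x (gramInv lam xs) = (gramInv lam xs).mulVec x := by
    rw [← Matrix.mulVec_transpose, gramInv_transpose]
  rw [leverage, h, rankOneUpdate]
  simp only [Matrix.sub_mulVec, Matrix.smul_mulVec, dotProduct_sub, dotProduct_smul, hs,
    Matrix.vecMulVec_mulVec, op_smul_eq_smul, smul_eq_mul]
  have hc : (gramInv lam xs).mulVec x ⬝ᵥ y = y ⬝ᵥ (gramInv lam xs).mulVec x := dotProduct_comm _ _
  rw [hc, leverage, leverage]
  ring

theorem leverage_append_le (hlam : 0 < lam) (xs : List (Fin d → ℝ)) (x y : Fin d → ℝ) :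
    leverage lam (xs ++ [x]) y ≤ leverage lam xs y := by
  rw [leverage_append hlam]
  have h1 := leverage_nonneg hlam xs x
  have : 0 ≤ (y ⬝ᵥ (gramInv lam xs).mulVec x) ^ 2 / (1 + leverage lam xs x) := by positivity
  linarith

/-- A leverage `ℓ` becomes `ℓ / (1 + ℓ)` once the vector itself is added; hence at threshold one an
added pair is certain from then on. -/
theorem leverage_append_self_le_one (hlam : 0 < lam) (xs : List (Fin d → ℝ)) (x : Fin d → ℝ) :
    leverage lam (xs ++ [x]) x ≤ 1 := by
  rw [leverage_append hlam]
  have h1 := leverage_nonneg hlam xs x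
  change leverage lam xs x - (leverage lam xs x) ^ 2 / (1 + leverage lam xs x) ≤ 1
  have h2 : 0 < 1 + leverage lam xs x := by linarith
  have h3 : leverage lam xs x - (leverage lam xs x) ^ 2 / (1 + leverage lam xs x) =
      leverage lam xs x / (1 + leverage lam xs x) := by
    field_simp
    ring
  rw [h3, div_le_one h2]
  linarith

/-- The matrix determinant lemma. It turns leverage above one into at least a doubling of the
determinant. -/
theorem det_gram_append (hlam : 0 < lam) (xs : List (Fin d → ℝ)) (x : Fin d → ℝ) :
    (gram lam (xs ++ [x])).det = (gram lam xs).det * (1 + leverage lam xs x) := by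
  rw [gram_append, Matrix.vecMulVec_eq Unit,
    Matrix.det_add_replicateCol_mul_replicateRow (isUnit_det_gram hlam xs)]
  congr 1
  rw [Matrix.det_unique, Matrix.add_apply, Matrix.one_apply_eq, Matrix.mul_assoc]
  congr 1

theorem trace_gram (xs : List (Fin d → ℝ)) :
    (gram lam xs).trace = lam * d + (xs.map fun x => x ⬝ᵥ x).sum := by
  induction xs using List.reverseRecOn with
  | nil => simp [gram_nil]
  | append_singleton xs x ih =>
    rw [gram_append, Matrix.trace_add, ih, Matrix.trace_vecMulVec]
    simp [add_assoc]

/-- Arithmetic-geometric mean inequality for the eigenvalues, whose sum is the trace. In logarithmic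
form it is the tangent bound `log t ≤ t - 1` at `t = eigenvalue / c`. -/
theorem log_det_gram_le (hd : 0 < d) (hlam : 0 < lam) {xs : List (Fin d → ℝ)}
    (hxs : ∀ x ∈ xs, x ⬝ᵥ x ≤ 1) :
    Real.log (gram lam xs).det ≤ d * Real.log (lam + xs.length / d) := by
  have hpd := gram_posDef hlam xs
  have hd' : (0 : ℝ) < d := Nat.cast_pos.2 hd
  set c : ℝ := lam + xs.length / d with hc
  have hcpos : 0 < c := by positivity
  have htr : (gram lam xs).trace ≤ d * c := by
    rw [trace_gram, hc]
    have hle : (xs.map fun x => x ⬝ᵥ x).sum ≤ xs.length := by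
      have := List.sum_le_card_nsmul (xs.map fun x => x ⬝ᵥ x) 1 (by simpa using hxs)
      simpa using this
    have : (d : ℝ) * (xs.length / d) = xs.length := by field_simp
    nlinarith
  have hdet := hpd.1.det_eq_prod_eigenvalues
  have htrace := hpd.1.trace_eq_sum_eigenvalues
  simp only [RCLike.ofReal_real_eq_id, id_eq] at hdet htrace
  rw [hdet, Real.log_prod fun i _ => (hpd.eigenvalues_pos i).ne']
  calc ∑ i, Real.log (hpd.1.eigenvalues i)
      ≤ ∑ i, (Real.log c + (hpd.1.eigenvalues i / c - 1)) := by
        refine Finset.sum_le_sum fun i _ => ?_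
        have hpos := hpd.eigenvalues_pos i
        have := Real.log_le_sub_one_of_pos (div_pos hpos hcpos)
        rw [Real.log_div hpos.ne' hcpos.ne'] at this
        linarith
    _ = d * Real.log c + ((gram lam xs).trace / c - d) := by
        rw [htrace, Finset.sum_add_distrib, Finset.sum_sub_distrib, Finset.sum_div]
        simp
    _ ≤ d * Real.log c := by
        have : (gram lam xs).trace / c ≤ d := (div_le_iff₀ hcpos).2 htr
        linarith

/-- The quantity `1 + log (1 + lam⁻¹)` in the bound for the size of the core set. -/
def logFactor (lam : ℝ) : ℝ := 1 + Real.log (1 + lam⁻¹)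

theorem one_le_logFactor (hlam : 0 < lam) : 1 ≤ logFactor lam := by
  have : 0 < lam⁻¹ := inv_pos.2 hlam
  have := Real.log_nonneg (by linarith : (1 : ℝ) ≤ 1 + lam⁻¹)
  rw [logFactor]
  linarith

/-- Lists of features along which the determinant of the Gram matrix doubles with each element
after the first one. -/
def Doubling (lam : ℝ) (xs : List (Fin d → ℝ)) : Prop :=
  lam ^ d * 2 ^ (xs.length - 1) ≤ (gram lam xs).det

theorem doubling_nil : Doubling lam ([] : List (Fin d → ℝ)) := by
  simp [Doubling, gram_nil]

theorem Doubling.singleton (hlam : 0 < lam) (x : Fin d → ℝ) : Doubling lam [x] := by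
  have h := det_gram_append hlam [] x
  have h1 := leverage_nonneg hlam [] x
  rw [List.nil_append, gram_nil, Matrix.det_smul, Matrix.det_one] at h
  rw [Doubling, h]
  simp only [List.length_singleton, Fintype.card_fin]
  have : 0 < lam ^ d := pow_pos hlam d
  norm_num
  nlinarith

theorem Doubling.append (hlam : 0 < lam) {xs : List (Fin d → ℝ)} (h : Doubling lam xs)
    (hne : xs ≠ []) {x : Fin d → ℝ} (hx : 1 < leverage lam xs x) : Doubling lam (xs ++ [x]) := by
  have hlen : 0 < xs.length := List.length_pos_iff.2 hne
  rw [Doubling] at h ⊢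
  rw [det_gram_append hlam, List.length_append, List.length_singleton, Nat.add_sub_cancel]
  have e : (2 : ℝ) ^ xs.length = 2 ^ (xs.length - 1) * 2 := by
    rw [← pow_succ, Nat.sub_add_cancel hlen]
  rw [e, ← mul_assoc]
  have : 0 < (gram lam xs).det := (gram_posDef hlam xs).det_pos
  exact mul_le_mul h (by linarith) (by norm_num) this.le

/-- The elliptical potential bound. -/
theorem Doubling.length_le (hd : 0 < d) (hlam : 0 < lam) {xs : List (Fin d → ℝ)}
    (h : Doubling lam xs) (hxs : ∀ x ∈ xs, x ⬝ᵥ x ≤ 1) :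
    (xs.length : ℝ) ≤ 3 * (d * logFactor lam) := by
  have hd' : (0 : ℝ) < d := Nat.cast_pos.2 hd
  have hd1 : (1 : ℝ) ≤ d := Nat.one_le_cast.2 hd
  have hL := one_le_logFactor hlam
  set N : ℝ := (xs.length : ℝ) with hN
  -- Below `d` elements there is nothing to show, because the logarithmic factor is at least one;
  -- otherwise `N / d ≥ 1`.
  rcases lt_or_ge N d with hlt | hge
  · nlinarith
  set l : ℝ := Real.log (1 + lam⁻¹) with hl
  have hlnn : 0 ≤ l := by rw [logFactor] at hL; linarith
  have hx1 : 1 ≤ N / d := (one_le_div hd').2 hge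
  have hx0 : 0 < N / d := by linarith
  have hlog2 := Real.log_two_gt_d9
  have hlog2' := Real.log_two_lt_d9
  have h1 : d * Real.log lam + (N - 1) * Real.log 2 ≤ d * Real.log (lam + N / d) := by
    refine le_trans ?_ (log_det_gram_le hd hlam hxs)
    have hlen : 1 ≤ xs.length := by
      have : (1 : ℝ) ≤ xs.length := by rw [← hN]; linarith
      exact_mod_cast this
    have := Real.log_le_log (by positivity) h
    rw [Real.log_mul (by positivity) (by positivity), Real.log_pow, Real.log_pow,
      Nat.cast_sub hlen, Nat.cast_one] at this
    exact this
  -- From `lam + N / d ≤ (lam + 1) (N / d)`.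
  have h2 : Real.log (lam + N / d) ≤ Real.log lam + l + Real.log (N / d) := by
    have hli : 0 < lam⁻¹ := inv_pos.2 hlam
    rw [hl, ← Real.log_mul hlam.ne' (by positivity), ← Real.log_mul (by positivity) hx0.ne']
    refine Real.log_le_log (by positivity) ?_
    have : lam * (1 + lam⁻¹) = lam + 1 := by field_simp
    rw [this]
    nlinarith
  -- Tangent of the logarithm at `4`: its slope `1/4` is below `log 2`, so the term linear in `N`
  -- can be absorbed on the left, and the resulting constant stays below `3`.
  have h3 : Real.log (N / d) ≤ N / d / 4 + 2 * Real.log 2 - 1 := by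
    have h4 : Real.log 4 = 2 * Real.log 2 := by
      rw [show (4 : ℝ) = 2 ^ 2 by norm_num, Real.log_pow]; norm_num
    have := Real.log_le_sub_one_of_pos (by positivity : 0 < N / d / 4)
    rw [Real.log_div hx0.ne' (by norm_num), h4] at this
    linarith
  have h5 : (N - 1) * Real.log 2 ≤ d * (l + N / d / 4 + 2 * Real.log 2 - 1) := by
    have : Real.log (lam + N / d) ≤ Real.log lam + (l + N / d / 4 + 2 * Real.log 2 - 1) := by
      linarith
    have := mul_le_mul_of_nonneg_left this hd'.le
    rw [mul_add] at this
    linarith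
  have h6 : (d : ℝ) * (l + N / d / 4 + 2 * Real.log 2 - 1) =
      d * (l + 2 * Real.log 2 - 1) + N / 4 := by
    field_simp
    ring
  rw [h6] at h5
  have h7 : N * (Real.log 2 - 1 / 4) ≤ d * (l + 3 * Real.log 2 - 1) := by nlinarith
  have h8 : N * (44 / 100) ≤ N * (Real.log 2 - 1 / 4) :=
    mul_le_mul_of_nonneg_left (by linarith) (by linarith)
  have h9 : (d : ℝ) * (l + 3 * Real.log 2 - 1) ≤ d * (l + 109 / 100) :=
    mul_le_mul_of_nonneg_left (by linarith) hd'.le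
  rw [logFactor, ← hl]
  nlinarith [mul_nonneg hd'.le hlnn]

/-- Error of ridge regression at a point of leverage at most one. -/
theorem abs_ridge_sub_le (hlam : 0 < lam) (xs : List (Fin d → ℝ)) (q : Fin xs.length → ℝ)
    (wst y : Fin d → ℝ) {η b : ℝ} (hη : 0 ≤ η) (hb : wst ⬝ᵥ wst ≤ b ^ 2) (hb0 : 0 ≤ b)
    (hq : ∀ i, |q i - wst ⬝ᵥ xs.get i| ≤ η) (hy : leverage lam xs y ≤ 1) :
    |((gramInv lam xs).mulVec ((rowMatrix xs).transpose.mulVec q)) ⬝ᵥ y - wst ⬝ᵥ y| ≤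
      η * √xs.length + √lam * b := by
  set B := gramInv lam xs with hB
  set Φ := rowMatrix xs with hΦ
  set uu := B.mulVec y with hu
  set e : Fin xs.length → ℝ := q - Φ.mulVec wst with he
  have hBG : gram lam xs * B = 1 := Matrix.mul_nonsing_inv _ (isUnit_det_gram hlam xs)
  have hGu : (gram lam xs).mulVec uu = y := by
    rw [hu, Matrix.mulVec_mulVec, hBG, Matrix.one_mulVec]
  have hGexp : ∀ v : Fin d → ℝ, (gram lam xs).mulVec v = Φᵀ.mulVec (Φ.mulVec v) + lam • v := by
    intro v
    rw [gram, Matrix.add_mulVec, Matrix.mulVec_mulVec, Matrix.smul_mulVec, Matrix.one_mulVec]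
  have hadj : ∀ (v : Fin d → ℝ) (r : Fin xs.length → ℝ), v ⬝ᵥ Φᵀ.mulVec r = Φ.mulVec v ⬝ᵥ r := by
    intro v r
    rw [Matrix.dotProduct_mulVec, Matrix.vecMul_transpose]
  -- With `u = G⁻¹ y` the leverage of `y` is `‖Φ u‖² + lam ‖u‖²`. The prediction error is `⟨Φ u, e⟩
  -- - lam ⟨u, wst⟩`, and Cauchy-Schwarz bounds the noise term by the first summand and the
  -- regularization bias by the second.
  have hlev : (Φ.mulVec uu) ⬝ᵥ (Φ.mulVec uu) + lam * (uu ⬝ᵥ uu) ≤ 1 := by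
    have h1 : uu ⬝ᵥ y = leverage lam xs y := by rw [leverage, dotProduct_comm]
    have h2 : uu ⬝ᵥ y = (Φ.mulVec uu) ⬝ᵥ (Φ.mulVec uu) + lam * (uu ⬝ᵥ uu) := by
      conv_lhs => rw [← hGu, hGexp, dotProduct_add, hadj, dotProduct_smul, smul_eq_mul]
    linarith
  have hBu : ∀ v : Fin d → ℝ, (B.mulVec v) ⬝ᵥ y = uu ⬝ᵥ v := by
    intro v
    rw [hu, dotProduct_comm, Matrix.dotProduct_mulVec, ← Matrix.mulVec_transpose,
      gramInv_transpose]
  have hmain : (B.mulVec (Φᵀ.mulVec q)) ⬝ᵥ y - wst ⬝ᵥ y =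
      (Φ.mulVec uu) ⬝ᵥ e - lam * (uu ⬝ᵥ wst) := by
    have h1 : wst ⬝ᵥ y = (Φ.mulVec uu) ⬝ᵥ (Φ.mulVec wst) + lam * (uu ⬝ᵥ wst) := by
      conv_lhs => rw [← hGu, hGexp, dotProduct_add, hadj, dotProduct_smul, smul_eq_mul,
        dotProduct_comm wst uu, dotProduct_comm (Φ.mulVec wst)]
    rw [hBu, hadj, h1, he, dotProduct_sub]
    ring
  have hnn1 : 0 ≤ (Φ.mulVec uu) ⬝ᵥ (Φ.mulVec uu) :=
    Finset.sum_nonneg fun i _ => mul_self_nonneg _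
  have hnn2 : 0 ≤ uu ⬝ᵥ uu := Finset.sum_nonneg fun i _ => mul_self_nonneg _
  have hcs : ∀ {ι : Type} [Fintype ι] (v r : ι → ℝ), (v ⬝ᵥ r) ^ 2 ≤ (v ⬝ᵥ v) * (r ⬝ᵥ r) := by
    intro ι _ v r
    simpa [dotProduct, sq] using Finset.sum_mul_sq_le_sq_mul_sq Finset.univ v r
  have he2 : e ⬝ᵥ e ≤ xs.length * η ^ 2 := by
    calc e ⬝ᵥ e = ∑ i, e i * e i := rfl
      _ ≤ ∑ _i : Fin xs.length, η ^ 2 := by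
        refine Finset.sum_le_sum fun i _ => ?_
        have h1 : |e i| ≤ η := by
          have := hq i
          rwa [dotProduct_comm] at this
        have := abs_le.1 h1
        nlinarith
      _ = xs.length * η ^ 2 := by simp
  have hb1 : |(Φ.mulVec uu) ⬝ᵥ e| ≤ η * √xs.length := by
    refine abs_le_of_sq_le_sq ?_ (by positivity)
    rw [mul_pow, Real.sq_sqrt (Nat.cast_nonneg _)]
    have h1 : (Φ.mulVec uu) ⬝ᵥ (Φ.mulVec uu) ≤ 1 := by nlinarith
    have h2 : 0 ≤ e ⬝ᵥ e := Finset.sum_nonneg fun i _ => mul_self_nonneg _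
    nlinarith [hcs (Φ.mulVec uu) e]
  have hb2 : |lam * (uu ⬝ᵥ wst)| ≤ √lam * b := by
    refine abs_le_of_sq_le_sq ?_ (by positivity)
    rw [mul_pow, mul_pow, Real.sq_sqrt hlam.le]
    have h1 : lam * (uu ⬝ᵥ uu) ≤ 1 := by nlinarith
    have h3 : lam * (uu ⬝ᵥ wst) ^ 2 ≤ b ^ 2 := by
      calc lam * (uu ⬝ᵥ wst) ^ 2 ≤ lam * ((uu ⬝ᵥ uu) * (wst ⬝ᵥ wst)) :=
            mul_le_mul_of_nonneg_left (hcs uu wst) hlam.le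
        _ = (lam * (uu ⬝ᵥ uu)) * (wst ⬝ᵥ wst) := by ring
        _ ≤ 1 * b ^ 2 := mul_le_mul h1 hb
            (Finset.sum_nonneg fun i _ => mul_self_nonneg _) zero_le_one
        _ = b ^ 2 := one_mul _
    nlinarith
  rw [hmain]
  exact (abs_sub _ _).trans (add_le_add hb1 hb2)

end Gram

end MCPolitex

end

noncomputable section

namespace MCPolitex

theorem Prog.bind_assoc {S : Type u} {A : Type v} {α : Type*} {β : Type*} {δ : Type*}
    (q : Prog S A α) (f : α → Prog S A β) (g : β → Prog S A δ) :
    (q.bind f).bind g = q.bind fun x => (f x).bind g := by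
  induction q with
  | done x => rfl
  | ops k q ih => simp only [Prog.bind, ih]
  | query s a next ih => simp only [Prog.bind, ih]
  | draw q next ih => simp only [Prog.bind, ih]

/-! ### Every early exit reports an uncertain pair. -/

section Exit

variable {S : Type u} {A : Type v} [MeasurableSpace S] [Fintype A] [MeasurableSpace A] [Nonempty A]
  {d : ℕ} {M : MDP S A} (φ : FeatureMap S A d) (p : Params) (π₀ : Policy S A)
  (ws : List (Fin d → ℝ)) (C : List (S × A))

/-- The result is not a pair that is certain. -/
def ExitUncertain {β : Type w} (res : (S × A) ⊕ β) : Prop :=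
  ∀ z, res = .inl z → Uncertain φ p C z.1 z.2

/-- States at which no action is uncertain. -/
def Settled (s : S) : Prop := ∀ a, ¬ Uncertain φ p C s a

theorem Policy.sum_ofReal (π : Policy S A) (s : S) : ∑ a, ENNReal.ofReal (π.prob s a) = 1 := by
  rw [← ENNReal.ofReal_sum_of_nonneg fun a _ => π.nonneg s a, π.sum_eq_one, ENNReal.ofReal_one]

theorem scan_sat (s : S) (l : List A) :
    (scan φ p C s l).Sat M fun o => ∀ a, o = some a → Uncertain φ p C s a := by
  induction l with
  | nil => simp [scan, Prog.Sat]
  | cons a l ih =>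
    simp only [scan, Prog.Sat]
    split_ifs with h
    · intro b hb
      cases hb
      exact h
    · exact ih

theorem rolloutSteps_sat (k : ℕ) (s : S) (disc G : ℝ) :
    (rolloutSteps M.γ φ p π₀ ws C k s disc G).Sat M (ExitUncertain φ p C) := by
  induction k generalizing s disc G with
  | zero => intro z hz; cases hz
  | succ k ih =>
    refine Prog.Sat.bind (scan_sat φ p C s _) fun o ho => ?_
    cases o with
    | some a =>
      intro z hz
      cases hz
      exact ho a rfl
    | none => exact ⟨(Policy.sum_ofReal _ s).le, fun a s' => ih _ _ _⟩

theorem oneRollout_sat (z : S × A) :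
    (oneRollout M.γ φ p π₀ ws C z).Sat M (ExitUncertain φ p C) :=
  fun _ => rolloutSteps_sat φ p π₀ ws C _ _ _ _

theorem rollouts_sat (z : S × A) (k : ℕ) (total : ℝ) :
    (rollouts M.γ φ p π₀ ws C z k total).Sat M (ExitUncertain φ p C) := by
  induction k generalizing total with
  | zero => intro z hz; cases hz
  | succ k ih =>
    refine Prog.Sat.bind (oneRollout_sat φ p π₀ ws C z) fun res hres => ?_
    cases res with
    | inl z' => exact hres
    | inr G => exact ih _

theorem confidentRollout_sat (z : S × A) :
    (confidentRollout M.γ φ p π₀ ws C z).Sat M (ExitUncertain φ p C) := by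
  refine Prog.Sat.bind (rollouts_sat φ p π₀ ws C z _ _) fun res hres => ?_
  cases res with
  | inl z' => exact hres
  | inr G => intro z hz; cases hz

theorem evaluate_sat (zs : List (S × A)) (qs : List ℝ) :
    (evaluate M.γ φ p π₀ ws C zs qs).Sat M (ExitUncertain φ p C) := by
  induction zs generalizing qs with
  | nil => intro z hz; cases hz
  | cons z zs ih =>
    refine Prog.Sat.bind (confidentRollout_sat φ p π₀ ws C z) fun res hres => ?_
    cases res with
    | inl z' => exact fun z h => hres z (by cases h; rfl)
    | inr q => exact ih _

theorem policyIteration_sat (k : ℕ) :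
    (policyIteration M.γ φ p π₀ C k ws).Sat M (ExitUncertain φ p C) := by
  induction k generalizing ws with
  | zero => intro z hz; cases hz
  | succ k ih =>
    refine Prog.Sat.bind (evaluate_sat φ p π₀ ws C C []) fun res hres => ?_
    cases res with
    | inl z' => exact fun z h => hres z (by cases h; rfl)
    | inr q => exact ih _

end Exit

/-! ### Concentration of the rollouts, for all policies that agree at settled states. -/

section Concentration

variable {S : Type u} {A : Type v} [MeasurableSpace S] [Fintype A] [MeasurableSpace A] [Nonempty A]
  [MeasurableSingletonClass A]
  {d : ℕ} {M : MDP S A} {φ : FeatureMap S A d} {p : Params} {π₀ : Policy S A}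
  {ws : List (Fin d → ℝ)} {C : List (S × A)}

/-- Scanning involves no randomness, so it suffices to bound each of its two outcomes under the
condition that produces it. -/
theorem le_prob_scan_bind {β : Type w} {f : Option A → Prog S A β} {E : β → Prop} {c : ENNReal}
    {s : S} {l : List A} (h1 : (∀ a ∈ l, ¬ Uncertain φ p C s a) → c ≤ (f none).prob M E)
    (h2 : ∀ a, Uncertain φ p C s a → c ≤ (f (some a)).prob M E) :
    c ≤ ((scan φ p C s l).bind f).prob M E := by
  induction l with
  | nil => exact h1 (by simp)
  | cons a l ih =>
    simp only [scan, Prog.bind, Prog.prob]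
    split_ifs with h
    · exact h2 a h
    · refine ih fun hl => h1 ?_
      simpa [h] using hl

/-- Expectation of `g (G + disc * X)`, where `X` is the discounted reward of the first `k` steps
from the state `s`. -/
def stepExp (M : MDP S A) (π : Policy S A) (g : ℝ → ENNReal) : ℕ → S → ℝ → ℝ → ENNReal
  | 0, _, _, G => g G
  | k + 1, s, disc, G =>
    ∑ a, ENNReal.ofReal (π.prob s a) * ∫⁻ x, g (G + disc * x) ∂(M.retLaw π k (s, a))

variable {π : Policy S A} {g : ℝ → ENNReal}

theorem stepExp_le_one (hg1 : ∀ x, g x ≤ 1) (k : ℕ) (s : S) (disc G : ℝ) :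
    stepExp M π g k s disc G ≤ 1 := by
  cases k with
  | zero => exact hg1 _
  | succ k =>
    rw [← π.sum_ofReal s]
    refine Finset.sum_le_sum fun a _ => ?_
    refine (mul_le_mul_right ?_ _).trans (mul_one _).le
    refine (lintegral_mono fun x => hg1 _).trans ?_
    simp

theorem lintegral_stepExp (hg : Measurable g) (k : ℕ) (z : S × A) (disc G : ℝ) :
    ∫⁻ s', stepExp M π g k s' (disc * M.γ) (G + disc * M.r z.1 z.2) ∂(M.P z) =
      ∫⁻ x, g (G + disc * x) ∂(M.retLaw π k z) := by
  have := M.isMarkov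
  have haff : ∀ G disc : ℝ, Measurable fun x : ℝ => g (G + disc * x) := fun G disc =>
    hg.comp ((measurable_id.const_mul _).const_add _)
  cases k with
  | zero =>
    rw [MDP.retLaw, Kernel.lintegral_deterministic' _ (haff _ _)]
    simp [stepExp]
  | succ k =>
    rw [M.lintegral_retLaw_succ π k z (haff G disc), M.lintegral_stepKernel π z]
    · refine lintegral_congr fun s' => Finset.sum_congr rfl fun a _ => ?_
      congr 1
      refine lintegral_congr fun x => ?_
      congr 1
      ring
    · exact ((haff G disc).comp ((measurable_id.const_mul _).const_add _)).lintegral_kernel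

/-- The comparison with an uninterrupted rollout of `π`. At a settled state both processes move
alike; at any other state the program exits, which counts as certain success, while the test
function is at most `1`. No coupling has to be constructed. -/
theorem stepExp_le_prob_rolloutSteps {β : Type w} {f : (S × A) ⊕ ℝ → Prog S A β} {E : β → Prop}
    (hπ : ∀ s, Settled φ p C s → ∀ a, (rolloutPolicy M.γ p.alpha φ π₀ ws).prob s a = π.prob s a)
    (hg : Measurable g) (hg1 : ∀ x, g x ≤ 1) (hf1 : ∀ z, 1 ≤ (f (.inl z)).prob M E)
    (hf2 : ∀ x, g x ≤ (f (.inr x)).prob M E) (k : ℕ) (s : S) (disc G : ℝ) :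
    stepExp M π g k s disc G ≤
      ((rolloutSteps M.γ φ p π₀ ws C k s disc G).bind f).prob M E := by
  induction k generalizing s disc G with
  | zero => exact hf2 G
  | succ k ih =>
    rw [rolloutSteps, Prog.bind_assoc]
    refine le_prob_scan_bind (fun hset => ?_) fun a _ => ?_
    · simp only [Prog.bind, Prog.prob, stepExp]
      refine Finset.sum_le_sum fun a _ => ?_
      rw [hπ s (fun a => hset a (by simp)) a]
      refine mul_le_mul_right ?_ _
      rw [← lintegral_stepExp hg k (s, a) disc G]
      exact lintegral_mono fun s' => ih s' _ _
    · exact (stepExp_le_one hg1 _ _ _ _).trans (hf1 _)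

theorem lintegral_le_prob_oneRollout {β : Type w} {f : (S × A) ⊕ ℝ → Prog S A β} {E : β → Prop}
    (hπ : ∀ s, Settled φ p C s → ∀ a, (rolloutPolicy M.γ p.alpha φ π₀ ws).prob s a = π.prob s a)
    (hg : Measurable g) (hg1 : ∀ x, g x ≤ 1) (hf1 : ∀ z, 1 ≤ (f (.inl z)).prob M E)
    (hf2 : ∀ x, g x ≤ (f (.inr x)).prob M E) (z : S × A) :
    ∫⁻ x, g x ∂(M.retLaw π p.n z) ≤ ((oneRollout M.γ φ p π₀ ws C z).bind f).prob M E := by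
  have h := lintegral_stepExp (M := M) (π := π) hg p.n z 1 0
  simp only [zero_add, one_mul] at h
  rw [← h]
  simp only [oneRollout, Prog.bind, Prog.prob]
  exact lintegral_mono fun s' => stepExp_le_prob_rolloutSteps hπ hg hg1 hf1 hf2 _ _ _ _

/-- No sign condition is needed, since the negative part only lowers the left side. The Chernoff
bound below uses functions that can be negative. -/
theorem ofReal_integral_le_lintegral {X : Type*} [MeasurableSpace X] {μ : Measure X} {h : X → ℝ}
    (hh : Integrable h μ) : ENNReal.ofReal (∫ x, h x ∂μ) ≤ ∫⁻ x, ENNReal.ofReal (h x) ∂μ := by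
  rw [integral_eq_lintegral_pos_part_sub_lintegral_neg_part hh]
  refine (ENNReal.ofReal_le_ofReal (sub_le_self _ ENNReal.toReal_nonneg)).trans ?_
  exact ENNReal.ofReal_toReal_le

/-- Hoeffding's lemma: the truncated return takes values in an interval of length `M.horizon`. -/
theorem MDP.integral_exp_retLaw_le (M : MDP S A) (π : Policy S A) (k : ℕ) (z : S × A) (t : ℝ) :
    Integrable (fun x => Real.exp (t * (x - M.truncQ π k z))) (M.retLaw π k z) ∧
    ∫ x, Real.exp (t * (x - M.truncQ π k z)) ∂(M.retLaw π k z) ≤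
      Real.exp (M.horizon ^ 2 * t ^ 2 / 8) := by
  have h := hasSubgaussianMGF_of_mem_Icc (X := fun x : ℝ => x) measurable_id.aemeasurable
    (M.retLaw_mem_Icc π k z)
  refine ⟨h.integrable_exp_mul t, (h.mgf_le t).trans (Real.exp_le_exp.2 (le_of_eq ?_))⟩
  simp only [sub_zero]
  push_cast
  rw [Real.norm_of_nonneg M.horizon_pos.le]
  ring

/-- Chernoff bound for the sum of the discounted rewards of `k` rollouts. -/
theorem le_prob_rollouts
    (hπ : ∀ s, Settled φ p C s → ∀ a, (rolloutPolicy M.γ p.alpha φ π₀ ws).prob s a = π.prob s a)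
    (z : S × A) {t : ℝ} (ht : 0 ≤ t) (u c : ℝ) (k : ℕ) (total : ℝ) :
    ENNReal.ofReal (1 - Real.exp (k * (M.horizon ^ 2 * t ^ 2 / 8) - t * u) *
        (Real.exp (t * (total + k * M.truncQ π p.n z - c)) +
          Real.exp (-t * (total + k * M.truncQ π p.n z - c)))) ≤
      (rollouts M.γ φ p π₀ ws C z k total).prob M
        (fun res => ∀ x, res = .inr x → |x - c| ≤ u) := by
  set μ := M.truncQ π p.n z with hμ
  induction k generalizing total with
  | zero =>
    simp only [rollouts, Prog.prob, Sum.inr.injEq, forall_eq', Nat.cast_zero, zero_mul, zero_sub,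
      add_zero]
    -- If the total misses `c` by more than `u`, one of the two exponentials alone is at least one,
    -- so the claimed lower bound is not positive.
    split_ifs with h
    · rw [← ENNReal.ofReal_one]
      exact ENNReal.ofReal_le_ofReal (sub_le_self _ (by positivity))
    · rw [nonpos_iff_eq_zero, ENNReal.ofReal_eq_zero, sub_nonpos, mul_add, ← Real.exp_add,
        ← Real.exp_add]
      rw [not_le, lt_abs] at h
      rcases h with h | h
      · have := Real.one_le_exp (x := -(t * u) + t * (total - c)) (by nlinarith)
        linarith [Real.exp_pos (-(t * u) + -t * (total - c))]
      · have := Real.one_le_exp (x := -(t * u) + -t * (total - c)) (by nlinarith)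
        linarith [Real.exp_pos (-(t * u) + t * (total - c))]
  | succ k ih =>
    set Y : ℝ := total + (k + 1) * μ - c with hY
    set σ : ℝ := Real.exp (k * (M.horizon ^ 2 * t ^ 2 / 8) - t * u) with hσ
    -- The induction hypothesis for the remaining `k` rollouts as a function of the return `x` of
    -- the current one. Centred at `μ` it factorizes, so integrating it costs one factor from
    -- Hoeffding's lemma.
    set h : ℝ → ℝ := fun x => 1 - σ * (Real.exp (t * Y) * Real.exp (t * (x - μ)) +
      Real.exp (-t * Y) * Real.exp (-t * (x - μ))) with hh
    have hexp : ∀ x, h x = 1 - σ * (Real.exp (t * (total + x + k * μ - c)) +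
        Real.exp (-t * (total + x + k * μ - c))) := by
      intro x
      simp only [hh]
      rw [← Real.exp_add, ← Real.exp_add]
      congr 4 <;> simp only [hY] <;> ring
    obtain ⟨hi1, hb1⟩ := M.integral_exp_retLaw_le π p.n z t
    obtain ⟨hi2, hb2⟩ := M.integral_exp_retLaw_le π p.n z (-t)
    rw [neg_sq] at hb2
    have hint : Integrable h (M.retLaw π p.n z) :=
      (integrable_const _).sub (((hi1.const_mul _).add (hi2.const_mul _)).const_mul _)
    have hmeas : Measurable h := by
      simp only [hh]
      fun_prop
    have hstep := lintegral_le_prob_oneRollout (M := M) (φ := φ) (p := p) (π₀ := π₀) (ws := ws)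
      (C := C) (π := π) (g := fun x => ENNReal.ofReal (h x))
      (f := fun res => match res with
        | .inl z' => .done (.inl z')
        | .inr G => .ops 1 (rollouts M.γ φ p π₀ ws C z k (total + G)))
      (E := fun res => ∀ x, res = .inr x → |x - c| ≤ u)
      hπ hmeas.ennreal_ofReal ?_ ?_ ?_ z
    · refine le_trans ?_ hstep
      refine le_trans (ENNReal.ofReal_le_ofReal ?_) (ofReal_integral_le_lintegral hint)
      have hval : ∫ x, h x ∂(M.retLaw π p.n z) = 1 - σ * (Real.exp (t * Y) *
          ∫ x, Real.exp (t * (x - μ)) ∂(M.retLaw π p.n z) + Real.exp (-t * Y) *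
          ∫ x, Real.exp (-t * (x - μ)) ∂(M.retLaw π p.n z)) := by
        have h1 := integral_sub (integrable_const (1 : ℝ))
          (((hi1.const_mul (Real.exp (t * Y))).add
            (hi2.const_mul (Real.exp (-t * Y)))).const_mul σ)
        have h2 := integral_add (hi1.const_mul (Real.exp (t * Y)))
            (hi2.const_mul (Real.exp (-t * Y)))
        rw [integral_const_mul, integral_const_mul] at h2
        rw [integral_const_mul, integral_const] at h1
        refine h1.trans ?_
        rw [← h2]
        simp
      rw [hval]
      have e1 : Real.exp (((k + 1 : ℕ) : ℝ) * (M.horizon ^ 2 * t ^ 2 / 8) - t * u) =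
          σ * Real.exp (M.horizon ^ 2 * t ^ 2 / 8) := by
        rw [hσ, ← Real.exp_add]
        congr 1
        push_cast
        ring
      rw [e1, mul_assoc]
      push_cast
      have : Real.exp (t * Y) * ∫ x, Real.exp (t * (x - μ)) ∂(M.retLaw π p.n z) +
          Real.exp (-t * Y) * ∫ x, Real.exp (-t * (x - μ)) ∂(M.retLaw π p.n z) ≤
          Real.exp (M.horizon ^ 2 * t ^ 2 / 8) * (Real.exp (t * Y) + Real.exp (-t * Y)) := by
        have a1 := mul_le_mul_of_nonneg_left hb1 (Real.exp_pos (t * Y)).le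
        have a2 := mul_le_mul_of_nonneg_left hb2 (Real.exp_pos (-t * Y)).le
        linarith
      have := mul_le_mul_of_nonneg_left this (Real.exp_pos _ : 0 < σ).le
      linarith
    · intro x
      rw [← ENNReal.ofReal_one]
      exact ENNReal.ofReal_le_ofReal (sub_le_self _ (by positivity))
    · intro z'
      simp [Prog.prob]
    · intro x
      simp only [Prog.prob]
      rw [hexp]
      exact ih (total + x)

theorem ofReal_one_sub_two_mul_le {x : ℝ} {P : ENNReal}
    (h : ENNReal.ofReal (1 - x) + ENNReal.ofReal (1 - x) ≤ P + 1) :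
    ENNReal.ofReal (1 - 2 * x) ≤ P := by
  rcases le_or_gt (1 - 2 * x) 0 with h0 | h0
  · rw [ENNReal.ofReal_eq_zero.2 h0]
    exact zero_le
  · rw [← ENNReal.ofReal_add (by linarith) (by linarith)] at h
    have e : 1 - x + (1 - x) = (1 - 2 * x) + 1 := by ring
    rw [e, ENNReal.ofReal_add h0.le zero_le_one, ENNReal.ofReal_one] at h
    exact (ENNReal.add_le_add_iff_right ENNReal.one_ne_top).1 h

/-- Hoeffding's inequality for one call of the rollout subroutine, simultaneously for two policies
that agree with the rollout policy at all states where no action is uncertain. -/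
theorem le_prob_confidentRollout {π' : Policy S A}
    (hπ : ∀ s, Settled φ p C s → ∀ a, (rolloutPolicy M.γ p.alpha φ π₀ ws).prob s a = π.prob s a)
    (hπ' : ∀ s, Settled φ p C s → ∀ a, (rolloutPolicy M.γ p.alpha φ π₀ ws).prob s a = π'.prob s a)
    (z : S × A) {θ : ℝ} (hθ : 0 ≤ θ) (hm : 0 < p.m) :
    ENNReal.ofReal (1 - 4 * Real.exp (-(2 * p.m * θ ^ 2 / M.horizon ^ 2))) ≤
      (confidentRollout M.γ φ p π₀ ws C z).prob M (fun res => ∀ q, res = .inr q →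
        |q - M.truncQ π p.n z| ≤ θ ∧ |q - M.truncQ π' p.n z| ≤ θ) := by
  have hm' : (0 : ℝ) < p.m := Nat.cast_pos.2 hm
  have hH := M.horizon_pos
  have key : ∀ ν : Policy S A,
      (∀ s, Settled φ p C s → ∀ a, (rolloutPolicy M.γ p.alpha φ π₀ ws).prob s a = ν.prob s a) →
      ENNReal.ofReal (1 - 2 * Real.exp (-(2 * p.m * θ ^ 2 / M.horizon ^ 2))) ≤
        (rollouts M.γ φ p π₀ ws C z p.m 0).prob M
          (fun res => ∀ x, res = .inr x → |x - p.m * M.truncQ ν p.n z| ≤ p.m * θ) := by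
    intro ν hν
    -- This `t` minimizes the exponent `m H² t² / 8 - t m θ`; the minimum is `-2 m θ² / H²`.
    have h := le_prob_rollouts (M := M) hν z (t := 4 * θ / M.horizon ^ 2) (by positivity)
      (p.m * θ) (p.m * M.truncQ ν p.n z) p.m 0
    refine le_trans (le_of_eq ?_) h
    congr 2
    rw [zero_add, sub_self, mul_zero, mul_zero, Real.exp_zero, mul_comm]
    norm_num
    field_simp
    ring
  -- Both events concern the same run, so inclusion-exclusion intersects them; this turns the factor
  -- `2` into `4`.
  have h2 := (add_le_add (key π hπ) (key π' hπ')).trans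
    (Prog.prob_add_prob_le (rollouts_sat (M := M) φ p π₀ ws C z p.m 0))
  have h3 := ofReal_one_sub_two_mul_le h2
  rw [← mul_assoc] at h3
  norm_num at h3
  refine h3.trans ?_
  simp only [confidentRollout, Prog.prob]
  refine le_trans (le_of_eq (mul_one _).symm) (Prog.prob_mul_le_prob_bind _ (c := 1) ?_)
  intro res hres
  cases res with
  | inl z' => simp [Prog.prob]
  | inr total =>
    obtain ⟨h4, h5⟩ := hres
    have h4 := h4 total rfl
    have h5 := h5 total rfl
    have hdiv : ∀ μ : ℝ, |total - p.m * μ| ≤ p.m * θ → |total / p.m - μ| ≤ θ := by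
      intro μ h
      have e : total / p.m - μ = (total - p.m * μ) / p.m := by field_simp
      rw [e, abs_div, abs_of_pos hm', div_le_iff₀ hm', mul_comm θ]
      exact h
    have : ∀ q, (Sum.inr (total / p.m) : (S × A) ⊕ ℝ) = .inr q →
        |q - M.truncQ π p.n z| ≤ θ ∧ |q - M.truncQ π' p.n z| ≤ θ := by
      intro q hq
      cases hq
      exact ⟨hdiv _ h4, hdiv _ h5⟩
    simp only [Prog.prob]
    rw [if_pos this]

end Concentration

end MCPolitex

end

noncomputable section

namespace MCPolitex

/-! ### Regret of exponential weights at a fixed state. -/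

section ExpWeights

variable {S : Type u} {A : Type v} [MeasurableSpace S]

/-- Functions on state-action pairs that are measurable in the state. -/
abbrev QFun (S : Type u) (A : Type v) [MeasurableSpace S] : Type (max u v) :=
  {f : S → A → ℝ // ∀ a, Measurable fun s => f s a}

theorem measurable_sum_qFun (fs : List (QFun S A)) (a : A) :
    Measurable fun s => (fs.map fun f => f.1 s a).sum := by
  induction fs with
  | nil => simp
  | cons f fs ih =>
    simp only [List.map_cons, List.sum_cons]
    exact (f.2 a).add ih

variable [Fintype A] [Nonempty A]

/-- The policy proportional to `exp(α ∑ f(s, a))`. -/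
def expPolicy (alpha : ℝ) (fs : List (QFun S A)) : Policy S A where
  prob s a := Real.exp (alpha * (fs.map fun f => f.1 s a).sum) /
    ∑ a', Real.exp (alpha * (fs.map fun f => f.1 s a').sum)
  nonneg s a := div_nonneg (Real.exp_pos _).le (Finset.sum_nonneg fun _ _ => (Real.exp_pos _).le)
  sum_eq_one s := by
    rw [← Finset.sum_div]
    exact div_self (Finset.sum_pos (fun _ _ => Real.exp_pos _) Finset.univ_nonempty).ne'
  measurable_prob a := (Real.measurable_exp.comp ((measurable_sum_qFun fs a).const_mul _)).div
    (Finset.measurable_sum _ fun a' _ =>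
      Real.measurable_exp.comp ((measurable_sum_qFun fs a').const_mul _))

/-- The initial policy for the empty list, and otherwise the exponential-weights policy of the list
without its head. -/
def mirrorPolicy (alpha : ℝ) (π₀ : Policy S A) : List (QFun S A) → Policy S A
  | [] => π₀
  | _ :: fs => expPolicy alpha fs

variable [MeasurableSpace A] [MeasurableSingletonClass A]

/-- Hoeffding's lemma for the action distribution of a policy. -/
theorem Policy.sum_mul_exp_le (π : Policy S A) (s : S) {f : A → ℝ} {H : ℝ} (hH : 0 ≤ H)
    (hf : ∀ a, f a ∈ Set.Icc 0 H) (alpha : ℝ) :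
    ∑ a, π.prob s a * Real.exp (alpha * f a) ≤
      Real.exp (alpha * ∑ a, π.prob s a * f a + alpha ^ 2 * H ^ 2 / 8) := by
  have h := hasSubgaussianMGF_of_mem_Icc (μ := π.kernel s) (X := f)
    (measurable_of_finite f).aemeasurable (Filter.Eventually.of_forall hf)
  have h2 := h.mgf_le alpha
  rw [mgf, π.integral_kernel, π.integral_kernel] at h2
  set μ := ∑ a, π.prob s a * f a
  have e1 : ∑ a, π.prob s a * Real.exp (alpha * f a) =
      Real.exp (alpha * μ) * ∑ a, π.prob s a * Real.exp (alpha * (f a - μ)) := by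
    rw [Finset.mul_sum]
    refine Finset.sum_congr rfl fun a _ => ?_
    rw [mul_left_comm, ← Real.exp_add]
    congr 2
    ring
  rw [e1, Real.exp_add]
  refine mul_le_mul_of_nonneg_left (h2.trans (Real.exp_le_exp.2 (le_of_eq ?_)))
    (Real.exp_pos _).le
  simp only [sub_zero]
  push_cast
  rw [Real.norm_of_nonneg hH]
  ring

/-- The regret bound for exponential weights. -/
theorem exp_weights_regret (f : ℕ → QFun S A) (s : S) {H : ℝ} (hH : 0 ≤ H)
    (hf : ∀ k a, (f k).1 s a ∈ Set.Icc 0 H) {alpha : ℝ} (halpha : 0 < alpha) (π : Policy S A)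
    (T : ℕ) :
    ∑ k ∈ Finset.range T, ∑ a, (π.prob s a -
        (expPolicy alpha ((List.range k).map f)).prob s a) * (f k).1 s a ≤
      Real.log (Fintype.card A) / alpha + T * (alpha * H ^ 2 / 8) := by
  set F : ℕ → A → ℝ := fun k a => ∑ j ∈ Finset.range k, (f j).1 s a with hF
  have hFl : ∀ k a, (((List.range k).map f).map fun g => g.1 s a).sum = F k a := by
    intro k a
    induction k with
    | zero => simp [hF]
    | succ k ih =>
      rw [List.range_succ, List.map_append, List.map_append, List.sum_append, ih]
      simp [hF, Finset.sum_range_succ]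
  set pk : ℕ → A → ℝ := fun k a => (expPolicy alpha ((List.range k).map f)).prob s a with hpk
  set Z : ℕ → ℝ := fun k => ∑ a, Real.exp (alpha * F k a) with hZ
  have hZpos : ∀ k, 0 < Z k := fun k =>
    Finset.sum_pos (fun _ _ => Real.exp_pos _) Finset.univ_nonempty
  have hpk' : ∀ k a, pk k a = Real.exp (alpha * F k a) / Z k := by
    intro k a
    simp only [hpk, expPolicy, hFl, hZ]
  -- The partition function is the potential: `Z (k + 1) / Z k` is the exponential moment of `f k`
  -- under the current policy. Conversely `log (Z T)` dominates the scaled cumulative value of every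
  -- action, hence of every comparator.
  have hstep : ∀ k, Z (k + 1) ≤
      Z k * Real.exp (alpha * ∑ a, pk k a * (f k).1 s a + alpha ^ 2 * H ^ 2 / 8) := by
    intro k
    have h := (expPolicy alpha ((List.range k).map f)).sum_mul_exp_le s hH (hf k) alpha
    refine le_trans (le_of_eq ?_) (mul_le_mul_of_nonneg_left h (hZpos k).le)
    rw [Finset.mul_sum]
    refine Finset.sum_congr rfl fun a _ => ?_
    change _ = Z k * (pk k a * _)
    rw [hpk', ← mul_assoc, mul_div_cancel₀ _ (hZpos k).ne', ← Real.exp_add]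
    simp only [hF, Finset.sum_range_succ, mul_add]
  have hbound : Real.log (Z T) ≤ Real.log (Fintype.card A) +
      ∑ k ∈ Finset.range T, (alpha * ∑ a, pk k a * (f k).1 s a + alpha ^ 2 * H ^ 2 / 8) := by
    induction T with
    | zero => simp [hZ, hF]
    | succ T ih =>
      have h := Real.log_le_log (hZpos _) (hstep T)
      rw [Real.log_mul (hZpos T).ne' (Real.exp_pos _).ne', Real.log_exp] at h
      rw [Finset.sum_range_succ]
      linarith
  have hlow : ∀ a, alpha * F T a ≤ Real.log (Z T) := by
    intro a
    rw [← Real.log_exp (alpha * F T a)]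
    exact Real.log_le_log (Real.exp_pos _)
      (Finset.single_le_sum (f := fun a => Real.exp (alpha * F T a))
        (fun _ _ => (Real.exp_pos _).le) (Finset.mem_univ a))
  have hlow' : alpha * ∑ a, π.prob s a * F T a ≤ Real.log (Z T) := by
    calc alpha * ∑ a, π.prob s a * F T a = ∑ a, π.prob s a * (alpha * F T a) := by
          rw [Finset.mul_sum]
          exact Finset.sum_congr rfl fun a _ => by ring
      _ ≤ ∑ a, π.prob s a * Real.log (Z T) :=
          Finset.sum_le_sum fun a _ => mul_le_mul_of_nonneg_left (hlow a) (π.nonneg s a)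
      _ = Real.log (Z T) := by rw [← Finset.sum_mul, π.sum_eq_one, one_mul]
  have hF2 : ∑ a, π.prob s a * F T a = ∑ k ∈ Finset.range T, ∑ a, π.prob s a * (f k).1 s a := by
    rw [Finset.sum_comm]
    exact Finset.sum_congr rfl fun a _ => by rw [hF, Finset.mul_sum]
  rw [Finset.sum_add_distrib, ← Finset.mul_sum, Finset.sum_const, Finset.card_range,
    nsmul_eq_mul] at hbound
  have hsplit : ∑ k ∈ Finset.range T, ∑ a, (π.prob s a - pk k a) * (f k).1 s a =
      ∑ a, π.prob s a * F T a - ∑ k ∈ Finset.range T, ∑ a, pk k a * (f k).1 s a := by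
    rw [hF2, ← Finset.sum_sub_distrib]
    refine Finset.sum_congr rfl fun k _ => ?_
    rw [← Finset.sum_sub_distrib]
    exact Finset.sum_congr rfl fun a _ => by ring
  change ∑ k ∈ Finset.range T, ∑ a, (π.prob s a - pk k a) * (f k).1 s a ≤ _
  rw [hsplit]
  have h := hlow'.trans hbound
  have e : Real.log (Fintype.card A) / alpha + T * (alpha * H ^ 2 / 8) =
      (Real.log (Fintype.card A) + T * (alpha ^ 2 * H ^ 2 / 8)) / alpha := by
    field_simp
  rw [e, le_div_iff₀ halpha]
  linarith

end ExpWeights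

/-! ### Performance difference without occupancy measures. -/

section PerformanceDifference

variable {S : Type u} {A : Type v} [MeasurableSpace S] [Fintype A] [MeasurableSpace A]
  [MeasurableSingletonClass A] (M : MDP S A)

theorem MDP.measurable_Q_left (π : Policy S A) (a : A) : Measurable fun s => M.Q π s a := by
  have h : Measurable fun s : S => (s, a) := measurable_prodMk_right
  simpa [Function.comp_def] using (M.measurable_Q π).comp h

/-- Performance difference for a sequence of policies: a pointwise bound on the summed advantages of
a comparator bounds the summed value differences. -/
theorem MDP.sum_V_sub_le (π : Policy S A) (μ : ℕ → Policy S A) (K : ℕ) {c : ℝ}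
    (hc : ∀ s, ∑ k ∈ Finset.range K, ∑ a, (π.prob s a - (μ k).prob s a) * M.Q (μ k) s a ≤ c)
    (s : S) : ∑ k ∈ Finset.range K, (M.V π s - M.V (μ k) s) ≤ M.horizon * c := by
  have := M.isMarkov
  set D : S × A → ℝ := fun z => ∑ k ∈ Finset.range K, (M.Q π z.1 z.2 - M.Q (μ k) z.1 z.2) with hD
  have hV : ∀ s, ∑ k ∈ Finset.range K, (M.V π s - M.V (μ k) s) ≤
      ∑ a, π.prob s a * D (s, a) + c := by
    intro s
    have : ∑ k ∈ Finset.range K, (M.V π s - M.V (μ k) s) = ∑ a, π.prob s a * D (s, a) +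
        ∑ k ∈ Finset.range K, ∑ a, (π.prob s a - (μ k).prob s a) * M.Q (μ k) s a := by
      simp only [hD, Finset.mul_sum]
      rw [Finset.sum_comm, ← Finset.sum_add_distrib]
      refine Finset.sum_congr rfl fun k _ => ?_
      rw [M.V_eq, M.V_eq, ← Finset.sum_sub_distrib, ← Finset.sum_add_distrib]
      exact Finset.sum_congr rfl fun a _ => by ring
    rw [this]
    exact add_le_add_right (hc s) _
  have hVQ : ∀ (ν : Policy S A) z, M.Q ν z.1 z.2 =
      M.r z.1 z.2 + M.γ * ∫ s', M.V ν s' ∂(M.P z) := by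
    intro ν z
    rw [M.Q_bellman ν z, M.integral_stepKernel ν z (M.measurable_Q ν)
      (fun y => M.Q_mem_Icc ν y.1 y.2)]
    congr 2
    exact integral_congr_ae (Filter.Eventually.of_forall fun s' => (M.V_eq ν s').symm)
  have hVm : ∀ ν : Policy S A, Measurable (M.V ν) := by
    intro ν
    have e : M.V ν = fun s => ∑ a, ν.prob s a * M.Q ν s a := funext fun s => M.V_eq ν s
    rw [e]
    exact Finset.measurable_sum _ fun a _ => (ν.measurable_prob a).mul
      (M.measurable_Q_left ν a)
  -- One Bellman step improves any uniform bound `B` on the summed differences of action values to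
  -- `γ (B + c)`. Applied to the supremum this gives `B ≤ γ c / (1 - γ)`.
  have hDle : ∀ B : ℝ, (∀ z, D z ≤ B) → ∀ z, D z ≤ M.γ * (B + c) := by
    intro B hB z
    have hi : ∀ ν : Policy S A, Integrable (M.V ν) (M.P z) := fun ν =>
      integrable_of_mem_Icc (hVm ν) (M.V_mem_Icc ν)
    have hi' : ∀ k ∈ Finset.range K, Integrable (fun s' => M.V π s' - M.V (μ k) s') (M.P z) :=
      fun k _ => (hi π).sub (hi (μ k))
    have e : D z = M.γ * ∫ s', ∑ k ∈ Finset.range K, (M.V π s' - M.V (μ k) s') ∂(M.P z) := by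
      rw [integral_finsetSum _ hi', Finset.mul_sum]
      refine Finset.sum_congr rfl fun k _ => ?_
      rw [integral_sub (hi π) (hi (μ k)), hVQ π z, hVQ (μ k) z]
      ring
    rw [e]
    refine mul_le_mul_of_nonneg_left ?_ M.γ_pos.le
    have h2 : ∫ s', ∑ k ∈ Finset.range K, (M.V π s' - M.V (μ k) s') ∂(M.P z) ≤
        ∫ _, (B + c) ∂(M.P z) := by
      refine integral_mono (integrable_finsetSum _ hi')
        (integrable_const _) fun s' => ?_
      refine (hV s').trans (add_le_add_left ?_ _)
      calc ∑ a, π.prob s' a * D (s', a) ≤ ∑ a, π.prob s' a * B :=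
            Finset.sum_le_sum fun a _ => mul_le_mul_of_nonneg_left (hB _) (π.nonneg s' a)
        _ = B := by rw [← Finset.sum_mul, π.sum_eq_one, one_mul]
    simpa using h2
  have hbdd : BddAbove (Set.range D) := by
    refine ⟨∑ _k ∈ Finset.range K, M.horizon, ?_⟩
    rintro _ ⟨z, rfl⟩
    refine Finset.sum_le_sum fun k _ => ?_
    linarith [(M.Q_mem_Icc π z.1 z.2).2, (M.Q_mem_Icc (μ k) z.1 z.2).1]
  have hne : Nonempty A := by
    by_contra h
    rw [not_nonempty_iff] at h
    have := π.sum_eq_one s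
    simp at this
  have hne' : Nonempty (S × A) := ⟨(s, hne.some)⟩
  set B := ⨆ z, D z with hB
  have hDB : ∀ z, D z ≤ B := fun z => le_ciSup hbdd z
  have hB1 : B ≤ M.γ * (B + c) := ciSup_le fun z => hDle B hDB z
  have hg := M.one_sub_γ_pos
  have hB2 : B ≤ M.horizon * (M.γ * c) := by
    rw [MDP.horizon, inv_mul_eq_div, le_div_iff₀ hg]
    linarith
  have h3 : ∑ a, π.prob s a * D (s, a) ≤ B := by
    calc ∑ a, π.prob s a * D (s, a) ≤ ∑ a, π.prob s a * B :=
          Finset.sum_le_sum fun a _ => mul_le_mul_of_nonneg_left (hDB _) (π.nonneg s a)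
      _ = B := by rw [← Finset.sum_mul, π.sum_eq_one, one_mul]
  have h4 := M.one_add_γ_mul_horizon
  have h5 : M.horizon * c = M.horizon * (M.γ * c) + c := by
    nth_rewrite 1 [← h4]
    ring
  linarith [hV s]

end PerformanceDifference

/-! ### The virtual algorithm and the suboptimality of the mixture. -/

section Virtual

variable {S : Type u} {A : Type v} [MeasurableSpace S] [Fintype A] [MeasurableSpace A] [Nonempty A]
  [MeasurableSingletonClass A] {d : ℕ}
  (M : MDP S A) (φ : FeatureMap S A d) (p : Params) (π₀ : Policy S A) (C : List (S × A))

theorem measurableSet_settled : MeasurableSet {s | Settled φ p C s} := by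
  have h : {s | Settled φ p C s} = ⋂ a, {s | Uncertain φ p C s a}ᶜ := by
    ext s
    simp [Settled]
  rw [h]
  refine MeasurableSet.iInter fun a => MeasurableSet.compl ?_
  have hm : ∀ i, Measurable fun s => φ.map s a i := fun i =>
    (measurable_pi_apply i).comp (φ.measurable_map a)
  refine measurableSet_lt measurable_const ?_
  change Measurable fun s => ∑ i, φ.map s a i *
    ∑ j, gramInv p.lam (feats φ C) i j * φ.map s a j
  exact Finset.measurable_sum _ fun i _ => (hm i).mul
    (Finset.measurable_sum _ fun j _ => (hm j).const_mul _)

open Classical in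
/-- The clipped linear function with weights `w` where no action is uncertain, and the action-value
function of `π` elsewhere. -/
def patchedQ (w : Fin d → ℝ) (π : Policy S A) : QFun S A :=
  ⟨fun s a => if Settled φ p C s then clipQ M.γ φ w s a else M.Q π s a, fun a =>
    Measurable.ite (measurableSet_settled φ p C) (measurable_clipQ M.γ φ w a)
      (M.measurable_Q_left π a)⟩

/-- The functions of the virtual algorithm, which knows the exact action values outside the states
where no action is uncertain. -/
def virtualQs (ws : List (Fin d → ℝ)) : List (QFun S A) :=
  ws.foldl (fun fs w => fs ++ [patchedQ M φ p C w (mirrorPolicy p.alpha π₀ fs)]) []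

/-- The policies of the virtual algorithm. -/
def virtualPolicy (ws : List (Fin d → ℝ)) : Policy S A :=
  mirrorPolicy p.alpha π₀ (virtualQs M φ p π₀ C ws)

theorem virtualQs_append (ws : List (Fin d → ℝ)) (w : Fin d → ℝ) :
    virtualQs M φ p π₀ C (ws ++ [w]) = virtualQs M φ p π₀ C ws ++
      [patchedQ M φ p C w (virtualPolicy M φ p π₀ C ws)] := by
  rw [virtualQs, List.foldl_append]
  rfl

variable {φ p C}

theorem virtualQs_map_of_settled {s : S} (hs : Settled φ p C s) (ws : List (Fin d → ℝ)) (a : A) :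
    (virtualQs M φ p π₀ C ws).map (fun f => f.1 s a) = ws.map fun w => clipQ M.γ φ w s a := by
  induction ws using List.reverseRecOn with
  | nil => rfl
  | append_singleton ws w ih =>
    rw [virtualQs_append, List.map_append, List.map_append, ih]
    simp [patchedQ, hs]

/-- At a settled state each patched function is the clipped linear one, so both policies have the
same exponential weights there. This agreement is what the rollout bounds require. -/
theorem rolloutPolicy_eq_virtualPolicy {s : S} (hs : Settled φ p C s) (ws : List (Fin d → ℝ))
    (a : A) : (rolloutPolicy M.γ p.alpha φ π₀ ws).prob s a =
      (virtualPolicy M φ p π₀ C ws).prob s a := by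
  have h := fun a => virtualQs_map_of_settled M π₀ hs ws a
  cases ws with
  | nil => rfl
  | cons w ws =>
    rw [virtualPolicy]
    cases hv : virtualQs M φ p π₀ C (w :: ws) with
    | nil =>
      have := h a
      simp [hv] at this
    | cons f fs =>
      rw [hv] at h
      simp only [List.map_cons, List.cons.injEq] at h
      simp only [rolloutPolicy, softmaxPolicy, mirrorPolicy, expPolicy, expWeight,
        fun a => (h a).2]

theorem clipQ_mem_Icc (w : Fin d → ℝ) (s : S) (a : A) :
    clipQ M.γ φ w s a ∈ Set.Icc 0 M.horizon :=
  ⟨le_min (le_max_right _ _) M.horizon_pos.le, min_le_right _ _⟩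

/-- Clipping projects onto an interval that contains the true value, so it cannot increase the
error. -/
theorem abs_clipQ_sub_Q_le {w : Fin d → ℝ} {s : S} {a : A} {π : Policy S A} {e : ℝ}
    (h : |w ⬝ᵥ φ.map s a - M.Q π s a| ≤ e) : |clipQ M.γ φ w s a - M.Q π s a| ≤ e := by
  obtain ⟨h0, h1⟩ := M.Q_mem_Icc π s a
  obtain ⟨h2, h3⟩ := abs_le.1 h
  change M.Q π s a ≤ (1 - M.γ)⁻¹ at h1
  rw [abs_le, clipQ]
  rcases max_cases (w ⬝ᵥ φ.map s a) 0 with ⟨e1, _⟩ | ⟨e1, _⟩ <;> rw [e1] <;>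
  rcases min_cases (w ⬝ᵥ φ.map s a) (1 - M.γ)⁻¹ with ⟨e2, _⟩ | ⟨e2, _⟩ <;>
  rcases min_cases 0 (1 - M.γ)⁻¹ with ⟨e3, _⟩ | ⟨e3, _⟩ <;>
  simp only [e2, e3] <;> constructor <;> linarith

variable (φ p C)

/-- The weights approximate, at the certain pairs, both the action values of the rollout policies
and those of the virtual policies. -/
def Accurate (e : ℝ) (ws : List (Fin d → ℝ)) : Prop :=
  ∀ k w, ws[k]? = some w → ∀ s a, ¬ Uncertain φ p C s a →
    |w ⬝ᵥ φ.map s a - M.Q (rolloutPolicy M.γ p.alpha φ π₀ (ws.take k)) s a| ≤ e ∧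
    |w ⬝ᵥ φ.map s a - M.Q (virtualPolicy M φ p π₀ C (ws.take k)) s a| ≤ e

variable {φ p C}

theorem accurate_nil (e : ℝ) : Accurate M φ p π₀ C e [] := by
  intro k w h
  simp at h

theorem Accurate.append {e : ℝ} {ws : List (Fin d → ℝ)} (h : Accurate M φ p π₀ C e ws)
    {w : Fin d → ℝ} (hw : ∀ s a, ¬ Uncertain φ p C s a →
      |w ⬝ᵥ φ.map s a - M.Q (rolloutPolicy M.γ p.alpha φ π₀ ws) s a| ≤ e ∧
      |w ⬝ᵥ φ.map s a - M.Q (virtualPolicy M φ p π₀ C ws) s a| ≤ e) :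
    Accurate M φ p π₀ C e (ws ++ [w]) := by
  intro k w' hk
  rcases lt_trichotomy k ws.length with hlt | heq | hgt
  · rw [List.getElem?_append_left hlt] at hk
    rw [List.take_append_of_le_length hlt.le]
    exact h k w' hk
  · subst heq
    rw [List.getElem?_append_right le_rfl] at hk
    simp at hk
    subst hk
    rw [List.take_left]
    exact hw
  · rw [List.getElem?_append_right hgt.le] at hk
    have : k - ws.length ≠ 0 := by omega
    simp [this] at hk

/-- Suboptimality of the mixture policy, when all weights are accurate. -/
theorem Vstar_sub_mixtureValue_le {e : ℝ} (he : 0 ≤ e) {ws : List (Fin d → ℝ)}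
    (hlen : ws.length = p.K) (hK : 0 < p.K) (halpha : 0 < p.alpha)
    (hacc : Accurate M φ p π₀ C e ws) (hρ : Settled φ p C M.ρ) :
    M.Vstar M.ρ - mixtureValue M φ p π₀ ws ≤
      M.horizon * (M.horizon + Real.log (Fintype.card A) / p.alpha) / p.K +
        M.horizon * (p.alpha * M.horizon ^ 2 / 8) + 2 * (M.horizon + 1) * e := by
  have hH := M.horizon_pos
  have hK' : (0 : ℝ) < p.K := Nat.cast_pos.2 hK
  set W : ℕ → Fin d → ℝ := fun k => ws.getD k 0 with hW
  have htake : ∀ k ≤ p.K, ws.take k = (List.range k).map W := by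
    intro k hk
    refine List.ext_getElem? fun i => ?_
    rw [List.getElem?_take, List.getElem?_map]
    by_cases hi : i < k
    · have hil : i < ws.length := by omega
      simp [hi, hW, hil]
    · simp [hi]
  set μ : ℕ → Policy S A := fun k => virtualPolicy M φ p π₀ C ((List.range k).map W) with hμ
  set f : ℕ → QFun S A := fun k => patchedQ M φ p C (W k) (μ k) with hf
  have hvq : ∀ k, virtualQs M φ p π₀ C ((List.range k).map W) = (List.range k).map f := by
    intro k
    induction k with
    | zero => rfl
    | succ k ih =>
      rw [List.range_succ, List.map_append, List.map_append, ← ih]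
      exact virtualQs_append M φ p π₀ C _ _
  have hμs : ∀ k, μ (k + 1) = expPolicy p.alpha ((List.range k).map fun j => f (j + 1)) := by
    intro k
    simp only [hμ, virtualPolicy, hvq, List.range_succ_eq_map, List.map_cons, mirrorPolicy,
      List.map_map]
    rfl
  have hsome : ∀ k < p.K, ws[k]? = some (W k) := by
    intro k hk
    have hil : k < ws.length := by omega
    simp [hW, hil]
  -- Here the patching pays off: the bound holds at every state, by accuracy of the weights where it
  -- is settled and with error zero elsewhere.
  have hfQ : ∀ k < p.K, ∀ s a, |(f k).1 s a - M.Q (μ k) s a| ≤ e := by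
    intro k hk s a
    by_cases hs : Settled φ p C s
    · have := (hacc k (W k) (hsome k hk) s a (hs a)).2
      rw [htake k hk.le] at this
      simpa [hf, patchedQ, hs] using abs_clipQ_sub_Q_le M this
    · simpa [hf, patchedQ, hs] using he
  have hfI : ∀ k s a, (f k).1 s a ∈ Set.Icc 0 M.horizon := by
    intro k s a
    by_cases hs : Settled φ p C s
    · simpa [hf, patchedQ, hs] using clipQ_mem_Icc M (φ := φ) (W k) s a
    · simpa [hf, patchedQ, hs] using M.Q_mem_Icc (μ k) s a
  -- The arbitrary initial policy is charged separately with at most `M.horizon`. The policies `π_1,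
  -- …, π_T` run exponential weights on `Q_1, Q_2, …`; the function `Q_0` is never used.
  obtain ⟨T, hT⟩ : ∃ T, p.K = T + 1 := ⟨p.K - 1, by omega⟩
  have hTK : (T : ℝ) ≤ p.K := by rw [hT]; push_cast; linarith
  have hadv : ∀ π : Policy S A, ∀ s,
      ∑ k ∈ Finset.range p.K, ∑ a, (π.prob s a - (μ k).prob s a) * M.Q (μ k) s a ≤
        M.horizon + Real.log (Fintype.card A) / p.alpha +
          p.K * (p.alpha * M.horizon ^ 2 / 8) + p.K * (2 * e) := by
    intro π s
    have h1 : ∀ k < p.K, ∑ a, (π.prob s a - (μ k).prob s a) * M.Q (μ k) s a ≤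
        ∑ a, (π.prob s a - (μ k).prob s a) * (f k).1 s a + 2 * e := by
      intro k hk
      have : ∑ a, (π.prob s a + (μ k).prob s a) * e = 2 * e := by
        rw [← Finset.sum_mul, Finset.sum_add_distrib, π.sum_eq_one, (μ k).sum_eq_one]
        norm_num
      rw [← this, ← Finset.sum_add_distrib]
      refine Finset.sum_le_sum fun a _ => ?_
      obtain ⟨h2, h3⟩ := abs_le.1 (hfQ k hk s a)
      nlinarith [π.nonneg s a, (μ k).nonneg s a]
    rw [hT, Finset.sum_range_succ']
    have h0 : ∑ a, (π.prob s a - (μ 0).prob s a) * M.Q (μ 0) s a ≤ M.horizon := by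
      calc ∑ a, (π.prob s a - (μ 0).prob s a) * M.Q (μ 0) s a
          ≤ ∑ a, π.prob s a * M.horizon := by
            refine Finset.sum_le_sum fun a _ => ?_
            obtain ⟨h2, h3⟩ := M.Q_mem_Icc (μ 0) s a
            nlinarith [π.nonneg s a, (μ 0).nonneg s a]
        _ = M.horizon := by rw [← Finset.sum_mul, π.sum_eq_one, one_mul]
    have hreg := exp_weights_regret (fun j => f (j + 1)) s hH.le (fun k a => hfI (k + 1) s a)
      halpha π T
    have h2 : ∑ k ∈ Finset.range T,
        ∑ a, (π.prob s a - (μ (k + 1)).prob s a) * M.Q (μ (k + 1)) s a ≤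
        ∑ k ∈ Finset.range T, (∑ a, (π.prob s a - (μ (k + 1)).prob s a) * (f (k + 1)).1 s a +
          2 * e) :=
      Finset.sum_le_sum fun k hk => h1 (k + 1) (by have := Finset.mem_range.1 hk; omega)
    rw [Finset.sum_add_distrib, Finset.sum_const, Finset.card_range, nsmul_eq_mul] at h2
    simp only [← hμs] at hreg
    have h5 : (T : ℝ) * (p.alpha * M.horizon ^ 2 / 8) ≤ p.K * (p.alpha * M.horizon ^ 2 / 8) :=
      mul_le_mul_of_nonneg_right hTK (by positivity)
    have h6 : (T : ℝ) * (2 * e) ≤ p.K * (2 * e) :=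
      mul_le_mul_of_nonneg_right hTK (by positivity)
    rw [← hT]
    linarith
  set c := M.horizon + Real.log (Fintype.card A) / p.alpha +
          p.K * (p.alpha * M.horizon ^ 2 / 8) + p.K * (2 * e) with hc
  -- At the settled initial state both policies have the same action distribution, and their action
  -- values are both within `e` of the same linear prediction.
  have hVr : ∀ k < p.K, M.V (μ k) M.ρ - 2 * e ≤
      M.V (rolloutPolicy M.γ p.alpha φ π₀ (ws.take k)) M.ρ := by
    intro k hk
    have : ∑ a, (μ k).prob M.ρ a * (2 * e) = 2 * e := by
      rw [← Finset.sum_mul, (μ k).sum_eq_one, one_mul]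
    rw [M.V_eq, M.V_eq, ← this, ← Finset.sum_sub_distrib]
    refine Finset.sum_le_sum fun a _ => ?_
    rw [rolloutPolicy_eq_virtualPolicy M π₀ hρ, htake k hk.le]
    have h := hacc k (W k) (hsome k hk) M.ρ a (hρ a)
    rw [htake k hk.le] at h
    obtain ⟨h2, h3⟩ := abs_le.1 h.1
    obtain ⟨h4, h5⟩ := abs_le.1 h.2
    change (μ k).prob M.ρ a * M.Q (μ k) M.ρ a - _ ≤ (μ k).prob M.ρ a * _
    rw [← mul_sub]
    refine mul_le_mul_of_nonneg_left ?_ ((μ k).nonneg _ _)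
    change _ - M.Q (μ k) M.ρ a ≤ e at h5
    change -e ≤ _ - M.Q (μ k) M.ρ a at h4
    linarith
  have hmain : ∀ π : Policy S A,
      M.V π M.ρ ≤ mixtureValue M φ p π₀ ws + (M.horizon * c / p.K + 2 * e) := by
    intro π
    have h1 := M.sum_V_sub_le π μ p.K (hadv π) M.ρ
    have h2 : ∑ k ∈ Finset.range p.K, (M.V (μ k) M.ρ - 2 * e) ≤
        ∑ k ∈ Finset.range p.K, M.V (rolloutPolicy M.γ p.alpha φ π₀ (ws.take k)) M.ρ :=
      Finset.sum_le_sum fun k hk => hVr k (Finset.mem_range.1 hk)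
    rw [Finset.sum_sub_distrib, Finset.sum_const, Finset.card_range, nsmul_eq_mul] at h1 h2
    have h3 : p.K * M.V π M.ρ ≤ (∑ k ∈ Finset.range p.K,
        M.V (rolloutPolicy M.γ p.alpha φ π₀ (ws.take k)) M.ρ) + M.horizon * c + p.K * (2 * e) := by
      linarith
    rw [mixtureValue]
    have e1 : (1 / p.K : ℝ) * (∑ k ∈ Finset.range p.K,
        M.V (rolloutPolicy M.γ p.alpha φ π₀ (ws.take k)) M.ρ) + (M.horizon * c / p.K + 2 * e) =
        ((∑ k ∈ Finset.range p.K,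
        M.V (rolloutPolicy M.γ p.alpha φ π₀ (ws.take k)) M.ρ) + M.horizon * c + p.K * (2 * e)) /
          p.K := by
      field_simp
      ring
    rw [e1, le_div_iff₀ hK']
    linarith
  have hsup : M.Vstar M.ρ ≤ mixtureValue M φ p π₀ ws + (M.horizon * c / p.K + 2 * e) := by
    have : Nonempty (Policy S A) := ⟨π₀⟩
    exact ciSup_le hmain
  have e2 : M.horizon * c / p.K + 2 * e =
      M.horizon * (M.horizon + Real.log (Fintype.card A) / p.alpha) / p.K +
        M.horizon * (p.alpha * M.horizon ^ 2 / 8) + 2 * (M.horizon + 1) * e := by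
    rw [hc]
    field_simp
    ring
  linarith

/-- The trivial bound on the suboptimality of the mixture policy. -/
theorem Vstar_sub_mixtureValue_le_horizon (hK : 0 < p.K) (ws : List (Fin d → ℝ)) :
    M.Vstar M.ρ - mixtureValue M φ p π₀ ws ≤ M.horizon := by
  have : Nonempty (Policy S A) := ⟨π₀⟩
  have h1 : M.Vstar M.ρ ≤ M.horizon := ciSup_le fun π => (M.V_mem_Icc π M.ρ).2
  have h2 : 0 ≤ mixtureValue M φ p π₀ ws :=
    mul_nonneg (by positivity) (Finset.sum_nonneg fun k _ => (M.V_mem_Icc _ M.ρ).1)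
  linarith

end Virtual

end MCPolitex

end

noncomputable section

namespace MCPolitex

/-! ### The invariant of the core set and its initialization. -/

section CoreSet

variable {S : Type u} {A : Type v} [MeasurableSpace S] {d : ℕ}
  (φ : FeatureMap S A d) (p : Params)

/-- The invariant of the core set: it is nonempty, the determinant of the Gram matrix doubles with
each further element, and no action is uncertain at the initial state. -/
def CoreInv (ρ : S) (C : List (S × A)) : Prop :=
  C ≠ [] ∧ Doubling p.lam (feats φ C) ∧ Settled φ p C ρ

variable {φ p} {C : List (S × A)}

theorem feats_append (z : S × A) : feats φ (C ++ [z]) = feats φ C ++ [φ.map z.1 z.2] := by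
  simp [feats]

theorem feats_ne_nil (hC : C ≠ []) : feats φ C ≠ [] := by simpa [feats] using hC

theorem uncertain_iff {s : S} {a : A} :
    Uncertain φ p C s a ↔ p.tau < leverage p.lam (feats φ C) (φ.map s a) := Iff.rfl

theorem not_uncertain_append (hlam : 0 < p.lam) {s : S} {a : A} (h : ¬ Uncertain φ p C s a)
    (z : S × A) : ¬ Uncertain φ p (C ++ [z]) s a := by
  rw [uncertain_iff, not_lt] at h ⊢
  rw [feats_append]
  exact (leverage_append_le hlam _ _ _).trans h

theorem not_uncertain_append_self (hlam : 0 < p.lam) (htau : p.tau = 1) (z : S × A) :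
    ¬ Uncertain φ p (C ++ [z]) z.1 z.2 := by
  rw [uncertain_iff, not_lt, htau, feats_append]
  exact leverage_append_self_le_one hlam _ _

theorem doubling_feats_append (hlam : 0 < p.lam) (htau : p.tau = 1) {z : S × A}
    (hD : Doubling p.lam (feats φ C)) (hz : C = [] ∨ Uncertain φ p C z.1 z.2) :
    Doubling p.lam (feats φ (C ++ [z])) := by
  rw [feats_append]
  by_cases hC : C = []
  · subst hC
    exact Doubling.singleton hlam _
  · have hu := hz.resolve_left hC
    rw [uncertain_iff, htau] at hu
    exact hD.append hlam (feats_ne_nil hC) hu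

theorem CoreInv.append (hlam : 0 < p.lam) (htau : p.tau = 1) {ρ : S} (h : CoreInv φ p ρ C)
    {z : S × A} (hz : Uncertain φ p C z.1 z.2) : CoreInv φ p ρ (C ++ [z]) :=
  ⟨by simp, doubling_feats_append hlam htau h.2.1 (.inr hz),
    fun a => not_uncertain_append hlam (h.2.2 a) z⟩

theorem dotProduct_self_eq_norm_sq (x : Fin d → ℝ) : x ⬝ᵥ x = ‖WithLp.toLp 2 x‖ ^ 2 := by
  rw [EuclideanSpace.norm_sq_eq]
  simp [dotProduct, sq]

theorem FeatureMap.dotProduct_self_le_one (φ : FeatureMap S A d) (s : S) (a : A) :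
    φ.map s a ⬝ᵥ φ.map s a ≤ 1 := by
  rw [dotProduct_self_eq_norm_sq]
  exact pow_le_one₀ (norm_nonneg _) (φ.norm_le_one s a)

theorem CoreInv.length_le (hd : 0 < d) (hlam : 0 < p.lam) {ρ : S} (h : CoreInv φ p ρ C) :
    (C.length : ℝ) ≤ 3 * (d * logFactor p.lam) := by
  have := h.2.1.length_le hd hlam (fun x hx => by
    simp only [feats, List.mem_map] at hx
    obtain ⟨z, _, rfl⟩ := hx
    exact φ.dotProduct_self_le_one z.1 z.2)
  simpa [feats] using this

/-- The largest possible size of the core set. -/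
def coreBound (d : ℕ) (lam : ℝ) : ℕ := ⌊3 * (d * logFactor lam)⌋₊

theorem CoreInv.length_le_coreBound (hd : 0 < d) (hlam : 0 < p.lam) {ρ : S}
    (h : CoreInv φ p ρ C) : C.length ≤ coreBound d p.lam :=
  Nat.le_floor (h.length_le hd hlam)

theorem coreBound_le (hlam : 0 < p.lam) :
    (coreBound d p.lam : ℝ) ≤ 3 * (d * logFactor p.lam) :=
  Nat.floor_le (by have := one_le_logFactor hlam; positivity)

variable [Fintype A] [MeasurableSpace A] {M : MDP S A}

/-- Initialization is deterministic, so one core set serves all executions. In the induction each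
action is either still to be tested or already certain, and certainty survives every later addition
because leverage only decreases. -/
theorem exists_initCore (hlam : 0 < p.lam) (htau : p.tau = 1) (l : List A)
    (hD : Doubling p.lam (feats φ C))
    (hset : ∀ a, a ∈ l ∨ (C ≠ [] ∧ ¬ Uncertain φ p C M.ρ a)) [Nonempty A] :
    ∃ C', CoreInv φ p M.ρ C' ∧ ∀ F : List (S × A) → Prop, F C' →
      1 ≤ (initCore φ p M.ρ l C).prob M F ∧ (initCore φ p M.ρ l C).Sat M F := by
  induction l generalizing C with
  | nil =>
    simp only [List.not_mem_nil, false_or] at hset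
    refine ⟨C, ⟨(hset (Classical.arbitrary A)).1, hD, fun a => (hset a).2⟩, fun F hF => ?_⟩
    simp [initCore, Prog.prob, Prog.Sat, hF]
  | cons a l ih =>
    by_cases h : C = [] ∨ Uncertain φ p C M.ρ a
    · obtain ⟨C', hC', hF⟩ := ih (C := C ++ [(M.ρ, a)])
        (doubling_feats_append hlam htau hD h) fun b => by
          by_cases hb : b = a
          · subst hb
            exact .inr ⟨by simp, not_uncertain_append_self hlam htau (M.ρ, b)⟩
          · rcases hset b with h1 | h1
            · exact .inl ((List.mem_cons.1 h1).resolve_left hb)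
            · exact .inr ⟨by simp, not_uncertain_append hlam h1.2 _⟩
      refine ⟨C', hC', fun F hFC => ?_⟩
      simp only [initCore, Prog.prob, Prog.Sat, if_pos h]
      exact hF F hFC
    · obtain ⟨C', hC', hF⟩ := ih hD fun b => by
        by_cases hb : b = a
        · subst hb
          exact .inr (not_or.1 h)
        · rcases hset b with h1 | h1
          · exact .inl ((List.mem_cons.1 h1).resolve_left hb)
          · exact .inr h1
      refine ⟨C', hC', fun F hFC => ?_⟩
      simp only [initCore, Prog.prob, Prog.Sat, if_neg h]
      exact hF F hFC

theorem exists_initCore_univ [Nonempty A] (hlam : 0 < p.lam) (htau : p.tau = 1) :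
    ∃ C', CoreInv φ p M.ρ C' ∧ ∀ F : List (S × A) → Prop, F C' →
      1 ≤ (initCore φ p M.ρ Finset.univ.toList []).prob M F ∧
      (initCore φ p M.ρ Finset.univ.toList []).Sat M F :=
  exists_initCore hlam htau _ doubling_nil fun a => .inl (by simp)

end CoreSet

/-! ### Success probability of the whole algorithm. -/

section Success

variable {S : Type u} {A : Type v} [MeasurableSpace S] [Fintype A] [MeasurableSpace A] [Nonempty A]
  [MeasurableSingletonClass A]
  {d : ℕ} {M : MDP S A} {φ : FeatureMap S A d} {p : Params} {π₀ : Policy S A}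
  {ws : List (Fin d → ℝ)} {C : List (S × A)}

/-- The guaranteed success probability of one call of the rollout subroutine. -/
def rolloutConfidence (M : MDP S A) (p : Params) (θ : ℝ) : ENNReal :=
  ENNReal.ofReal (1 - 4 * Real.exp (-(2 * p.m * θ ^ 2 / M.horizon ^ 2)))

theorem rolloutConfidence_le_one (θ : ℝ) : rolloutConfidence M p θ ≤ 1 := by
  rw [rolloutConfidence, ← ENNReal.ofReal_one]
  exact ENNReal.ofReal_le_ofReal (sub_le_self _ (by positivity))

/-- `q` estimates the action values of the rollout policy and of the virtual policy at `z`. -/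
def Estimates (M : MDP S A) (φ : FeatureMap S A d) (p : Params) (π₀ : Policy S A)
    (ws : List (Fin d → ℝ)) (C : List (S × A)) (β : ℝ) (z : S × A) (q : ℝ) : Prop :=
  |q - M.Q (rolloutPolicy M.γ p.alpha φ π₀ ws) z.1 z.2| ≤ β ∧
    |q - M.Q (virtualPolicy M φ p π₀ C ws) z.1 z.2| ≤ β

theorem le_prob_confidentRollout_estimates {θ β : ℝ} (hθ : 0 ≤ θ) (hm : 0 < p.m)
    (hβ : θ + M.γ ^ (p.n + 1) * M.horizon ≤ β) (z : S × A) :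
    rolloutConfidence M p θ ≤ (confidentRollout M.γ φ p π₀ ws C z).prob M
      (fun res => ∀ q, res = .inr q → Estimates M φ p π₀ ws C β z q) := by
  refine (le_prob_confidentRollout (π := rolloutPolicy M.γ p.alpha φ π₀ ws)
    (π' := virtualPolicy M φ p π₀ C ws) (fun s _ a => rfl)
    (fun s hs a => rolloutPolicy_eq_virtualPolicy M π₀ hs ws a) z hθ hm).trans
    (Prog.prob_mono _ fun res h q hq => ?_)
  obtain ⟨h1, h2⟩ := h q hq
  have key : ∀ π : Policy S A, |q - M.truncQ π p.n z| ≤ θ → |q - M.Q π z.1 z.2| ≤ β := by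
    intro π h
    have h3 := M.abs_truncQ_sub_Q_le π p.n z
    have h4 := abs_sub_le q (M.truncQ π p.n z) (M.Q π z.1 z.2)
    linarith
  exact ⟨key _ h1, key _ h2⟩

/-- The guarantee for one call holds whatever happened before, so the guarantees multiply. An early
exit makes the event vacuous and costs nothing. -/
theorem le_prob_evaluate {θ β : ℝ} (hθ : 0 ≤ θ) (hm : 0 < p.m)
    (hβ : θ + M.γ ^ (p.n + 1) * M.horizon ≤ β) (zs : List (S × A)) (qs : List ℝ) :
    rolloutConfidence M p θ ^ zs.length ≤ (evaluate M.γ φ p π₀ ws C zs qs).prob M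
      (fun res => ∀ out, res = .inr out → ∃ qs', out = qs ++ qs' ∧
        List.Forall₂ (Estimates M φ p π₀ ws C β) zs qs') := by
  induction zs generalizing qs with
  | nil =>
    have : ∀ out, (Sum.inr qs : (S × A) ⊕ List ℝ) = .inr out → ∃ qs', out = qs ++ qs' ∧
        List.Forall₂ (Estimates M φ p π₀ ws C β) [] qs' := by
      intro out h
      cases h
      exact ⟨[], by simp, .nil⟩
    simp only [evaluate, Prog.prob, List.length_nil, pow_zero]
    rw [if_pos this]
  | cons z zs ih =>
    rw [List.length_cons, pow_succ', evaluate]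
    refine (mul_le_mul_left (le_prob_confidentRollout_estimates hθ hm hβ z) _).trans
      (Prog.prob_mul_le_prob_bind _ fun res hres => ?_)
    cases res with
    | inl z' =>
      simp only [Prog.prob]
      rw [if_pos (fun out h => by cases h)]
      exact pow_le_one₀ zero_le (rolloutConfidence_le_one θ)
    | inr q =>
      refine (ih (qs ++ [q])).trans (Prog.prob_mono _ fun res h out hout => ?_)
      obtain ⟨qs', h1, h2⟩ := h out hout
      exact ⟨q :: qs', by simp [h1], .cons (hres q rfl) h2⟩

/-- Realizability holds for every policy, so it gives a linear target for the virtual policy too,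
and one regression serves both targets. The error `ε` occurs twice: in the data at the core pairs
and at the point of prediction. -/
theorem ridge_accurate {b ε β e : ℝ} (hlam : 0 < p.lam) (htau : p.tau = 1) (hb : 0 ≤ b)
    (hreal : ApproxRealizable M φ b ε) (hε : 0 ≤ ε) (hβ : 0 ≤ β)
    (he : ε + (ε + β) * √C.length + √p.lam * b ≤ e) {qs : List ℝ}
    (hqs : List.Forall₂ (Estimates M φ p π₀ ws C β) C qs) {s : S} {a : A}
    (hsa : ¬ Uncertain φ p C s a) :
    |ridge φ p C qs ⬝ᵥ φ.map s a - M.Q (rolloutPolicy M.γ p.alpha φ π₀ ws) s a| ≤ e ∧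
    |ridge φ p C qs ⬝ᵥ φ.map s a - M.Q (virtualPolicy M φ p π₀ C ws) s a| ≤ e := by
  have hlev : leverage p.lam (feats φ C) (φ.map s a) ≤ 1 := by
    rw [uncertain_iff, not_lt, htau] at hsa
    exact hsa
  have hlen : (feats φ C).length = C.length := by simp [feats]
  have key : ∀ π : Policy S A,
      (∀ i (hi : i < C.length), |qs.getD i 0 - M.Q π (C[i]).1 (C[i]).2| ≤ β) →
      |ridge φ p C qs ⬝ᵥ φ.map s a - M.Q π s a| ≤ e := by
    intro π hπ
    obtain ⟨w, hw, hwQ⟩ := hreal π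
    have h1 := abs_ridge_sub_le hlam (feats φ C) (fun i => qs.getD i 0) w (φ.map s a)
      (η := ε + β) (b := b) (by linarith)
      (by rw [dotProduct_self_eq_norm_sq]; exact pow_le_pow_left₀ (norm_nonneg _) hw 2) hb
      (fun i => by
        have hi : (i : ℕ) < C.length := by rw [← hlen]; exact i.2
        have h2 := hπ i hi
        have h3 := hwQ (C[(i : ℕ)]).1 (C[(i : ℕ)]).2
        have e1 : (feats φ C).get i = φ.map (C[(i : ℕ)]).1 (C[(i : ℕ)]).2 := by
          rw [List.get_eq_getElem]
          exact List.getElem_map _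
        rw [e1]
        have h4 := abs_sub_le (qs.getD i 0) (M.Q π (C[(i : ℕ)]).1 (C[(i : ℕ)]).2)
          (w ⬝ᵥ φ.map (C[(i : ℕ)]).1 (C[(i : ℕ)]).2)
        linarith) hlev
    have hlen' : √((feats φ C).length : ℝ) = √(C.length : ℝ) := by rw [hlen]
    rw [hlen'] at h1
    have h2 := hwQ s a
    rw [abs_sub_comm] at h2
    have h3 := abs_sub_le (ridge φ p C qs ⬝ᵥ φ.map s a) (w ⬝ᵥ φ.map s a) (M.Q π s a)
    change |ridge φ p C qs ⬝ᵥ φ.map s a - w ⬝ᵥ φ.map s a| ≤ _ at h1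
    linarith
  have hget : ∀ i (hi : i < C.length), Estimates M φ p π₀ ws C β C[i] (qs.getD i 0) := by
    intro i hi
    have hi' : i < qs.length := hqs.length_eq ▸ hi
    rw [List.getD_eq_getElem _ _ hi']
    exact hqs.get hi hi'
  exact ⟨key _ fun i hi => (hget i hi).1, key _ fun i hi => (hget i hi).2⟩

theorem le_prob_policyIteration {θ b ε β e : ℝ} (hlam : 0 < p.lam) (htau : p.tau = 1) (hb : 0 ≤ b)
    (hreal : ApproxRealizable M φ b ε) (hε : 0 ≤ ε) (hθ : 0 ≤ θ) (hm : 0 < p.m)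
    (hβ : θ + M.γ ^ (p.n + 1) * M.horizon ≤ β)
    (he : ε + (ε + β) * √C.length + √p.lam * b ≤ e) (k : ℕ)
    (hws : Accurate M φ p π₀ C e ws) :
    (rolloutConfidence M p θ ^ C.length) ^ k ≤ (policyIteration M.γ φ p π₀ C k ws).prob M
      (fun res => ∀ out, res = .inr out →
        Accurate M φ p π₀ C e out ∧ out.length = ws.length + k) := by
  have hβ0 : 0 ≤ β := by
    have := mul_nonneg (pow_nonneg M.γ_pos.le (p.n + 1)) M.horizon_pos.le
    linarith
  induction k generalizing ws with
  | zero =>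
    have : ∀ out, (Sum.inr ws : (S × A) ⊕ List (Fin d → ℝ)) = .inr out →
        Accurate M φ p π₀ C e out ∧ out.length = ws.length + 0 := by
      intro out h
      cases h
      exact ⟨hws, rfl⟩
    simp only [policyIteration, Prog.prob, pow_zero]
    rw [if_pos this]
  | succ k ih =>
    rw [pow_succ', policyIteration]
    refine (mul_le_mul_left (le_prob_evaluate hθ hm hβ C []) _).trans
      (Prog.prob_mul_le_prob_bind _ fun res hres => ?_)
    cases res with
    | inl z' =>
      simp only [Prog.prob]
      rw [if_pos (fun out h => by cases h)]
      exact pow_le_one₀ zero_le (pow_le_one₀ zero_le (rolloutConfidence_le_one θ))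
    | inr qs =>
      obtain ⟨qs', h1, h2⟩ := hres qs rfl
      rw [List.nil_append] at h1
      subst h1
      have hacc : Accurate M φ p π₀ C e (ws ++ [ridge φ p C qs]) :=
        hws.append M π₀ fun s a hsa => ridge_accurate hlam htau hb hreal hε hβ0 he h2 hsa
      refine (ih hacc).trans (Prog.prob_mono _ fun res h out hout => ?_)
      obtain ⟨h3, h4⟩ := h out hout
      refine ⟨h3, ?_⟩
      rw [h4, List.length_append, List.length_singleton]
      omega

/-- Each restart uses one round and adds one pair, so `C.length + R` is preserved. The rounds cannot
run out, because the core set would then exceed its largest size. -/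
theorem le_prob_restartLoop {θ b ε β e x : ℝ} (hd : 0 < d) (hlam : 0 < p.lam) (htau : p.tau = 1)
    (hb : 0 ≤ b) (hreal : ApproxRealizable M φ b ε) (hε : 0 ≤ ε) (hθ : 0 ≤ θ) (hm : 0 < p.m)
    (hβ : θ + M.γ ^ (p.n + 1) * M.horizon ≤ β)
    (he : ε + (ε + β) * √(coreBound d p.lam) + √p.lam * b ≤ e)
    (hx : ∀ C ws, CoreInv φ p M.ρ C → Accurate M φ p π₀ C e ws → ws.length = p.K →
      M.Vstar M.ρ - mixtureValue M φ p π₀ ws ≤ x)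
    (R : ℕ) (hC : CoreInv φ p M.ρ C) (hR : coreBound d p.lam + 1 ≤ C.length + R) :
    ((rolloutConfidence M p θ ^ coreBound d p.lam) ^ p.K) ^ R ≤
      (restartLoop M.γ φ p π₀ R C).prob M
        (fun out => ∃ ws, out = some ws ∧ M.Vstar M.ρ - mixtureValue M φ p π₀ ws ≤ x) := by
  have hc1 := rolloutConfidence_le_one (M := M) (p := p) θ
  have hβ0 : 0 ≤ β := by
    have := mul_nonneg (pow_nonneg M.γ_pos.le (p.n + 1)) M.horizon_pos.le
    linarith
  induction R generalizing C with
  | zero =>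
    have := hC.length_le_coreBound hd hlam
    omega
  | succ R ih =>
    have hlen := hC.length_le_coreBound hd hlam
    have heC : ε + (ε + β) * √C.length + √p.lam * b ≤ e := by
      have : √(C.length : ℝ) ≤ √(coreBound d p.lam) := Real.sqrt_le_sqrt (Nat.cast_le.2 hlen)
      have := mul_le_mul_of_nonneg_left this (by linarith : 0 ≤ ε + β)
      linarith
    have h1 := le_prob_policyIteration (M := M) (π₀ := π₀) hlam htau hb hreal hε hθ hm hβ heC p.K
      (accurate_nil M π₀ e)
    have h2 := h1.trans (Prog.prob_mono_of_sat (policyIteration_sat φ p π₀ [] C p.K)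
      (E' := fun res => ExitUncertain φ p C res ∧ ∀ out, res = .inr out →
        Accurate M φ p π₀ C e out ∧ out.length = 0 + p.K) fun res h3 h4 => ⟨h3, h4⟩)
    have h3 : (rolloutConfidence M p θ ^ coreBound d p.lam) ^ p.K ≤
        (rolloutConfidence M p θ ^ C.length) ^ p.K :=
      pow_le_pow_left₀ zero_le (pow_le_pow_of_le_one zero_le hc1 hlen) _
    rw [pow_succ', restartLoop]
    refine (mul_le_mul_left (h3.trans h2) _).trans
      (Prog.prob_mul_le_prob_bind _ fun res hres => ?_)
    cases res with
    | inl z =>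
      refine ih (hC.append hlam htau (hres.1 z rfl)) ?_
      rw [List.length_append, List.length_singleton]
      omega
    | inr ws =>
      obtain ⟨h4, h5⟩ := hres.2 ws rfl
      simp only [Prog.prob]
      rw [if_pos ⟨ws, rfl, hx C ws hC h4 (by omega)⟩]
      exact pow_le_one₀ zero_le (pow_le_one₀ zero_le (pow_le_one₀ zero_le hc1))

/-- The success probability of the algorithm, in terms of the parameters. -/
theorem le_successProb {θ b ε β e x δ : ℝ} (hd : 0 < d) (hlam : 0 < p.lam) (htau : p.tau = 1)
    (hb : 0 ≤ b) (hreal : ApproxRealizable M φ b ε) (hε : 0 ≤ ε) (hθ : 0 ≤ θ) (hm : 0 < p.m)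
    (hK : 0 < p.K) (halpha : 0 < p.alpha)
    (hβ : θ + M.γ ^ (p.n + 1) * M.horizon ≤ β)
    (he : ε + (ε + β) * √(3 * (d * logFactor p.lam)) + √p.lam * b ≤ e)
    (hδ : p.K * (3 * (d * logFactor p.lam)) ^ 2 *
      (4 * Real.exp (-(2 * p.m * θ ^ 2 / M.horizon ^ 2))) ≤ δ) (hδ1 : δ < 1)
    (hx : min M.horizon (M.horizon * (M.horizon + Real.log (Fintype.card A) / p.alpha) / p.K +
        M.horizon * (p.alpha * M.horizon ^ 2 / 8) + 2 * (M.horizon + 1) * e) ≤ x) :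
    ENNReal.ofReal (1 - δ) ≤ successProb M φ p π₀ x := by
  have hL := one_le_logFactor hlam
  have hd1 : (1 : ℝ) ≤ d := Nat.one_le_cast.2 hd
  have hN := coreBound_le (d := d) hlam
  set N := coreBound d p.lam with hNdef
  have hdL : 1 ≤ d * logFactor p.lam := one_le_mul_of_one_le_of_one_le hd1 hL
  have hβ0 : 0 ≤ β := by
    have := mul_nonneg (pow_nonneg M.γ_pos.le (p.n + 1)) M.horizon_pos.le
    linarith
  have he0 : 0 ≤ e := le_trans (by positivity) he
  have heN : ε + (ε + β) * √N + √p.lam * b ≤ e := by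
    have := mul_le_mul_of_nonneg_left (Real.sqrt_le_sqrt hN) (by linarith : 0 ≤ ε + β)
    linarith
  have hsub : ∀ C ws, CoreInv φ p M.ρ C → Accurate M φ p π₀ C e ws → ws.length = p.K →
      M.Vstar M.ρ - mixtureValue M φ p π₀ ws ≤ x := fun C ws hC hacc hlen =>
    (le_min (Vstar_sub_mixtureValue_le_horizon M π₀ hK ws)
      (Vstar_sub_mixtureValue_le M π₀ he0 hlen hK halpha hacc hC.2.2)).trans hx
  obtain ⟨C, hC, hinit⟩ := exists_initCore_univ (M := M) (φ := φ) hlam htau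
  have hC1 : 1 ≤ C.length := List.length_pos_iff.2 hC.1
  -- As many rounds as the bound on the core set suffice, since the initial core set already has an
  -- element.
  have hloop := le_prob_restartLoop (M := M) (π₀ := π₀) hd hlam htau hb hreal hε hθ hm hβ heN hsub
    N hC (by omega)
  have hprob : ((rolloutConfidence M p θ ^ N) ^ p.K) ^ N ≤
      (politex M.γ φ p π₀ M.ρ N).prob M
        (fun out => ∃ ws, out = some ws ∧ M.Vstar M.ρ - mixtureValue M φ p π₀ ws ≤ x) := by
    rw [politex]
    refine le_trans ?_ (Prog.prob_mul_le_prob_bind _ (F := fun C' => C' = C)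
      (c := ((rolloutConfidence M p θ ^ N) ^ p.K) ^ N) fun C' hC' => by subst hC'; exact hloop)
    exact le_mul_of_one_le_left zero_le (hinit (fun C' => C' = C) rfl).1
  refine le_trans ?_ (hprob.trans (le_iSup (fun R : ℕ => (politex M.γ φ p π₀ M.ρ R).prob M
    (fun out => ∃ ws, out = some ws ∧ M.Vstar M.ρ - mixtureValue M φ p π₀ ws ≤ x)) N))
  rw [← pow_mul, ← pow_mul, ← mul_assoc, rolloutConfidence]
  set η : ℝ := 4 * Real.exp (-(2 * p.m * θ ^ 2 / M.horizon ^ 2)) with hη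
  have hη0 : 0 ≤ η := by positivity
  have hK1 : (1 : ℝ) ≤ p.K := Nat.one_le_cast.2 hK
  have hη1 : η ≤ 1 := by
    have h1 : 1 ≤ (p.K : ℝ) * (3 * (d * logFactor p.lam)) ^ 2 :=
      one_le_mul_of_one_le_of_one_le hK1 (one_le_pow₀ (by linarith))
    nlinarith
  rw [← ENNReal.ofReal_pow (by linarith)]
  refine ENNReal.ofReal_le_ofReal ?_
  -- Bernoulli's inequality takes the place of a union bound over the calls of the rollout
  -- subroutine.
  have hbern := one_add_mul_le_pow (a := -η) (by linarith) (N * p.K * N)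
  rw [← sub_eq_add_neg] at hbern
  refine le_trans ?_ hbern
  have hTle : ((N * p.K * N : ℕ) : ℝ) ≤ p.K * (3 * (d * logFactor p.lam)) ^ 2 := by
    push_cast
    have h1 : (N : ℝ) ^ 2 ≤ (3 * (d * logFactor p.lam)) ^ 2 :=
      pow_le_pow_left₀ (Nat.cast_nonneg _) hN 2
    nlinarith
  have := mul_le_mul_of_nonneg_right hTle hη0
  linarith

end Success

end MCPolitex

end

noncomputable section

namespace MCPolitex

/-! ### Elementary inequalities for the parameters. -/

section Numerics

/-- From `γ ≤ exp (-(1 - γ))`; it bounds the truncation error for the prescribed rollout length. -/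
theorem pow_succ_le_inv {γ y : ℝ} {n : ℕ} (h0 : 0 < γ) (h1 : γ < 1) (hy : 0 < y)
    (hn : 1 / (1 - γ) * Real.log y ≤ n) : γ ^ (n + 1) ≤ y⁻¹ := by
  have hg : 0 < 1 - γ := by linarith
  have h2 : γ ≤ Real.exp (-(1 - γ)) := by
    have := Real.add_one_le_exp (-(1 - γ))
    linarith
  have h3 : Real.log y ≤ n * (1 - γ) := by
    rw [one_div, inv_mul_eq_div, div_le_iff₀ hg] at hn
    exact hn
  calc γ ^ (n + 1) ≤ γ ^ n := pow_le_pow_of_le_one h0.le h1.le (Nat.le_succ n)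
    _ ≤ Real.exp (-(1 - γ)) ^ n := pow_le_pow_left₀ h0.le h2 n
    _ = Real.exp (-(n * (1 - γ))) := by rw [← Real.exp_nat_mul]; ring_nf
    _ ≤ Real.exp (-Real.log y) := Real.exp_le_exp.2 (by linarith)
    _ = y⁻¹ := by rw [Real.exp_neg, Real.exp_log hy]

/-- Twice the logarithm in the exponent makes the failure probability quadratic in `δ / (8 K D)`.
This cancels the square of the core set bound and one factor `K`, leaving `(36/64) δ² / K`. -/
theorem union_bound_le {K D δ X : ℝ} (hK : 1 ≤ K) (hD : 1 ≤ D) (hδ : 0 < δ) (hδ1 : δ < 1)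
    (hX : 2 * Real.log (8 * K * D / δ) ≤ X) :
    K * (3 * D) ^ 2 * (4 * Real.exp (-X)) ≤ δ := by
  have hpos : 0 < 8 * K * D / δ := by positivity
  have h1 : Real.exp (-X) ≤ (δ / (8 * K * D)) ^ 2 := by
    calc Real.exp (-X) ≤ Real.exp (-(2 * Real.log (8 * K * D / δ))) :=
          Real.exp_le_exp.2 (by linarith)
      _ = (δ / (8 * K * D)) ^ 2 := by
          rw [Real.exp_neg, two_mul, Real.exp_add, Real.exp_log hpos, ← sq, ← inv_pow, inv_div]
  calc K * (3 * D) ^ 2 * (4 * Real.exp (-X))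
      ≤ K * (3 * D) ^ 2 * (4 * (δ / (8 * K * D)) ^ 2) := by gcongr
    _ = 36 / 64 * δ ^ 2 / K := by
        field_simp
        ring
    _ ≤ δ := by
        rw [div_le_iff₀ (by linarith)]
        nlinarith

/-- The optimization error of mirror descent with the step size of the algorithm. -/
theorem mirror_error_eq {H K a : ℝ} (hH : 0 < H) (hK : 0 < K) (ha : 0 < a) :
    H * (H + a / (H⁻¹ * √(2 * a / K))) / K + H * (H⁻¹ * √(2 * a / K) * H ^ 2 / 8) =
      H ^ 2 / K + 5 / 8 * (H ^ 2 * √(2 * a / K)) := by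
  set r := √(2 * a / K) with hr
  have hr0 : 0 < r := Real.sqrt_pos.2 (by positivity)
  have hr2 : r ^ 2 = 2 * a / K := Real.sq_sqrt (by positivity)
  have ha' : a = r ^ 2 * K / 2 := by rw [hr2]; field_simp
  rw [ha']
  field_simp
  ring

theorem log_two_le_log_natCast {n : ℕ} (hn : 2 ≤ n) : 69 / 100 ≤ Real.log n := by
  have h1 : Real.log 2 ≤ Real.log n := Real.log_le_log (by norm_num) (by exact_mod_cast hn)
  linarith [Real.log_two_gt_d9]

end Numerics

/-! ### The two choices of parameters. -/

section Instances

variable {S : Type u} {A : Type v} [MeasurableSpace S] [Fintype A] [MeasurableSpace A] [Nonempty A]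
  [MeasurableSingletonClass A]
  {d : ℕ} {M : MDP S A} {φ : FeatureMap S A d} {π₀ : Policy S A}

theorem exact_successProb {b κ δ : ℝ} {featCost : ℕ} (hA : 2 ≤ Fintype.card A) (hd : 0 < d)
    (hb : 0 < b) (hκ : 0 < κ) (hδ : 0 < δ) (hδ1 : δ < 1) (hreal : Realizable M φ b) :
    ENNReal.ofReal (1 - δ) ≤
      successProb M φ (exactParams (Fintype.card A) d M.γ b κ δ featCost) π₀ κ := by
  set p := exactParams (Fintype.card A) d M.γ b κ δ featCost with hp
  have hg := M.one_sub_γ_pos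
  have hH := M.horizon_pos
  have hH1 := M.one_le_horizon
  have hgH : 1 - M.γ = M.horizon⁻¹ := by rw [MDP.horizon, inv_inv]
  have hd' : (0 : ℝ) < d := Nat.cast_pos.2 hd
  have hd1 : (1 : ℝ) ≤ d := Nat.one_le_cast.2 hd
  have hlogA := log_two_le_log_natCast hA
  set a : ℝ := Real.log (Fintype.card A) with ha
  have hlam_def : p.lam = κ ^ 2 * (1 - M.γ) ^ 2 / (256 * b ^ 2) := rfl
  have hlam : 0 < p.lam := by rw [hlam_def]; positivity
  have hL := one_le_logFactor hlam
  set L := logFactor p.lam with hLdef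
  set H := M.horizon with hHdef
  have hK_def : p.K = ⌈32 * a / (κ ^ 2 * (1 - M.γ) ^ 4)⌉₊ := rfl
  have hm_def : p.m = ⌈1024 * (d * L / (κ ^ 2 * (1 - M.γ) ^ 4)) *
    Real.log (8 * p.K * d * L / δ)⌉₊ := rfl
  have hn_def : p.n = ⌈1 / (1 - M.γ) * Real.log (32 * √d * L / ((1 - M.γ) ^ 2 * κ))⌉₊ := rfl
  have halpha_def : p.alpha = (1 - M.γ) * √(2 * a / p.K) := rfl
  have hK : 0 < p.K := by rw [hK_def, Nat.ceil_pos]; positivity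
  have hK1 : (1 : ℝ) ≤ p.K := Nat.one_le_cast.2 hK
  have hK0 : (0 : ℝ) < p.K := by linarith
  have hD : 1 ≤ d * L := one_le_mul_of_one_le_of_one_le hd1 hL
  have hD0 : 0 < d * L := by linarith
  have hlogpos : 0 < Real.log (8 * p.K * d * L / δ) := by
    refine Real.log_pos ((one_lt_div hδ).2 ?_)
    have : 1 ≤ p.K * (d * L) := one_le_mul_of_one_le_of_one_le hK1 hD
    nlinarith
  have hm : 0 < p.m := by rw [hm_def, Nat.ceil_pos]; positivity
  have hsD : 0 < √(d * L) := Real.sqrt_pos.2 hD0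
  set θ : ℝ := κ * (1 - M.γ) / (32 * √(d * L)) with hθ
  have hreal' : ApproxRealizable M φ b 0 := fun π => by
    obtain ⟨w, hw, h⟩ := hreal π
    exact ⟨w, hw, fun s a => by rw [h s a, sub_self, abs_zero]⟩
  have halpha : 0 < p.alpha := by rw [halpha_def]; positivity
  -- `β` allows `θ` for sampling and `θ` for truncation. Regularization contributes `1/16` and noise
  -- `√3/16` in units of `κ (1 - γ)`, and `(1 + √3)/16 < 0.171`.
  refine le_successProb (θ := θ) (b := b) (ε := 0) (β := 2 * θ) (e := 171 / 1000 * (κ * (1 - M.γ)))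
    hd hlam rfl hb.le hreal' le_rfl (by positivity) hm hK halpha ?_ ?_ ?_ hδ1 ?_
  · have hy : 0 < 32 * √d * L / ((1 - M.γ) ^ 2 * κ) := by positivity
    have h1 := pow_succ_le_inv (n := p.n) M.γ_pos M.γ_lt_one hy (by rw [hn_def]; exact Nat.le_ceil _)
    have h2 : √(d * L) ≤ √d * L := by
      rw [Real.sqrt_mul hd'.le]
      refine mul_le_mul_of_nonneg_left ?_ (Real.sqrt_nonneg _)
      rw [Real.sqrt_le_left (by linarith)]
      nlinarith
    have h3 : (32 * √d * L / ((1 - M.γ) ^ 2 * κ))⁻¹ * H ≤ θ := by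
      have e1 : (32 * √d * L / ((1 - M.γ) ^ 2 * κ))⁻¹ * H = κ * (1 - M.γ) / (32 * (√d * L)) := by
        rw [inv_div, hHdef, MDP.horizon]
        field_simp
      rw [e1, hθ]
      gcongr
    have h4 := mul_le_mul_of_nonneg_right h1 hH.le
    linarith
  · have e1 : √p.lam * b = κ * (1 - M.γ) / 16 := by
      have : p.lam = (κ * (1 - M.γ) / (16 * b)) ^ 2 := by rw [hlam_def]; field_simp; norm_num
      rw [this, Real.sqrt_sq (by positivity)]
      field_simp
    have e2 : (0 + 2 * θ) * √(3 * (d * L)) = √3 * (κ * (1 - M.γ) / 16) := by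
      rw [Real.sqrt_mul (by norm_num), hθ]
      field_simp
      ring
    have h3 : √3 ≤ 1736 / 1000 := by
      rw [Real.sqrt_le_left (by norm_num)]
      norm_num
    rw [e1, e2]
    have := mul_le_mul_of_nonneg_right h3 (by positivity : 0 ≤ κ * (1 - M.γ) / 16)
    linarith
  · refine union_bound_le hK1 hD hδ hδ1 ?_
    have h1 : 1024 * (d * L / (κ ^ 2 * (1 - M.γ) ^ 4)) * Real.log (8 * p.K * d * L / δ) ≤ p.m := by
      rw [hm_def]; exact Nat.le_ceil _
    have e1 : 8 * (p.K : ℝ) * (d * L) / δ = 8 * p.K * d * L / δ := by ring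
    have hθ2 : θ ^ 2 = κ ^ 2 * (1 - M.γ) ^ 2 / (1024 * (d * L)) := by
      rw [hθ, div_pow, mul_pow, mul_pow, Real.sq_sqrt hD0.le]
      norm_num
    rw [e1, hθ2, ← hHdef]
    have e2 : 2 * Real.log (8 * p.K * d * L / δ) =
        2 * (1024 * (d * L / (κ ^ 2 * (1 - M.γ) ^ 4)) * Real.log (8 * p.K * d * L / δ)) *
          (κ ^ 2 * (1 - M.γ) ^ 2 / (1024 * (d * L))) / H ^ 2 := by
      rw [hgH]
      field_simp
    rw [e2]
    gcongr
  -- For `κ ≥ H` the trivial bound suffices. Otherwise `H / κ > 1`, which makes the cost `H² / K` of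
  -- the initial policy a small multiple of `κ`. The total is at most `1/22 + 5/32 + 0.684 < 1`
  -- times `κ`.
  · rcases le_or_gt H κ with hle | hgt
    · exact (min_le_left _ _).trans hle
    · refine (min_le_right _ _).trans ?_
      rw [halpha_def, hgH, mirror_error_eq hH hK0 (by linarith)]
      have hKle : 32 * a * H ^ 4 / κ ^ 2 ≤ p.K := by
        have : 32 * a * H ^ 4 / κ ^ 2 = 32 * a / (κ ^ 2 * (1 - M.γ) ^ 4) := by
          rw [hgH]; field_simp
        rw [this, hK_def]
        exact Nat.le_ceil _
      have h1 : √(2 * a / p.K) ≤ κ / (4 * H ^ 2) := by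
        rw [Real.sqrt_le_left (by positivity), div_le_iff₀ hK0]
        have e1 : 2 * a = (κ / (4 * H ^ 2)) ^ 2 * (32 * a * H ^ 4 / κ ^ 2) := by
          field_simp
          norm_num
        calc 2 * a = (κ / (4 * H ^ 2)) ^ 2 * (32 * a * H ^ 4 / κ ^ 2) := e1
          _ ≤ (κ / (4 * H ^ 2)) ^ 2 * p.K := by gcongr
      have h2 : H ^ 2 * √(2 * a / p.K) ≤ κ / 4 := by
        calc H ^ 2 * √(2 * a / p.K) ≤ H ^ 2 * (κ / (4 * H ^ 2)) := by gcongr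
          _ = κ / 4 := by field_simp
      -- The constant comes from `32 log |A| ≥ 32 · 0.69 > 22`, where at least two actions are
      -- needed.
      have h3 : H ^ 2 / p.K ≤ κ / 22 := by
        rw [div_le_iff₀ hK0]
        have h4 : H ^ 2 ≤ κ / 22 * (32 * a * H ^ 4 / κ ^ 2) := by
          have e1 : κ / 22 * (32 * a * H ^ 4 / κ ^ 2) = (32 * a / 22) * (H ^ 2 * (H / κ) * H) := by
            field_simp
          rw [e1]
          have h5 : 1 ≤ 32 * a / 22 := by linarith
          have h6 : 1 ≤ H / κ := (one_le_div hκ).2 hgt.le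
          have h7 : H ^ 2 ≤ H ^ 2 * (H / κ) := le_mul_of_one_le_right (by positivity) h6
          have h8 : H ^ 2 * (H / κ) ≤ H ^ 2 * (H / κ) * H :=
            le_mul_of_one_le_right (by positivity) hH1
          have h9 : H ^ 2 * (H / κ) * H ≤ 32 * a / 22 * (H ^ 2 * (H / κ) * H) :=
            le_mul_of_one_le_left (by positivity) h5
          linarith
        calc H ^ 2 ≤ κ / 22 * (32 * a * H ^ 4 / κ ^ 2) := h4
          _ ≤ κ / 22 * p.K := by gcongr
      have h5 : 2 * (H + 1) * (171 / 1000 * (κ * H⁻¹)) ≤ 684 / 1000 * κ := by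
        calc 2 * (H + 1) * (171 / 1000 * (κ * H⁻¹)) ≤ 2 * (H + H) * (171 / 1000 * (κ * H⁻¹)) := by
              gcongr
          _ = 684 / 1000 * κ := by field_simp; norm_num
      linarith

theorem approx_successProb {b ε δ : ℝ} {featCost : ℕ} (hA : 2 ≤ Fintype.card A) (hd : 0 < d)
    (hb : 0 < b) (hε : 0 < ε) (hδ : 0 < δ) (hδ1 : δ < 1) (hreal : ApproxRealizable M φ b ε) :
    ENNReal.ofReal (1 - δ) ≤
      successProb M φ (approxParams (Fintype.card A) d M.γ b ε δ featCost) π₀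
        (42 * ε * √d / (1 - M.γ) * (1 + Real.log (1 + b ^ 2 / (ε ^ 2 * d)))) := by
  set p := approxParams (Fintype.card A) d M.γ b ε δ featCost with hp
  have hg := M.one_sub_γ_pos
  have hH := M.horizon_pos
  have hH1 := M.one_le_horizon
  have hgH : 1 - M.γ = M.horizon⁻¹ := by rw [MDP.horizon, inv_inv]
  have hd' : (0 : ℝ) < d := Nat.cast_pos.2 hd
  have hd1 : (1 : ℝ) ≤ d := Nat.one_le_cast.2 hd
  have hlogA := log_two_le_log_natCast hA
  set a : ℝ := Real.log (Fintype.card A) with ha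
  have hlam_def : p.lam = ε ^ 2 * d / b ^ 2 := rfl
  have hlam : 0 < p.lam := by rw [hlam_def]; positivity
  have hL := one_le_logFactor hlam
  have htarget : 1 + Real.log (1 + b ^ 2 / (ε ^ 2 * d)) = logFactor p.lam := by
    rw [logFactor, hlam_def, inv_div]
  rw [htarget]
  set L := logFactor p.lam with hLdef
  set H := M.horizon with hHdef
  have hK_def : p.K = ⌈2 * a / (ε ^ 2 * d * (1 - M.γ) ^ 2)⌉₊ := rfl
  have hm_def : p.m = ⌈1 / (ε ^ 2 * (1 - M.γ) ^ 2) * Real.log (8 * p.K * d * L / δ)⌉₊ := rfl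
  have hn_def : p.n = ⌈1 / (1 - M.γ) * Real.log (1 / (ε * (1 - M.γ)))⌉₊ := rfl
  have halpha_def : p.alpha = (1 - M.γ) * √(2 * a / p.K) := rfl
  have hK : 0 < p.K := by rw [hK_def, Nat.ceil_pos]; positivity
  have hK1 : (1 : ℝ) ≤ p.K := Nat.one_le_cast.2 hK
  have hK0 : (0 : ℝ) < p.K := by linarith
  have hD : 1 ≤ d * L := one_le_mul_of_one_le_of_one_le hd1 hL
  have hD0 : 0 < d * L := by linarith
  have hlogpos : 0 < Real.log (8 * p.K * d * L / δ) := by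
    refine Real.log_pos ((one_lt_div hδ).2 ?_)
    have : 1 ≤ p.K * (d * L) := one_le_mul_of_one_le_of_one_le hK1 hD
    nlinarith
  have hm : 0 < p.m := by rw [hm_def, Nat.ceil_pos]; positivity
  have halpha : 0 < p.alpha := by rw [halpha_def]; positivity
  have hsd1 : 1 ≤ √(d : ℝ) := Real.one_le_sqrt.2 hd1
  set y : ℝ := ε * √d with hy
  have hy0 : 0 < y := by positivity
  have hy2 : y ^ 2 = ε ^ 2 * d := by rw [hy, mul_pow, Real.sq_sqrt hd'.le]
  -- Prediction error, noise and regularization add up to at most `(1 + 3 √3 + 1) y L`, and `2 + 3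
  -- √3 < 36/5`.
  refine le_successProb (θ := ε) (b := b) (ε := ε) (β := 2 * ε) (e := 36 / 5 * (y * L))
    hd hlam rfl hb.le hreal hε.le hε.le hm hK halpha ?_ ?_ ?_ hδ1 ?_
  · have h1 := pow_succ_le_inv (n := p.n) (y := 1 / (ε * (1 - M.γ))) M.γ_pos M.γ_lt_one
      (by positivity) (by rw [hn_def]; exact Nat.le_ceil _)
    have h2 : (1 / (ε * (1 - M.γ)))⁻¹ * H = ε := by
      rw [hgH]
      field_simp
    have h4 := mul_le_mul_of_nonneg_right h1 hH.le
    linarith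
  · have e1 : √p.lam * b = y := by
      have : p.lam = (y / b) ^ 2 := by rw [hlam_def, div_pow, hy2]
      rw [this, Real.sqrt_sq (by positivity)]
      field_simp
    have h3 : √3 ≤ 173206 / 100000 := by
      rw [Real.sqrt_le_left (by norm_num)]
      norm_num
    have h2 : √L ≤ L := by
      rw [Real.sqrt_le_left (by linarith)]
      nlinarith
    have e2 : (ε + 2 * ε) * √(3 * (d * L)) = 3 * (√3 * (y * √L)) := by
      rw [Real.sqrt_mul (by norm_num), Real.sqrt_mul hd'.le, hy]
      ring
    rw [e1, e2]
    have h4 : √3 * (y * √L) ≤ 173206 / 100000 * (y * L) := by gcongr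
    have h5 : y ≤ y * L := le_mul_of_one_le_right hy0.le hL
    have h6 : ε ≤ y := le_mul_of_one_le_right hε.le hsd1
    linarith
  · refine union_bound_le hK1 hD hδ hδ1 ?_
    have h1 : 1 / (ε ^ 2 * (1 - M.γ) ^ 2) * Real.log (8 * p.K * d * L / δ) ≤ p.m := by
      rw [hm_def]; exact Nat.le_ceil _
    have e1 : 8 * (p.K : ℝ) * (d * L) / δ = 8 * p.K * d * L / δ := by ring
    rw [e1, ← hHdef]
    have e2 : 2 * Real.log (8 * p.K * d * L / δ) =
        2 * (1 / (ε ^ 2 * (1 - M.γ) ^ 2) * Real.log (8 * p.K * d * L / δ)) * ε ^ 2 / H ^ 2 := by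
      rw [hgH]
      field_simp
    rw [e2]
    gcongr
  · have etarget : 42 * ε * √d / (1 - M.γ) * L = 42 * (y * L) * H := by
      rw [hgH, hy]
      field_simp
    rw [etarget]
    -- If the target reaches the horizon, the trivial bound suffices. Otherwise `y` is below `1/42`,
    -- hence below `2 log |A|`, which is what the cost of the initial policy requires.
    rcases le_or_gt 1 (42 * (y * L)) with hle | hgt
    · exact (min_le_left _ _).trans (le_mul_of_one_le_left hH.le hle)
    · refine (min_le_right _ _).trans ?_
      rw [halpha_def, hgH, mirror_error_eq hH hK0 (by linarith)]
      have hKle : 2 * a * H ^ 2 / y ^ 2 ≤ p.K := by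
        have : 2 * a * H ^ 2 / y ^ 2 = 2 * a / (ε ^ 2 * d * (1 - M.γ) ^ 2) := by
          rw [hgH, hy2]; field_simp
        rw [this, hK_def]
        exact Nat.le_ceil _
      have hyL : y ≤ y * L := le_mul_of_one_le_right hy0.le hL
      have h1 : √(2 * a / p.K) ≤ y / H := by
        rw [Real.sqrt_le_left (by positivity), div_le_iff₀ hK0]
        calc 2 * a = (y / H) ^ 2 * (2 * a * H ^ 2 / y ^ 2) := by field_simp
          _ ≤ (y / H) ^ 2 * p.K := by gcongr
      have h2 : H ^ 2 * √(2 * a / p.K) ≤ y * L * H := by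
        calc H ^ 2 * √(2 * a / p.K) ≤ H ^ 2 * (y / H) := by gcongr
          _ = y * H := by field_simp
          _ ≤ y * L * H := by gcongr
      have h3 : H ^ 2 / p.K ≤ y * L * H := by
        have h4 : H ^ 2 / p.K ≤ y := by
          rw [div_le_iff₀ hK0]
          have e1 : y * (2 * a * H ^ 2 / y ^ 2) = H ^ 2 * (2 * a / y) := by field_simp
          have h5 : 1 ≤ 2 * a / y := by
            rw [one_le_div hy0]
            linarith
          calc H ^ 2 ≤ H ^ 2 * (2 * a / y) := le_mul_of_one_le_right (by positivity) h5
            _ = y * (2 * a * H ^ 2 / y ^ 2) := e1.symm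
            _ ≤ y * p.K := by gcongr
        have h5 : y * L ≤ y * L * H := le_mul_of_one_le_right (by positivity) hH1
        linarith
      have h5 : 2 * (H + 1) * (36 / 5 * (y * L)) ≤ 144 / 5 * (y * L * H) := by
        calc 2 * (H + 1) * (36 / 5 * (y * L)) ≤ 2 * (H + H) * (36 / 5 * (y * L)) := by
              gcongr
          _ = 144 / 5 * (y * L * H) := by ring
      have h6 : 0 ≤ y * L * H := by positivity
      linarith

end Instances

end MCPolitex

end

noncomputable section

namespace MCPolitex

/-! ### Explicit cost formulas. -/

section Formula

variable {R : Type*} [CommSemiring R]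

/-- Operations for the features of a core set of size `N` and the inverse Gram matrix. -/
def invFormula (f d N : R) : R := N * f + (d ^ 2 + 1 + N * (7 * d ^ 2 + 2 * d + 2))

/-- Operations for one test. -/
def testFormula (f d : R) : R := f + 2 * d ^ 2 + 2 * d + 1

/-- Operations for one draw of an action. -/
def drawFormula (a f d K : R) : R := a * (f + K * (2 * d + 3) + 4) + 2 * a

/-- Cost of one step of a rollout. -/
def stepFormula (w a f d K : R) : R := w * (a * testFormula f d + drawFormula a f d K + 3) + 1

/-- Cost of `m` rollouts of length `n`. -/
def rolloutFormula (w a f d K m n : R) : R := m * (1 + n * stepFormula w a f d K + w)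

/-- Cost of one call of the rollout subroutine. -/
def subroutineFormula (w a f d K m n N : R) : R :=
  w * (invFormula f d N + 1) + rolloutFormula w a f d K m n

/-- Cost of one iteration of policy iteration. -/
def iterationFormula (w a f d K m n N : R) : R :=
  N * subroutineFormula w a f d K m n N + w * (invFormula f d N + 2 * N * d + 2 * d ^ 2)

/-- Cost of the algorithm: `w` is the cost of an operation, `a` the number of actions, `f` the cost
of a feature evaluation, and `N` a bound for the size of the core set. -/
def costFormula (w a f d K m n N : R) : R :=
  a * (w * (invFormula f d a + testFormula f d)) + N * (K * iterationFormula w a f d K m n N)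

theorem map_costFormula {R' : Type*} [CommSemiring R'] (g : R →+* R') (w a f d K m n N : R) :
    g (costFormula w a f d K m n N) =
      costFormula (g w) (g a) (g f) (g d) (g K) (g m) (g n) (g N) := by
  simp [costFormula, iterationFormula, subroutineFormula, rolloutFormula, stepFormula, drawFormula,
    testFormula, invFormula, map_ofNat]

theorem costFormula_mono {w a f d K m n N a' f' K' m' n' N' : ℝ} (hw : 0 ≤ w) (ha : 0 ≤ a)
    (hf : 0 ≤ f) (hd : 0 ≤ d) (hK : 0 ≤ K) (hm : 0 ≤ m) (hn : 0 ≤ n) (hN : 0 ≤ N)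
    (haa : a ≤ a') (hff : f ≤ f') (hKK : K ≤ K') (hmm : m ≤ m') (hnn : n ≤ n') (hNN : N ≤ N') :
    costFormula w a f d K m n N ≤ costFormula w a' f' d K' m' n' N' := by
  have ha' := ha.trans haa
  have hf' := hf.trans hff
  have hK' := hK.trans hKK
  have hm' := hm.trans hmm
  have hn' := hn.trans hnn
  have hN' := hN.trans hNN
  simp only [costFormula, iterationFormula, subroutineFormula, rolloutFormula, stepFormula,
    drawFormula, testFormula, invFormula]
  gcongr

end Formula

/-! ### Worst-case cost of each subroutine. -/

section Costs

variable {S : Type u} {A : Type v} [MeasurableSpace S] [Fintype A] [MeasurableSpace A] [Nonempty A]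
  {d : ℕ} {M : MDP S A} (φ : FeatureMap S A d) (p : Params) (π₀ : Policy S A)
  (ws : List (Fin d → ℝ)) (C : List (S × A)) (w : ℕ)

theorem gramInvCost_eq (lam : ℝ) (xs : List (Fin d → ℝ)) :
    gramInvCost lam xs = d ^ 2 + 1 + xs.length * (7 * d ^ 2 + 2 * d + 2) := by
  rw [gramInvCost]
  induction xs using List.reverseRecOn with
  | nil => simp [gramInvProcedure]
  | append_singleton xs x ih =>
    have h : (gramInvProcedure lam (xs ++ [x])).2 = (gramInvProcedure lam xs).2 +
        (2 * d ^ 2 + 2 * d ^ 2 + 2 * d + 2 + 3 * d ^ 2) := by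
      simp [gramInvProcedure, List.foldl_append, rankOneUpdate]
    rw [h, ih, List.length_append, List.length_singleton]
    ring

theorem coreInvCost_eq : coreInvCost φ p C = invFormula p.featCost d C.length := by
  rw [coreInvCost, gramInvCost_eq, invFormula]
  simp [feats]

theorem invFormula_mono (f d : ℕ) {N N' : ℕ} (h : N ≤ N') :
    invFormula f d N ≤ invFormula f d N' := by
  simp only [invFormula]
  gcongr

theorem policyCost_le (h : ws.length ≤ p.K) :
    policyCost A p ws ≤ drawFormula (Fintype.card A) p.featCost d p.K := by
  cases ws with
  | nil => simp [policyCost, drawFormula]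
  | cons x ws =>
    simp only [policyCost, drawFormula]
    have : ws.length ≤ p.K := by
      rw [List.length_cons] at h
      omega
    have : Fintype.card A * (p.featCost + ws.length * (2 * d + 3) + 4) ≤
        Fintype.card A * (p.featCost + p.K * (2 * d + 3) + 4) := by gcongr
    omega

theorem scan_cost_le (s : S) (l : List A) :
    (scan φ p C s l).cost M w ≤ (w * (l.length * testFormula p.featCost d) : ℕ) := by
  induction l with
  | nil => simp [scan, Prog.cost]
  | cons a l ih =>
    simp only [scan, Prog.cost]
    have e : w * ((a :: l).length * testFormula p.featCost d) =
        w * testCost d p + w * (l.length * testFormula p.featCost d) := by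
      rw [List.length_cons, testCost, testFormula]
      ring
    rw [e, Nat.cast_add]
    refine add_le_add_right ?_ _
    split_ifs with h
    · simp [Prog.cost]
    · exact ih

variable {ws}

theorem rolloutSteps_cost_le (h : ws.length ≤ p.K) (k : ℕ) (s : S) (disc G : ℝ) :
    (rolloutSteps M.γ φ p π₀ ws C k s disc G).cost M w ≤
      (k * stepFormula w (Fintype.card A) p.featCost d p.K : ℕ) := by
  induction k generalizing s disc G with
  | zero => simp [rolloutSteps, Prog.cost]
  | succ k ih =>
    set u := stepFormula w (Fintype.card A) p.featCost d p.K with hu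
    have hpc := policyCost_le (A := A) p ws h
    rw [rolloutSteps]
    refine (Prog.cost_bind_le (scan_sat φ p C s _) (scan_cost_le φ p C w s _)
      (b := w * drawFormula (Fintype.card A) p.featCost d p.K + (1 + (w * 3 + k * u)))
      fun o _ => ?_).trans ?_
    · cases o with
      | some a => simp [Prog.cost]
      | none =>
        simp only [Prog.cost]
        rw [Nat.cast_add]
        refine add_le_add (Nat.cast_le.2 (Nat.mul_le_mul_left w hpc)) (iSup_le fun a => ?_)
        rw [Nat.cast_add]
        refine add_le_add (by simp) (iSup_le fun s' => ?_)
        rw [Nat.cast_add]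
        exact add_le_add_right (ih _ _ _) _
    · refine le_of_eq ?_
      congr 1
      rw [Finset.length_toList, Finset.card_univ, add_mul, one_mul]
      nth_rewrite 3 [hu]
      rw [stepFormula]
      ring

theorem oneRollout_cost_le (h : ws.length ≤ p.K) (z : S × A) :
    (oneRollout M.γ φ p π₀ ws C z).cost M w ≤
      (1 + p.n * stepFormula w (Fintype.card A) p.featCost d p.K : ℕ) := by
  simp only [oneRollout, Prog.cost]
  rw [Nat.cast_add, Nat.cast_one]
  exact add_le_add_right (iSup_le fun s' => rolloutSteps_cost_le φ p π₀ C w h _ _ _ _) _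

theorem rollouts_cost_le (h : ws.length ≤ p.K) (z : S × A) (k : ℕ) (total : ℝ) :
    (rollouts M.γ φ p π₀ ws C z k total).cost M w ≤
      (rolloutFormula w (Fintype.card A) p.featCost d p.K k p.n : ℕ) := by
  induction k generalizing total with
  | zero => simp [rollouts, Prog.cost]
  | succ k ih =>
    rw [rollouts]
    refine (Prog.cost_bind_le (oneRollout_sat φ p π₀ ws C z) (oneRollout_cost_le φ p π₀ C w h z)
      (b := w + rolloutFormula w (Fintype.card A) p.featCost d p.K k p.n) fun res _ => ?_).trans ?_
    · cases res with
      | inl z' => simp [Prog.cost]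
      | inr G =>
        simp only [Prog.cost, mul_one]
        rw [Nat.cast_add]
        exact add_le_add_right (ih _) _
    · refine le_of_eq ?_
      congr 1
      simp only [rolloutFormula]
      ring

theorem confidentRollout_cost_le (h : ws.length ≤ p.K) (z : S × A) :
    (confidentRollout M.γ φ p π₀ ws C z).cost M w ≤
      (subroutineFormula w (Fintype.card A) p.featCost d p.K p.m p.n C.length : ℕ) := by
  simp only [confidentRollout, Prog.cost]
  have e : subroutineFormula w (Fintype.card A) p.featCost d p.K p.m p.n C.length =
      w * coreInvCost φ p C +
        (rolloutFormula w (Fintype.card A) p.featCost d p.K p.m p.n + w) := by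
    rw [subroutineFormula, coreInvCost_eq]
    ring
  rw [e, Nat.cast_add]
  refine add_le_add_right (Prog.cost_bind_le (rollouts_sat φ p π₀ ws C z _ _)
    (rollouts_cost_le φ p π₀ C w h z _ _) fun res _ => ?_) _
  cases res with
  | inl z' => simp [Prog.cost]
  | inr G => simp [Prog.cost]

theorem evaluate_cost_le (h : ws.length ≤ p.K) (zs : List (S × A)) (qs : List ℝ) :
    (evaluate M.γ φ p π₀ ws C zs qs).cost M w ≤ (zs.length *
      subroutineFormula w (Fintype.card A) p.featCost d p.K p.m p.n C.length : ℕ) := by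
  induction zs generalizing qs with
  | nil => simp [evaluate, Prog.cost]
  | cons z zs ih =>
    rw [evaluate, List.length_cons, add_mul, one_mul, add_comm (_ * _)]
    refine Prog.cost_bind_le (confidentRollout_sat φ p π₀ ws C z)
      (confidentRollout_cost_le φ p π₀ C w h z) fun res _ => ?_
    cases res with
    | inl z' => simp [Prog.cost]
    | inr q => exact ih _

theorem policyIteration_cost_le (k : ℕ) (h : ws.length + k ≤ p.K) :
    (policyIteration M.γ φ p π₀ C k ws).cost M w ≤ (k *
      iterationFormula w (Fintype.card A) p.featCost d p.K p.m p.n C.length : ℕ) := by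
  induction k generalizing ws with
  | zero => simp [policyIteration, Prog.cost]
  | succ k ih =>
    set t := iterationFormula w (Fintype.card A) p.featCost d p.K p.m p.n C.length with ht
    rw [policyIteration]
    refine (Prog.cost_bind_le (evaluate_sat φ p π₀ ws C C [])
      (evaluate_cost_le φ p π₀ C w (by omega) C []) (b := w * ridgeCost φ p C + k * t)
      fun res _ => ?_).trans ?_
    · cases res with
      | inl z' => simp [Prog.cost]
      | inr q =>
        simp only [Prog.cost]
        rw [Nat.cast_add]
        refine add_le_add_right (ih ?_) _
        rw [List.length_append, List.length_singleton]
        omega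
    · refine le_of_eq ?_
      congr 1
      rw [add_mul, one_mul]
      nth_rewrite 3 [ht]
      rw [iterationFormula, ridgeCost, coreInvCost_eq]
      ring

variable {φ p C}

theorem iterationFormula_mono (w a f d K m n : ℕ) {N N' : ℕ} (h : N ≤ N') :
    iterationFormula w a f d K m n N ≤ iterationFormula w a f d K m n N' := by
  simp only [iterationFormula, subroutineFormula, invFormula]
  gcongr

/-- The bound counts the restarts `j` that the core set still permits and not the cutoff `R`, so it
survives the supremum over cutoffs. -/
theorem restartLoop_cost_le (hd : 0 < d) (hlam : 0 < p.lam) (htau : p.tau = 1) (R j : ℕ)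
    (hC : CoreInv φ p M.ρ C) (hj : coreBound d p.lam + 1 ≤ C.length + j) :
    (restartLoop M.γ φ p π₀ R C).cost M w ≤ (j * (p.K *
      iterationFormula w (Fintype.card A) p.featCost d p.K p.m p.n (coreBound d p.lam)) : ℕ) := by
  induction R generalizing C j with
  | zero => simp [restartLoop, Prog.cost]
  | succ R ih =>
    have hlen := hC.length_le_coreBound hd hlam
    obtain ⟨i, rfl⟩ : ∃ i, j = i + 1 := ⟨j - 1, by omega⟩
    rw [restartLoop, add_mul, one_mul, add_comm (_ * _)]
    refine Prog.cost_bind_le (policyIteration_sat φ p π₀ [] C p.K)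
      ((policyIteration_cost_le φ p π₀ C w p.K (by simp)).trans (Nat.cast_le.2
        (Nat.mul_le_mul_left _ (iterationFormula_mono _ _ _ _ _ _ _ hlen)))) fun res hres => ?_
    cases res with
    | inl z =>
      refine ih i (hC.append hlam htau (hres z rfl)) ?_
      rw [List.length_append, List.length_singleton]
      omega
    | inr ws => simp [Prog.cost]

theorem initCore_cost_le (ρ : S) (l : List A) (C : List (S × A)) {N : ℕ}
    (hN : C.length + l.length ≤ N) :
    (initCore φ p ρ l C).cost M w ≤
      (l.length * (w * (invFormula p.featCost d N + testFormula p.featCost d)) : ℕ) := by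
  induction l generalizing C with
  | nil => simp [initCore, Prog.cost]
  | cons a l ih =>
    rw [List.length_cons] at hN
    simp only [initCore, Prog.cost]
    rw [List.length_cons, add_mul, one_mul, add_comm (_ * _), Nat.cast_add]
    refine add_le_add (Nat.cast_le.2 (Nat.mul_le_mul_left w ?_)) ?_
    · rw [coreInvCost_eq]
      exact add_le_add (invFormula_mono _ _ (by omega)) le_rfl
    · split_ifs with h
      · refine ih _ ?_
        rw [List.length_append, List.length_singleton]
        omega
      · exact ih _ (by omega)

variable (φ p)

theorem politex_cost_le (hd : 0 < d) (hlam : 0 < p.lam) (htau : p.tau = 1) (R : ℕ) :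
    (politex M.γ φ p π₀ M.ρ R).cost M w ≤ (costFormula w (Fintype.card A) p.featCost d p.K p.m p.n
      (coreBound d p.lam) : ℕ) := by
  obtain ⟨C, hC, hinit⟩ := exists_initCore_univ (M := M) (φ := φ) hlam htau
  have hC1 : 1 ≤ C.length := List.length_pos_iff.2 hC.1
  -- During initialization the size of the core set is bounded simply by the number of actions.
  have h1 := initCore_cost_le (M := M) (φ := φ) (p := p) w M.ρ Finset.univ.toList []
    (N := Fintype.card A) (by simp)
  rw [Finset.length_toList, Finset.card_univ] at h1
  rw [politex, costFormula]
  refine Prog.cost_bind_le (hinit (fun C' => C' = C) rfl).2 h1 fun C' hC' => ?_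
  subst hC'
  exact restartLoop_cost_le π₀ w hd hlam htau R _ hC (by omega)

theorem costLE_of_le {k : ℕ} {c : ℕ∞} {n : ℕ} {P : MvPolynomial (Fin k) ℝ} {x : Fin k → ℝ}
    (hc : c ≤ n) (h : (n : ℝ) ≤ MvPolynomial.eval x P) : CostLE c P x := by
  rw [CostLE]
  calc (c : ENNReal) ≤ ((n : ℕ∞) : ENNReal) := ENat.toENNReal_le.2 hc
    _ = ENNReal.ofReal n := by simp
    _ ≤ _ := ENNReal.ofReal_le_ofReal h

end Costs

/-! ### Polynomials in six variables: dimension, horizon, inverse accuracy, `log (1 / δ)`, `log⁺ b`,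
and a bound for `log |A|`. -/

section Polynomials

variable {R : Type*} [CommSemiring R]

/-- Polynomial bound for `1 + log (1 + lam⁻¹)`. -/
def logFactorPoly (x : Fin 6 → R) : R := 257 + 2 * x 4 + 2 * x 1 + 2 * x 2

/-- Polynomial bound for the number of iterations. -/
def iterationsPoly (x : Fin 6 → R) : R := 32 * x 5 * x 1 ^ 4 * x 2 ^ 2 + 1

/-- Polynomial bound for the rollout length. -/
def lengthPoly (x : Fin 6 → R) : R := 32 * x 0 * logFactorPoly x * x 1 ^ 3 * x 2 + 1

/-- Polynomial bound for the number of rollouts. -/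
def rolloutsPoly (x : Fin 6 → R) : R :=
  1024 * x 0 * logFactorPoly x * x 1 ^ 4 * x 2 ^ 2 *
    (8 * iterationsPoly x * x 0 * logFactorPoly x + x 3) + 1

/-- Polynomial bound for the cost of the algorithm. -/
def costPoly (w a f : R) (x : Fin 6 → R) : R :=
  costFormula w a f (x 0) (iterationsPoly x) (rolloutsPoly x) (lengthPoly x)
    (3 * (x 0 * logFactorPoly x))

theorem map_costPoly {R' : Type*} [CommSemiring R'] (g : R →+* R') (w a f : R) (x : Fin 6 → R) :
    g (costPoly w a f x) = costPoly (g w) (g a) (g f) (fun i => g (x i)) := by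
  simp [costPoly, map_costFormula, iterationsPoly, rolloutsPoly, lengthPoly, logFactorPoly,
    map_ofNat]

/-- The number of actions and the feature cost enter only through operations. Hence the query cost
depends on `|A|` only through the parameters, that is, through `log |A|`. -/
theorem costFormula_zero (a f d K m n N a' f' : R) :
    costFormula 0 a f d K m n N = costFormula 0 a' f' d K m n N := by
  simp [costFormula, iterationFormula, subroutineFormula, rolloutFormula, stepFormula]

end Polynomials

end MCPolitex

end

noncomputable section

namespace MCPolitex

/-! ### Polynomial bounds for the parameters. -/

section Bounds

/-- One hypothesis covers both choices of `lam`. Replacing `b` by `max 1 b` yields `log⁺ b`; the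
logarithms of the horizon, of `1 + c` and of the constant are bounded linearly. -/
theorem logFactor_le {lam b H c : ℝ} (hlam : 0 < lam) (hb : 0 < b) (hH : 1 ≤ H) (hc : 0 < c)
    (h : lam⁻¹ ≤ 256 * b ^ 2 * H ^ 2 * c ^ 2) :
    logFactor lam ≤ 257 + 2 * Real.posLog b + 2 * H + 2 * c := by
  have hB1 : 1 ≤ max 1 b := le_max_left _ _
  have hlogB : Real.log (max 1 b) = Real.posLog b := by
    rw [Real.posLog_eq_log_max_one hb.le]
  have hB : b ≤ max 1 b := le_max_right _ _
  set B := max 1 b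
  have hB0 : 0 < B := by linarith
  have hH0 : 0 < H := by linarith
  have hle : 1 + lam⁻¹ ≤ 257 * (B ^ 2 * (H ^ 2 * (1 + c) ^ 2)) := by
    have h1 : 256 * b ^ 2 * H ^ 2 * c ^ 2 ≤ 256 * (B ^ 2 * (H ^ 2 * (1 + c) ^ 2)) := by
      calc 256 * b ^ 2 * H ^ 2 * c ^ 2 ≤ 256 * B ^ 2 * H ^ 2 * (1 + c) ^ 2 := by
            gcongr
            linarith
        _ = _ := by ring
    have h2 : 1 ≤ B ^ 2 * (H ^ 2 * (1 + c) ^ 2) :=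
      one_le_mul_of_one_le_of_one_le (one_le_pow₀ hB1)
        (one_le_mul_of_one_le_of_one_le (one_le_pow₀ hH) (one_le_pow₀ (by linarith)))
    linarith
  have hlog : Real.log (257 * (B ^ 2 * (H ^ 2 * (1 + c) ^ 2))) =
      Real.log 257 + (2 * Real.log B + (2 * Real.log H + 2 * Real.log (1 + c))) := by
    rw [Real.log_mul (by norm_num) (by positivity), Real.log_mul (by positivity) (by positivity),
      Real.log_mul (by positivity) (by positivity), Real.log_pow, Real.log_pow, Real.log_pow]
    norm_num
  have h1 := Real.log_le_log (by positivity) hle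
  have h2 := Real.log_le_sub_one_of_pos (show (0 : ℝ) < 257 by norm_num)
  have h3 := Real.log_le_sub_one_of_pos hH0
  have h4 := Real.log_le_sub_one_of_pos (show 0 < 1 + c by linarith)
  rw [logFactor]
  linarith

theorem ceil_le_add_one {t s : ℝ} (h : t ≤ s) (hs : 0 ≤ s) : (⌈t⌉₊ : ℝ) ≤ s + 1 :=
  (Nat.cast_le.2 (Nat.ceil_mono h)).trans (Nat.ceil_lt_add_one hs).le

theorem log_div_le {y δ : ℝ} (hy : 0 ≤ y) (hδ : 0 < δ) (hδ1 : δ < 1) :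
    Real.log (y / δ) ≤ y + Real.log (1 / δ) := by
  rcases hy.eq_or_lt with rfl | hy
  · rw [zero_div, Real.log_zero, zero_add]
    exact Real.log_nonneg ((one_le_div hδ).2 hδ1.le)
  · rw [div_eq_mul_one_div, Real.log_mul hy.ne' (by positivity)]
    linarith [Real.log_le_sub_one_of_pos hy]

/-- The parameters are bounded by the polynomials in the variables `x`. -/
structure PolyBounded (p : Params) (d : ℕ) (x : Fin 6 → ℝ) : Prop where
  lam_pos : 0 < p.lam
  tau_eq : p.tau = 1
  eq_dim : x 0 = d
  iterations : (p.K : ℝ) ≤ iterationsPoly x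
  rollouts : (p.m : ℝ) ≤ rolloutsPoly x
  length : (p.n : ℝ) ≤ lengthPoly x
  logFactor : logFactor p.lam ≤ logFactorPoly x

theorem ceil_rollouts_le {K d : ℕ} {L T δ : ℝ} {x : Fin 6 → ℝ} (hx : ∀ i, 0 ≤ x i)
    (hdim : x 0 = d) (hδ : 0 < δ) (hδ1 : δ < 1) (hlog : x 3 = Real.log (1 / δ))
    (hK : (K : ℝ) ≤ iterationsPoly x) (hL0 : 0 ≤ L) (hL : L ≤ logFactorPoly x) (hT : 0 ≤ T)
    (hTle : T ≤ 1024 * x 0 * logFactorPoly x * x 1 ^ 4 * x 2 ^ 2) :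
    (⌈T * Real.log (8 * K * d * L / δ)⌉₊ : ℝ) ≤ rolloutsPoly x := by
  have h0 := hx 0
  have h1 := hx 1
  have h2 := hx 2
  have h3 := hx 3
  have hlf := hL0.trans hL
  have hit : 0 ≤ iterationsPoly x := (Nat.cast_nonneg K).trans hK
  have hlogle : Real.log (8 * K * d * L / δ) ≤
      8 * iterationsPoly x * x 0 * logFactorPoly x + x 3 := by
    refine (log_div_le (by positivity) hδ hδ1).trans ?_
    rw [hlog, hdim]
    gcongr
  refine ceil_le_add_one ?_ (by positivity)
  exact (mul_le_mul_of_nonneg_left hlogle hT).trans (mul_le_mul_of_nonneg_right hTle (by positivity))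

variable {nA d featCost : ℕ} {γ b δ y : ℝ}

theorem nonneg_variables {κ : ℝ} (hγ1 : γ < 1) (hκ : 0 < κ) (hδ : 0 < δ) (hδ1 : δ < 1)
    (hy : 0 ≤ y) (i : Fin 6) :
    0 ≤ (![(d : ℝ), 1 / (1 - γ), 1 / κ, Real.log (1 / δ), Real.posLog b, y] : Fin 6 → ℝ) i := by
  have h1 : 0 < 1 - γ := by linarith
  have h3 : 0 ≤ Real.log (1 / δ) := Real.log_nonneg ((one_le_div hδ).2 hδ1.le)
  have h4 : 0 ≤ Real.posLog b := Real.posLog_nonneg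
  fin_cases i <;> simp <;> first | positivity | simpa using h3 | assumption | linarith

theorem logFactorPoly_nonneg {x : Fin 6 → ℝ} (hx : ∀ i, 0 ≤ x i) : 0 ≤ logFactorPoly x := by
  have h1 := hx 1
  have h2 := hx 2
  have h4 := hx 4
  rw [logFactorPoly]
  positivity

theorem exactParams_polyBounded {κ : ℝ} (hγ : 0 < γ) (hγ1 : γ < 1) (hd : 0 < d) (hb : 0 < b)
    (hκ : 0 < κ) (hδ : 0 < δ) (hδ1 : δ < 1) (hy : 0 ≤ y) (hay : Real.log nA ≤ y) :
    PolyBounded (exactParams nA d γ b κ δ featCost) d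
      ![(d : ℝ), 1 / (1 - γ), 1 / κ, Real.log (1 / δ), Real.posLog b, y] := by
  have hg : 0 < 1 - γ := by linarith
  have hx := nonneg_variables (d := d) (b := b) hγ1 hκ hδ hδ1 hy
  have hH : 1 ≤ 1 / (1 - γ) := by rw [one_le_div hg]; linarith
  have hd1 : (1 : ℝ) ≤ d := by exact_mod_cast hd
  set x : Fin 6 → ℝ := ![(d : ℝ), 1 / (1 - γ), 1 / κ, Real.log (1 / δ), Real.posLog b, y] with hx_def
  have x0 : x 0 = d := rfl
  have x1 : x 1 = 1 / (1 - γ) := rfl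
  have x2 : x 2 = 1 / κ := rfl
  have x3 : x 3 = Real.log (1 / δ) := rfl
  have x4 : x 4 = Real.posLog b := rfl
  have x5 : x 5 = y := rfl
  have hlam : 0 < κ ^ 2 * (1 - γ) ^ 2 / (256 * b ^ 2) := by positivity
  have hL : logFactor (κ ^ 2 * (1 - γ) ^ 2 / (256 * b ^ 2)) ≤ logFactorPoly x := by
    rw [logFactorPoly, x1, x2, x4]
    refine logFactor_le hlam hb hH (by positivity) (le_of_eq ?_)
    field_simp
  have hL1 := one_le_logFactor hlam
  set L := logFactor (κ ^ 2 * (1 - γ) ^ 2 / (256 * b ^ 2)) with hL_def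
  have hlp := logFactorPoly_nonneg hx
  have hK : (⌈32 * Real.log nA / (κ ^ 2 * (1 - γ) ^ 4)⌉₊ : ℝ) ≤ iterationsPoly x := by
    refine ceil_le_add_one ?_ (by have := hx 5; have := hx 1; have := hx 2; positivity)
    rw [x1, x2, x5]
    calc 32 * Real.log nA / (κ ^ 2 * (1 - γ) ^ 4) ≤ 32 * y / (κ ^ 2 * (1 - γ) ^ 4) := by gcongr
      _ = _ := by field_simp
  refine ⟨hlam, rfl, rfl, hK, ?_, ?_, hL⟩
  · refine ceil_rollouts_le hx x0 hδ hδ1 x3 hK (zero_le_one.trans hL1) hL (by positivity) ?_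
    rw [x0, x1, x2]
    calc 1024 * (d * L / (κ ^ 2 * (1 - γ) ^ 4))
        ≤ 1024 * (d * logFactorPoly x / (κ ^ 2 * (1 - γ) ^ 4)) := by gcongr
      _ = _ := by field_simp
  · have h1 := hx 1
    have h2 := hx 2
    refine ceil_le_add_one ?_ (by have := hx 0; positivity)
    change 1 / (1 - γ) * Real.log (32 * √d * L / ((1 - γ) ^ 2 * κ)) ≤ _
    have hsd : √(d : ℝ) ≤ d := by
      rw [Real.sqrt_le_left (by positivity)]
      nlinarith
    have hlog := Real.log_le_self (show 0 ≤ 32 * √d * L / ((1 - γ) ^ 2 * κ) by positivity)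
    rw [x0, x1, x2]
    calc 1 / (1 - γ) * Real.log (32 * √d * L / ((1 - γ) ^ 2 * κ))
        ≤ 1 / (1 - γ) * (32 * d * logFactorPoly x / ((1 - γ) ^ 2 * κ)) := by
          gcongr
          refine hlog.trans ?_
          gcongr
      _ = _ := by field_simp

theorem approxParams_polyBounded {ε : ℝ} (hγ : 0 < γ) (hγ1 : γ < 1) (hd : 0 < d) (hb : 0 < b)
    (hε : 0 < ε) (hδ : 0 < δ) (hδ1 : δ < 1) (hy : 0 ≤ y) (hay : Real.log nA ≤ y) :
    PolyBounded (approxParams nA d γ b ε δ featCost) d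
      ![(d : ℝ), 1 / (1 - γ), 1 / ε, Real.log (1 / δ), Real.posLog b, y] := by
  have hg : 0 < 1 - γ := by linarith
  have hx := nonneg_variables (d := d) (b := b) hγ1 hε hδ hδ1 hy
  have hH : 1 ≤ 1 / (1 - γ) := by rw [one_le_div hg]; linarith
  have hd1 : (1 : ℝ) ≤ d := by exact_mod_cast hd
  set x : Fin 6 → ℝ := ![(d : ℝ), 1 / (1 - γ), 1 / ε, Real.log (1 / δ), Real.posLog b, y] with hx_def
  have x0 : x 0 = d := rfl
  have x1 : x 1 = 1 / (1 - γ) := rfl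
  have x2 : x 2 = 1 / ε := rfl
  have x3 : x 3 = Real.log (1 / δ) := rfl
  have x4 : x 4 = Real.posLog b := rfl
  have x5 : x 5 = y := rfl
  have hlam : 0 < ε ^ 2 * d / b ^ 2 := by positivity
  have hinv : (ε ^ 2 * d / b ^ 2)⁻¹ ≤ 256 * b ^ 2 * (1 / (1 - γ)) ^ 2 * (1 / ε) ^ 2 := by
    calc (ε ^ 2 * d / b ^ 2)⁻¹ = b ^ 2 * (1 / ε) ^ 2 * (1 / d) := by field_simp
      _ ≤ b ^ 2 * (1 / ε) ^ 2 * (256 * (1 / (1 - γ)) ^ 2) := by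
        gcongr
        have h1 : 1 / (d : ℝ) ≤ 1 := by rw [div_le_one (by positivity)]; exact hd1
        have h2 : 1 ≤ (1 / (1 - γ)) ^ 2 := one_le_pow₀ hH
        linarith
      _ = _ := by ring
  have hL : logFactor (ε ^ 2 * d / b ^ 2) ≤ logFactorPoly x := by
    rw [logFactorPoly, x1, x2, x4]
    exact logFactor_le hlam hb hH (by positivity) hinv
  have hL1 := one_le_logFactor hlam
  set L := logFactor (ε ^ 2 * d / b ^ 2) with hL_def
  have hlp := logFactorPoly_nonneg hx
  have h1 : 1 ≤ x 1 := hH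
  have h2 := hx 2
  have hK : (⌈2 * Real.log nA / (ε ^ 2 * d * (1 - γ) ^ 2)⌉₊ : ℝ) ≤ iterationsPoly x := by
    refine ceil_le_add_one ?_ (by have := hx 5; positivity)
    calc 2 * Real.log nA / (ε ^ 2 * d * (1 - γ) ^ 2) ≤ 32 * y / (ε ^ 2 * 1 * (1 - γ) ^ 2) := by
          gcongr
          linarith
      _ = 32 * x 5 * x 1 ^ 2 * x 2 ^ 2 := by rw [x1, x2, x5]; field_simp
      _ ≤ _ := by
        have := hx 5
        gcongr
        norm_num
  have hdL : 1 ≤ d * logFactorPoly x := one_le_mul_of_one_le_of_one_le hd1 (hL1.trans hL)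
  refine ⟨hlam, rfl, rfl, hK, ?_, ?_, hL⟩
  · refine ceil_rollouts_le hx x0 hδ hδ1 x3 hK (zero_le_one.trans hL1) hL (by positivity) ?_
    calc 1 / (ε ^ 2 * (1 - γ) ^ 2) = 1 * (x 1 ^ 2 * x 2 ^ 2) := by rw [x1, x2]; field_simp
      _ ≤ (1024 * (d * logFactorPoly x)) * (x 1 ^ 4 * x 2 ^ 2) := by
        gcongr
        · linarith
        · norm_num
      _ = _ := by rw [x0]; ring
  · refine ceil_le_add_one ?_ (by have := hx 0; positivity)
    have hlog := Real.log_le_self (show 0 ≤ 1 / (ε * (1 - γ)) by positivity)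
    calc 1 / (1 - γ) * Real.log (1 / (ε * (1 - γ)))
        ≤ 1 / (1 - γ) * (1 / (ε * (1 - γ))) := by gcongr
      _ = 1 * (x 1 ^ 2 * x 2) := by rw [x1, x2]; field_simp
      _ ≤ (32 * (d * logFactorPoly x)) * (x 1 ^ 3 * x 2) := by
        gcongr
        · linarith
        · norm_num
      _ = _ := by rw [x0]; ring

end Bounds

/-! ### The universal polynomials for both costs. -/

section Conclusion

variable {S : Type u} {A : Type v} [MeasurableSpace S] [Fintype A] [MeasurableSpace A] [Nonempty A]
  {d : ℕ} {M : MDP S A} (φ : FeatureMap S A d) {p : Params} (π₀ : Policy S A) {x : Fin 6 → ℝ}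

theorem PolyBounded.costFormula_le (hp : PolyBounded p d x) (hd : 0 < d) (w : ℕ) {a f : ℝ}
    (ha : (Fintype.card A : ℝ) ≤ a) (hf : (p.featCost : ℝ) ≤ f) :
    ((costFormula w (Fintype.card A) p.featCost d p.K p.m p.n (coreBound d p.lam) : ℕ) : ℝ) ≤
      costPoly (w : ℝ) a f x := by
  have h := map_costFormula (Nat.castRingHom ℝ) w (Fintype.card A) p.featCost d p.K p.m p.n
    (coreBound d p.lam)
  simp only [eq_natCast] at h
  rw [h, costPoly, hp.eq_dim]
  refine costFormula_mono (by positivity) (by positivity) (by positivity) (by positivity)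
    (by positivity) (by positivity) (by positivity) (by positivity) ha hf hp.iterations hp.rollouts
    hp.length ((coreBound_le hp.lam_pos).trans ?_)
  gcongr
  exact hp.logFactor

/-- Polynomial bound for the query cost. -/
def queryPoly : MvPolynomial (Fin 6) ℝ := costPoly 0 0 0 MvPolynomial.X

/-- Polynomial bound for the computational cost. -/
def computationPoly (Pφ : Polynomial ℝ) : MvPolynomial (Fin 6) ℝ :=
  costPoly 1 (MvPolynomial.X 5) (Polynomial.aeval (MvPolynomial.X 0) Pφ) MvPolynomial.X

theorem PolyBounded.queryCost_le (hp : PolyBounded p d x) (hd : 0 < d) :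
    CostLE (queryCost M φ p π₀) queryPoly x := by
  refine costLE_of_le (n := costFormula 0 (Fintype.card A) p.featCost d p.K p.m p.n
    (coreBound d p.lam)) (iSup_le fun R => ?_) ?_
  · rw [← Prog.cost_zero]
    exact politex_cost_le φ p π₀ 0 hd hp.lam_pos hp.tau_eq R
  · have h := hp.costFormula_le (A := A) hd 0 le_rfl le_rfl
    rw [Nat.cast_zero] at h
    rw [queryPoly, map_costPoly]
    simp only [MvPolynomial.eval_X, map_zero]
    rwa [costPoly, costFormula_zero _ _ _ _ _ _ _ (Fintype.card A : ℝ) (p.featCost : ℝ)]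

theorem PolyBounded.computationCost_le (hp : PolyBounded p d x) (hd : 0 < d) {Pφ : Polynomial ℝ}
    (hA : x 5 = Fintype.card A) (hf : (p.featCost : ℝ) ≤ Pφ.eval (d : ℝ)) :
    CostLE (computationCost M φ p π₀) (computationPoly Pφ) x := by
  refine costLE_of_le (n := costFormula 1 (Fintype.card A) p.featCost d p.K p.m p.n
    (coreBound d p.lam)) (iSup_le fun R => ?_) ?_
  · rw [← Prog.cost_one]
    exact politex_cost_le φ p π₀ 1 hd hp.lam_pos hp.tau_eq R
  · have h := hp.costFormula_le (A := A) hd 1 le_rfl hf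
    rw [Nat.cast_one] at h
    have hfeat : MvPolynomial.eval x (Polynomial.aeval (MvPolynomial.X 0) Pφ) =
        Pφ.eval (d : ℝ) := by
      rw [Polynomial.aeval_def, Polynomial.hom_eval₂, MvPolynomial.eval_X, hp.eq_dim,
        ← Polynomial.eval₂_id]
      congr 1
      ext r
      simp
    rw [computationPoly, map_costPoly, hfeat]
    simp only [MvPolynomial.eval_X, map_one]
    rwa [hA]

end Conclusion

end MCPolitex

end

theorem theorem2 :
    (∃ Pq : MvPolynomial (Fin 6) ℝ, ∀ Pφ : Polynomial ℝ, ∃ Pc : MvPolynomial (Fin 6) ℝ,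
      ∀ (S : Type u) [MeasurableSpace S] (A : Type v) [Fintype A] [Nonempty A] [MeasurableSpace A]
        [MeasurableSingletonClass A] (M : MCPolitex.MDP S A) (d : ℕ)
        (φ : MCPolitex.FeatureMap S A d) (π₀ : MCPolitex.Policy S A) (b κ δ : ℝ) (featCost : ℕ),
        2 ≤ Fintype.card A → 0 < d → 0 < b → 0 < κ → 0 < δ → δ < 1 →
        (featCost : ℝ) ≤ Pφ.eval (d : ℝ) →
        MCPolitex.Realizable M φ b →
        ENNReal.ofReal (1 - δ) ≤ MCPolitex.successProb M φ
            (MCPolitex.exactParams (Fintype.card A) d M.γ b κ δ featCost) π₀ κ ∧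
        MCPolitex.CostLE
          (MCPolitex.queryCost M φ
            (MCPolitex.exactParams (Fintype.card A) d M.γ b κ δ featCost) π₀)
          Pq ![(d : ℝ), 1 / (1 - M.γ), 1 / κ, Real.log (1 / δ), Real.posLog b,
            Real.log (Fintype.card A)] ∧
        MCPolitex.CostLE
          (MCPolitex.computationCost M φ
            (MCPolitex.exactParams (Fintype.card A) d M.γ b κ δ featCost) π₀)
          Pc ![(d : ℝ), 1 / (1 - M.γ), 1 / κ, Real.log (1 / δ), Real.posLog b,
            (Fintype.card A : ℝ)]) ∧
    (∃ Pq : MvPolynomial (Fin 6) ℝ, ∀ Pφ : Polynomial ℝ, ∃ Pc : MvPolynomial (Fin 6) ℝ,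
      ∀ (S : Type u) [MeasurableSpace S] (A : Type v) [Fintype A] [Nonempty A] [MeasurableSpace A]
        [MeasurableSingletonClass A] (M : MCPolitex.MDP S A) (d : ℕ)
        (φ : MCPolitex.FeatureMap S A d) (π₀ : MCPolitex.Policy S A) (b ε δ : ℝ) (featCost : ℕ),
        2 ≤ Fintype.card A → 0 < d → 0 < b → 0 < ε → 0 < δ → δ < 1 →
        (featCost : ℝ) ≤ Pφ.eval (d : ℝ) →
        MCPolitex.ApproxRealizable M φ b ε →
        ENNReal.ofReal (1 - δ) ≤ MCPolitex.successProb M φ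
            (MCPolitex.approxParams (Fintype.card A) d M.γ b ε δ featCost) π₀
            (42 * ε * √d / (1 - M.γ) * (1 + Real.log (1 + b ^ 2 / (ε ^ 2 * d)))) ∧
        MCPolitex.CostLE
          (MCPolitex.queryCost M φ
            (MCPolitex.approxParams (Fintype.card A) d M.γ b ε δ featCost) π₀)
          Pq ![(d : ℝ), 1 / (1 - M.γ), 1 / ε, Real.log (1 / δ), Real.posLog b,
            Real.log (Fintype.card A)] ∧
        MCPolitex.CostLE
          (MCPolitex.computationCost M φ
            (MCPolitex.approxParams (Fintype.card A) d M.γ b ε δ featCost) π₀)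
          Pc ![(d : ℝ), 1 / (1 - M.γ), 1 / ε, Real.log (1 / δ), Real.posLog b,
            (Fintype.card A : ℝ)]) := by
  refine ⟨⟨MCPolitex.queryPoly, fun Pφ => ⟨MCPolitex.computationPoly Pφ, ?_⟩⟩,
    ⟨MCPolitex.queryPoly, fun Pφ => ⟨MCPolitex.computationPoly Pφ, ?_⟩⟩⟩
  · intro S _ A _ _ _ _ M d φ π₀ b κ δ featCost hA hd hb hκ hδ hδ1 hf hreal
    exact ⟨MCPolitex.exact_successProb hA hd hb hκ hδ hδ1 hreal,
      (MCPolitex.exactParams_polyBounded M.γ_pos M.γ_lt_one hd hb hκ hδ hδ1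
        (Real.log_natCast_nonneg _) le_rfl).queryCost_le φ π₀ hd,
      -- For the computational cost the sixth variable is `|A|` itself: it counts the actions and
      -- also dominates `log |A|` in the bounds for the parameters.
      (MCPolitex.exactParams_polyBounded M.γ_pos M.γ_lt_one hd hb hκ hδ hδ1
        (Nat.cast_nonneg _) (Real.log_le_self (Nat.cast_nonneg _))).computationCost_le φ π₀ hd
        rfl hf⟩
  · intro S _ A _ _ _ _ M d φ π₀ b ε δ featCost hA hd hb hε hδ hδ1 hf hreal
    exact ⟨MCPolitex.approx_successProb hA hd hb hε hδ hδ1 hreal,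
      (MCPolitex.approxParams_polyBounded M.γ_pos M.γ_lt_one hd hb hε hδ hδ1
        (Real.log_natCast_nonneg _) le_rfl).queryCost_le φ π₀ hd,
      (MCPolitex.approxParams_polyBounded M.γ_pos M.γ_lt_one hd hb hε hδ hδ1
        (Nat.cast_nonneg _) (Real.log_le_self (Nat.cast_nonneg _))).computationCost_le φ π₀ hd
        rfl hf⟩
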